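/- Consider $L\ge 2$ cells, each with an $N$-antenna base station and $K\le N$ single-antenna users. Let $\beta_{lij}>0$ be the large-scale fading between user $j$ of cell $i$ and base station $l$, $p_r>0$ the transmit power, $\tau\ge K$ the pilot length, $0<|\alpha|\le 1$ the temporal correlation, and $$\hat\beta_{lij}=\frac{\beta_{lij}^2}{\sum_{i'=1}^{L}\beta_{li'j}+\frac1{\tau p_r}} .$$ Fix a cell $l$ and a user $k$. Let $\hat G_{ll}\in\mathbb C^{N\times K}$ be the channel estimate of cell $l$ at time $n-1$, with $(\cdot,j)$ entries of law $\mathcal{CN}(0,\hat\beta_{llj})$; let $\tilde G_{li}$ be the estimation errors, with entries of law $\mathcal{CN}(0,\beta_{lij}-\hat\beta_{lij})$, and $E_{li}$ the innovations of the autoregression $G_{li}[n]=\alpha G_{li}[n-1]+E_{li}[n]$, with entries of law $\mathcal{CN}(0,(1-\alpha^2)\beta_{lij})$, $i=1,\dots,L$; all these entries are mutually independent. Because of pilot reuse, $\hat G_{li}=\hat G_{ll}\,\mathrm{diag}(\beta_{li1}/\beta_{ll1},\dots,\beta_{liK}/\beta_{llK})$. Put $\tilde E_{li}=\alpha\tilde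 G_{li}+E_{li}$ and let $[\hat G_{ll}^\dagger]_k$ be the $k$th row of the pseudo-inverse. The SINR after zero forcing is $$\gamma_k=\frac{\alpha^2p_r}{\alpha^2p_r\sum_{i\ne l}\|[\hat G_{ll}^\dagger]_k\hat G_{li}\|^2+p_r\sum_{i=1}^L\|[\hat G_{ll}^\dagger]_k\tilde E_{li}\|^2+\|[\hat G_{ll}^\dagger]_k\|^2}$$ and the ergodic uplink rate is $R_{lk}=\mathbb E[\log_2(1+\gamma_k)]$. Let $C=\sum_{i\ne l}(\beta_{lik}/\beta_{llk})^2$, $M=N-K$, and let $\mathcal A$ be the $KL\times KL$ diagonal matrix with diagonal elements $\beta_{lij}-\alpha^2\hat\beta_{lij}$ ($1\le i\le L$, $1\le j\le K$). Let $\mu_1,\dots,\mu_\varrho$ be its distinct diagonal elements, with multiplicities $\tau_1,\dots,\tau_\varrho$, and let $\mathcal X_{p,q}$ be its characteristic coefficients, i.e. the partial fraction coefficients in $\det(I+v\mathcal A)^{-1}=\sum_{p=1}^{\varrho}\sum_{q=1}^{\tau_p}\mathcal X_{p,q}(1+v\mu_p)^{-q}$. Assume that $\frac1{\mu_p}\ne\frac1{\hat\beta_{llk}\alpha^2(C+1)}$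 and $\frac1{\mu_p}\ne\frac1{\hat\beta_{llk}\alpha^2C}$ for all $p$, so that the closed form below is defined. Then $\log_2(1+\gamma_k)$ is integrable and $$R_{lk}=\sum_{p=1}^{\varrho}\sum_{q=1}^{\tau_p}\frac{\mathcal X_{p,q}\,\mu_p^{-q}\log_2e}{(q-1)!\,M!\,\hat\beta_{llk}^{M+1}}\bigl(\mathcal I_{p,q}(C+1)-\mathcal I_{p,q}(C)\bigr),$$ where ($\mathcal I_1=\mathcal I_{p,q}(C+1)$, $\mathcal I_2=\mathcal I_{p,q}(C)$), with $a_c=\frac1{\hat\beta_{llk}\alpha^2c}$ and $b_c=\frac{1}{\hat\beta_{llk}\alpha^2p_rc}$, $$\mathcal I_{p,q}(c)=\sum_{t=0}^{M}\frac{(-1)^{M-t}M!\,\hat\beta_{llk}^{M+1}}{(M-t)!}\Bigl[-e^{b_c}\mathcal J_{q-1,M-t}\bigl(a_c,b_c,\tfrac1{\mu_p}-a_c\bigr)+\sum_{u=1}^{M-t}(u-1)!(-1)^u\,p_r^{-q}\,b_c^{M-t-u}\,\Gamma(q)\,U\bigl(q,q+1+M-t-u,\tfrac1{\mu_pp_r}\bigr)\Bigr],$$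 $U(x,y,z)=\frac1{\Gamma(x)}\int_0^\infty e^{-zt}t^{x-1}(1+t)^{y-x-1}dt$ is the confluent hypergeometric function of the second kind, $\mathrm{Ei}(x)=\int_{-\infty}^x\frac{e^t}tdt$ ($x<0$), and, with $k^{\underline s}=k(k-1)\cdots(k-s+1)$, $$\mathcal J_{m,n}(a,b,c)=\sum_{r=0}^m\binom mr(-b)^{m-r}\Bigl[\sum_{s=0}^{n+r}\frac{(n+r)^{\underline s}\,b^{n+r-s}}{c^{s+1}a^{m-s}}\mathrm{Ei}(-b)-\frac{(n+r)!\,e^{cb/a}}{c^{n+r+1}a^{m-n-r}}\mathrm{Ei}\bigl(-\tfrac{cb}a-b\bigr)+\frac{e^{-b}}c\sum_{s=0}^{n+r-1}\sum_{v=0}^{n+r-s-1}\frac{v!\,(n+r)^{\underline s}\binom{n+r-s-1}{v}b^{n+r-s-v-1}}{c^sa^{m-s}(c/a+1)^{v+1}}\Bigr].$$ If moreover all diagonal elements of $\mathcal A$ are distinct, then $\varrho=KL$, all $\tau_p=1$, $\mathcal X_{p,1}=\prod_{q\ne p}(1-\mu_q/\mu_p)^{-1}$, and $$R_{lk}=\sum_{p=1}^{KL}\sum_{t=0}^{M}\frac{\prod_{q\ne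 p}(1-\mu_q/\mu_p)^{-1}\log_2e}{(M-t)!\,(-1)^{M-t}\mu_p}\bigl(\bar{\mathcal I}_{p,t}(C+1)-\bar{\mathcal I}_{p,t}(C)\bigr),$$ $$\bar{\mathcal I}_{p,t}(c)=-e^{b_c}\mathcal J_{0,M-t}\bigl(a_c,b_c,\tfrac1{\mu_p}-a_c\bigr)+\sum_{u=1}^{M-t}(u-1)!(-1)^u\,a_c^{M-t-u}\,e^{1/(\mu_pp_r)}\mu_p^{M-t-u+1}\,\Gamma\bigl(M-t-u+1,\tfrac1{\mu_pp_r}\bigr),$$ where $\Gamma(s,x)=\int_x^\infty t^{s-1}e^{-t}dt$. -/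

import Mathlib

open MeasureTheory ProbabilityTheory

noncomputable section

/-! ## Special functions -/

/-- The exponential integral `Ei(x) = ∫_{-∞}^x e^t / t dt`, for `x < 0` (the only arguments at
which it is used). -/
def expIntegralEi (x : ℝ) : ℝ := ∫ t in Set.Iic x, Real.exp t / t

/-- The confluent hypergeometric function of the second kind,
`U(a, b, z) = Γ(a)⁻¹ ∫_0^∞ e^{-zt} t^{a-1} (1+t)^{b-a-1} dt`, for `a > 0` and `z > 0`. -/
def confluentU (a b z : ℝ) : ℝ :=
  (Real.Gamma a)⁻¹ *
    ∫ t in Set.Ioi (0 : ℝ), Real.exp (-(z * t)) * t ^ (a - 1) * (1 + t) ^ (b - a - 1)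

/-- The upper incomplete gamma function `Γ(s, x) = ∫_x^∞ t^{s-1} e^{-t} dt`, for `x > 0`. -/
def upperGamma (s x : ℝ) : ℝ := ∫ t in Set.Ioi x, t ^ (s - 1) * Real.exp (-t)

/-- The finite sum `𝒥_{m,n}(a, b, c)`. Here `(n + r).descFactorial s` is the falling factorial
`(n+r)(n+r-1)⋯(n+r-s+1)`. -/
def calJ (m n : ℕ) (a b c : ℝ) : ℝ :=
  ∑ r ∈ Finset.range (m + 1), (m.choose r : ℝ) * (-b) ^ (m - r) *
    ((∑ s ∈ Finset.range (n + r + 1),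
        ((n + r).descFactorial s : ℝ) * b ^ (n + r - s) /
          (c ^ (s + 1) * a ^ ((m : ℤ) - (s : ℤ))) * expIntegralEi (-b))
      - ((n + r).factorial : ℝ) * Real.exp (c * b / a) /
          (c ^ (n + r + 1) * a ^ ((m : ℤ) - (n : ℤ) - (r : ℤ))) *
          expIntegralEi (-(c * b / a) - b)
      + Real.exp (-b) / c *
        ∑ s ∈ Finset.range (n + r), ∑ u ∈ Finset.range (n + r - s),
          (u.factorial : ℝ) * ((n + r).descFactorial s : ℝ) *
              ((n + r - s - 1).choose u : ℝ) * b ^ (n + r - s - u - 1) /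
            (c ^ s * a ^ ((m : ℤ) - (s : ℤ)) * (c / a + 1) ^ (u + 1)))

/-! ## Distinct diagonal elements and characteristic coefficients

A real diagonal matrix is given by the family `d` of its diagonal elements. -/

/-- The set of distinct diagonal elements. -/
def distinctEntries {ι : Type*} [Fintype ι] (d : ι → ℝ) : Finset ℝ :=
  open Classical in Finset.univ.image d

/-- The multiplicity of the value `μ` among the diagonal elements. -/
def entryMult {ι : Type*} [Fintype ι] (d : ι → ℝ) (μ : ℝ) : ℕ :=
  open Classical in (Finset.univ.filter fun s => d s = μ).card

/-- The characteristic coefficient of order `q` at the diagonal element `μ`, i.e. the coefficient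
of `(1 + μ v)^{-q}` in the partial fraction expansion of `det (I + v diag d)⁻¹` in `v`. With
`τ` the multiplicity of `μ`, it is
`1 / ((τ - q)! μ^(τ - q))` times the derivative of order `τ - q` of
`(1 + μ v)^τ det (I + v diag d)⁻¹` at `v = - 1 / μ` (with the factor `1 + μ v` cancelled). -/
def charCoeff {ι : Type*} [Fintype ι] (d : ι → ℝ) (μ : ℝ) (q : ℕ) : ℝ :=
  (((entryMult d μ - q).factorial : ℝ) * μ ^ (entryMult d μ - q))⁻¹ *
    iteratedDeriv (entryMult d μ - q)
      (fun v : ℝ => ∏ ν ∈ (distinctEntries d).erase μ, ((1 + ν * v) ^ entryMult d ν)⁻¹)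
      (-1 / μ)

/-! ## The multicell uplink with MMSE channel estimates and channel aging -/

/-- The law `CN(0, v)` of a circularly symmetric complex Gaussian variable with variance `v`:
independent real and imaginary parts with law `N(0, v / 2)`. -/
def complexGaussian (v : ℝ) : Measure ℂ :=
  ((gaussianReal 0 (v / 2).toNNReal).prod (gaussianReal 0 (v / 2).toNNReal)).map
    Complex.measurableEquivRealProd.symm

variable {N K L : ℕ} {Ω : Type*}

/-- The variance of the entries of the MMSE estimate of the channel from user `j` of cell `i` to
base station `l`, with pilot sequences of length `τ` and `p_tr = τ p`. -/
def betaHat (β : Fin L → Fin L → Fin K → ℝ) (τ : ℕ) (p : ℝ) (l i : Fin L) (j : Fin K) : ℝ :=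
  β l i j ^ 2 / (∑ i' : Fin L, β l i' j + 1 / ((τ : ℝ) * p))

/-- The diagonal elements `β_{lij} - α² β̂_{lij}` of the `KL × KL` diagonal matrix `𝒜`. -/
def errVar (β : Fin L → Fin L → Fin K → ℝ) (τ : ℕ) (p α : ℝ) (l : Fin L) :
    Fin L × Fin K → ℝ :=
  fun s => β l s.1 s.2 - α ^ 2 * betaHat β τ p l s.1 s.2

/-- The pilot contamination constant `C`. -/
def pilotC (β : Fin L → Fin L → Fin K → ℝ) (l : Fin L) (k : Fin K) : ℝ :=
  ∑ i ∈ Finset.univ.erase l, (β l i k / β l l k) ^ 2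

/-- The channel model at base station `l`: `Ghat` is the estimate, made at time `n - 1`, of the
channel of the users in cell `l`; `Gtil i` is the error at time `n - 1` of the channel estimate of
the users in cell `i`; `E i` is the innovation of the autoregressive model
`G_{li}[n] = α G_{li}[n-1] + E_{li}[n]`. All entries are independent circularly symmetric complex
Gaussian variables. -/
structure IsChannelModel [MeasurableSpace Ω] (P : Measure Ω)
    (β : Fin L → Fin L → Fin K → ℝ) (τ : ℕ) (p α : ℝ) (l : Fin L)
    (Ghat : Ω → Matrix (Fin N) (Fin K) ℂ)
    (Gtil E : Fin L → Ω → Matrix (Fin N) (Fin K) ℂ) : Prop where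
  estimate_law : ∀ a j,
    HasLaw (fun ω => Ghat ω a j) (complexGaussian (betaHat β τ p l l j)) P
  error_law : ∀ i a j,
    HasLaw (fun ω => Gtil i ω a j) (complexGaussian (β l i j - betaHat β τ p l i j)) P
  innovation_law : ∀ i a j,
    HasLaw (fun ω => E i ω a j) (complexGaussian ((1 - α ^ 2) * β l i j)) P
  indep : iIndepFun
    (fun (s : (Fin N × Fin K) ⊕ (Fin L × Fin N × Fin K) ⊕ (Fin L × Fin N × Fin K)) (ω : Ω) =>
      match s with
      | Sum.inl (a, j) => Ghat ω a j
      | Sum.inr (Sum.inl (i, a, j)) => Gtil i ω a j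
      | Sum.inr (Sum.inr (i, a, j)) => E i ω a j) P

/-- The pseudo-inverse `(Gᴴ G)⁻¹ Gᴴ` of a matrix of full column rank. -/
def pinv (G : Matrix (Fin N) (Fin K) ℂ) : Matrix (Fin K) (Fin N) ℂ :=
  (G.conjTranspose * G)⁻¹ * G.conjTranspose

/-- The squared Euclidean norm of the row `k` of a complex matrix. -/
def rowNormSq {m n : ℕ} (M : Matrix (Fin m) (Fin n) ℂ) (k : Fin m) : ℝ :=
  ∑ j : Fin n, ‖M k j‖ ^ 2

/-- The estimated channels of the users in cell `i`, which is `Ĝ_{ll} D_i` with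
`D_i = diag (β_{lij} / β_{llj})`, because the pilot sequences are reused in all cells. -/
def crossEstimate (β : Fin L → Fin L → Fin K → ℝ) (l i : Fin L)
    (Ghat : Matrix (Fin N) (Fin K) ℂ) : Matrix (Fin N) (Fin K) ℂ :=
  Ghat * Matrix.diagonal fun j => ((β l i j / β l l j : ℝ) : ℂ)

/-- The combined error `Ẽ_{li}[n] = α G̃_{li}[n-1] + E_{li}[n]` of estimation and aging, so that
`G_{li}[n] = α Ĝ_{li}[n-1] + Ẽ_{li}[n]`. -/
def combinedError (α : ℝ) (Gtil E : Matrix (Fin N) (Fin K) ℂ) : Matrix (Fin N) (Fin K) ℂ :=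
  (α : ℂ) • Gtil + E

/-- The SINR of user `k` of cell `l` after zero-forcing detection at base station `l`. -/
def zfSINR (β : Fin L → Fin L → Fin K → ℝ) (p α : ℝ) (l : Fin L) (k : Fin K)
    (Ghat : Matrix (Fin N) (Fin K) ℂ) (Gtil E : Fin L → Matrix (Fin N) (Fin K) ℂ) : ℝ :=
  α ^ 2 * p /
    (α ^ 2 * p * ∑ i ∈ Finset.univ.erase l, rowNormSq (pinv Ghat * crossEstimate β l i Ghat) k
      + p * ∑ i, rowNormSq (pinv Ghat * combinedError α (Gtil i) (E i)) k
      + rowNormSq (pinv Ghat) k)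

/-- The ergodic rate `E[log₂ (1 + γ)]` in bits/s/Hz of a link with random SINR `γ`. -/
def ergodicRate [MeasurableSpace Ω] (P : Measure Ω) (γ : Ω → ℝ) : ℝ :=
  ∫ ω, Real.logb 2 (1 + γ ω) ∂P

/-! ## The closed forms -/

/-- The auxiliary sum: it is `ℐ₁` for `c = C + 1` and `ℐ₂` for `c = C`, with `M = N - K` and
`bh = β̂_{llk}`. -/
def auxI (M q : ℕ) (bh α p c μ : ℝ) : ℝ :=
  ∑ t ∈ Finset.range (M + 1),
    (-1) ^ (M - t) * (M.factorial : ℝ) * bh ^ (M + 1) / ((M - t).factorial : ℝ) *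
    (-Real.exp (1 / (bh * α ^ 2 * p * c)) *
        calJ (q - 1) (M - t) (1 / (bh * α ^ 2 * c)) (1 / (bh * α ^ 2 * p * c))
          (1 / μ - 1 / (bh * α ^ 2 * c))
      + ∑ u ∈ Finset.Icc 1 (M - t),
          ((u - 1).factorial : ℝ) * (-1) ^ u * (p ^ q)⁻¹ / (bh * α ^ 2 * p * c) ^ (M - t - u) *
            Real.Gamma (q : ℝ) *
            confluentU (q : ℝ) ((q + 1 + (M - t - u) : ℕ) : ℝ) (1 / (μ * p)))

/-- The term of index `t` of the auxiliary sum for distinct diagonal elements: `c = C + 1` for the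
first one and `c = C` for the second one. -/
def auxIBar (M t : ℕ) (bh α p c μ : ℝ) : ℝ :=
  -Real.exp (1 / (bh * α ^ 2 * p * c)) *
      calJ 0 (M - t) (1 / (bh * α ^ 2 * c)) (1 / (bh * α ^ 2 * p * c))
        (1 / μ - 1 / (bh * α ^ 2 * c))
    + ∑ u ∈ Finset.Icc 1 (M - t),
        ((u - 1).factorial : ℝ) * (-1) ^ u / (bh * α ^ 2 * c) ^ (M - t - u) *
          Real.exp (1 / (μ * p)) * μ ^ (M - t - u + 1) *
          upperGamma ((M - t - u + 1 : ℕ) : ℝ) (1 / (μ * p))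

/-- The closed form of the rate in the general case; `d` lists the diagonal elements of `𝒜`. -/
def rateClosedForm {ι : Type*} [Fintype ι] (d : ι → ℝ) (M : ℕ) (bh α p C : ℝ) : ℝ :=
  ∑ μ ∈ distinctEntries d, ∑ q ∈ Finset.Icc 1 (entryMult d μ),
    charCoeff d μ q * (μ ^ q)⁻¹ * Real.logb 2 (Real.exp 1) /
        (((q - 1).factorial : ℝ) * (M.factorial : ℝ) * bh ^ (M + 1)) *
      (auxI M q bh α p (C + 1) μ - auxI M q bh α p C μ)

/-- The closed form of the rate when the diagonal elements of `𝒜` are distinct. -/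
def rateClosedFormDistinct {ι : Type*} [Fintype ι] (d : ι → ℝ) (M : ℕ) (bh α p C : ℝ) : ℝ :=
  open Classical in
  ∑ s : ι, ∑ t ∈ Finset.range (M + 1),
    (∏ s' ∈ Finset.univ.erase s, (1 - d s' / d s)⁻¹) * Real.logb 2 (Real.exp 1) /
        (((M - t).factorial : ℝ) * (-1) ^ (M - t) * d s) *
      (auxIBar M t bh α p (C + 1) (d s) - auxIBar M t bh α p C (d s))

end

/-! Write X for the reciprocal of ‖[Ĝ†]_k‖² and Y for the filtered error power divided by ‖[Ĝ†]_k‖².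
Almost surely Ĝ has full column rank, so Ĝ†Ĝ = I and pilot contamination contributes the
deterministic constant C. Dividing numerator and denominator of the SINR by ‖[Ĝ†]_k‖² gives 1 + γ =
(pY + 1 + α²p(C+1)X) / (pY + 1 + α²pCX) (`one_add_zfSINR`). Since L ≥ 2 forces C > 0, this ratio is
at most 1 + 1/C, and integrability is immediate.

No density is ever computed for X or Y. The Frullani integral log(V/U) = ∫₀^∞ (e^{-zU} - e^{-zV})
dz/z shows that the rate depends only on the Laplace transforms of pY + 1 + α²pcX for c = C and c =
C + 1 (`integral_log_ratio_eq`). Given Ĝ, Y is a sum of independent exponentials whose means are the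
diagonal entries of 𝒜, whatever Ĝ is. X is the squared norm of the projection of column k onto the
orthogonal complement of the other columns, of dimension N - K + 1, so it has an Erlang transform
(`rowNormSq_pinv_mul`, `integral_exp_inv_rowNormSq_pinv`). Hence the transform is e^{-z} ∏(1 + d_i p
z)⁻¹ (1 + β̂ α²pcz)^{-(N-K+1)} (`integral_exp_noisePower_channel`).

Partial fractions write the product as a combination of (1 + μpz)^{-q}, each the transform of p
times an Erlang variable. Applying the Frullani identity backwards to each term gives the
expectation of a log ratio of two independent Erlang variables (`integral_erlang_log_ratio`), a
double integral. The inner one produces Ei (`integral_gamma_log`); the outer one produces `calJ` and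
`confluentU` (`integral_auxI`). When the diagonal entries are distinct only q = 1 occurs, and U
reduces to an incomplete gamma function (`auxI_one`). -/

/-! ## The exponential integral -/

open Set Filter Topology in
lemma integrableOn_exp_div_Iic {x : ℝ} (hx : x < 0) :
    IntegrableOn (fun t : ℝ => Real.exp t / t) (Iic x) := by
  have h := (integrableOn_exp_Iic x).const_mul (1 / |x|)
  refine Integrable.mono' h ?_ ?_
  · exact (by fun_prop : Measurable (fun t : ℝ => Real.exp t / t)).aestronglyMeasurable
  · filter_upwards [ae_restrict_mem measurableSet_Iic] with t ht
    have ht' : t ≤ x := ht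
    rw [norm_div, Real.norm_eq_abs, Real.norm_eq_abs, abs_of_pos (Real.exp_pos t), abs_of_neg hx,
      abs_of_neg (by linarith : t < 0), div_eq_mul_one_div, mul_comm]
    gcongr
    · linarith

open Set Filter Topology in
lemma hasDerivAt_expIntegralEi {x : ℝ} (hx : x < 0) :
    HasDerivAt expIntegralEi (Real.exp x / x) x := by
  have hd : HasDerivAt (fun u => ∫ t in (x - 1)..u, Real.exp t / t) (Real.exp x / x) x := by
    refine intervalIntegral.integral_hasDerivAt_right ?_ ?_ ?_
    · rw [intervalIntegrable_iff_integrableOn_Ioc_of_le (by linarith)]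
      exact (integrableOn_exp_div_Iic hx).mono_set Ioc_subset_Iic_self
    · exact (by fun_prop : StronglyMeasurable
        (fun t : ℝ => Real.exp t / t)).stronglyMeasurableAtFilter
    · exact Real.continuous_exp.continuousAt.div continuousAt_id hx.ne
  have h2 := hd.const_add (expIntegralEi (x - 1))
  refine h2.congr_of_eventuallyEq ?_
  filter_upwards [eventually_lt_nhds hx] with u hu
  have := intervalIntegral.integral_Iic_sub_Iic (integrableOn_exp_div_Iic (by linarith : x - 1 < 0))
    (integrableOn_exp_div_Iic hu)
  unfold expIntegralEi
  linarith

open Set in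
lemma expIntegralEi_nonpos {x : ℝ} (hx : x < 0) : expIntegralEi x ≤ 0 := by
  refine setIntegral_nonpos measurableSet_Iic fun t ht => ?_
  exact div_nonpos_of_nonneg_of_nonpos (Real.exp_pos t).le (le_trans ht hx.le)

open Set in
-- On the tail `t ≤ x < 0` one has 1/|t| ≤ 1/|x|. This exponential decay is the source of every
-- later convergence estimate involving Ei.
lemma neg_expIntegralEi_le {x : ℝ} (hx : x < 0) : -expIntegralEi x ≤ Real.exp x / (-x) := by
  have h1 : ∫ t in Iic x, Real.exp t * (1 / (-x)) = Real.exp x / (-x) := by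
    rw [integral_mul_const, integral_exp_Iic]; ring
  rw [← h1, expIntegralEi, ← integral_neg]
  refine setIntegral_mono_on (integrableOn_exp_div_Iic hx).neg
    ((integrableOn_exp_Iic x).mul_const _) measurableSet_Iic fun t ht => ?_
  have ht' : t ≤ x := ht
  rw [← div_neg, div_eq_mul_one_div]
  gcongr
  linarith

lemma abs_expIntegralEi_le {x : ℝ} (hx : x < 0) : |expIntegralEi x| ≤ Real.exp x / (-x) := by
  rw [abs_of_nonpos (expIntegralEi_nonpos hx)]; exact neg_expIntegralEi_le hx

lemma hasDerivAt_expIntegralEi_neg {z : ℝ} (hz : 0 < z) :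
    HasDerivAt (fun z => expIntegralEi (-z)) (Real.exp (-z) / z) z := by
  have := (hasDerivAt_expIntegralEi (neg_lt_zero.2 hz)).comp z (hasDerivAt_neg z)
  refine this.congr_deriv ?_
  rw [div_neg]; ring

open Filter Topology in
lemma tendsto_pow_mul_exp_neg_mul (k : ℕ) {r : ℝ} (hr : 0 < r) :
    Tendsto (fun z : ℝ => z ^ k * Real.exp (-(r * z))) atTop (𝓝 0) := by
  have h := (Real.tendsto_pow_mul_exp_neg_atTop_nhds_zero k).comp
    (tendsto_id.const_mul_atTop hr)
  have h2 := h.const_mul ((r ^ k)⁻¹)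
  rw [mul_zero] at h2
  refine h2.congr fun z => ?_
  simp only [Function.comp, id]
  rw [mul_pow]
  field_simp

open Filter Topology in
-- Ei(-z) itself decays like e^{-z}, so `r` may be negative as long as `r > -1`. This matters
-- because 1/μ - a can have either sign.
lemma tendsto_pow_mul_exp_mul_expIntegralEi (k : ℕ) {r : ℝ} (hr : 0 < r + 1) :
    Tendsto (fun z : ℝ => z ^ k * Real.exp (-(r * z)) * expIntegralEi (-z)) atTop (𝓝 0) := by
  refine squeeze_zero_norm' ?_ (tendsto_pow_mul_exp_neg_mul k hr)
  filter_upwards [eventually_ge_atTop 1] with z hz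
  have hz0 : 0 < z := by linarith
  rw [norm_mul, norm_mul, norm_pow, Real.norm_eq_abs, Real.norm_eq_abs, Real.norm_eq_abs,
    abs_of_pos hz0, abs_of_pos (Real.exp_pos _), mul_assoc]
  gcongr
  have h1 := abs_expIntegralEi_le (neg_lt_zero.2 hz0)
  calc Real.exp (-(r * z)) * |expIntegralEi (-z)|
      ≤ Real.exp (-(r * z)) * (Real.exp (-z) / 1) := by
        gcongr
        refine h1.trans ?_
        rw [neg_neg]
        gcongr
    _ = Real.exp (-((r + 1) * z)) := by rw [div_one, ← Real.exp_add]; ring_nf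

open Set Filter Topology in
/-- `∫_b^∞ z^k e^{-rz} dz`. -/
lemma integral_Ioi_pow_mul_exp (k : ℕ) {r b : ℝ} (hr : 0 < r) (hb : 0 ≤ b) :
    IntegrableOn (fun z : ℝ => z ^ k * Real.exp (-(r * z))) (Ioi b) ∧
    ∫ z in Ioi b, z ^ k * Real.exp (-(r * z)) =
      Real.exp (-(r * b)) *
        ∑ u ∈ Finset.range (k + 1), (u.factorial : ℝ) * (k.choose u : ℝ) * b ^ (k - u) /
          r ^ (u + 1) := by
  -- The closed form with b replaced by z is minus an antiderivative, and it vanishes at infinity.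
  have key : ∀ z : ℝ, HasDerivAt (fun z => -(Real.exp (-(r * z)) *
        ∑ u ∈ Finset.range (k + 1), (u.factorial : ℝ) * (k.choose u : ℝ) * z ^ (k - u) /
          r ^ (u + 1))) (z ^ k * Real.exp (-(r * z))) z := by
    intro z
    induction k with
    | zero =>
      have h := ((((hasDerivAt_id z).const_mul r).neg.exp).mul_const (1 / r)).neg
      simp only [zero_add, Finset.range_one, Finset.sum_singleton, Nat.factorial_zero,
        Nat.choose_self, Nat.cast_one, pow_zero, one_mul, pow_one]
      convert! h using 1
      simp; field_simp
    | succ k ih =>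
      have hS : ∀ z : ℝ, ∑ u ∈ Finset.range (k + 1 + 1),
          (u.factorial : ℝ) * ((k + 1).choose u : ℝ) * z ^ (k + 1 - u) / r ^ (u + 1) =
          z ^ (k + 1) / r + (k + 1) / r * ∑ u ∈ Finset.range (k + 1),
            (u.factorial : ℝ) * (k.choose u : ℝ) * z ^ (k - u) / r ^ (u + 1) := by
        intro z
        rw [Finset.sum_range_succ', Finset.mul_sum]
        simp only [Nat.factorial_zero, Nat.choose_zero_right, Nat.cast_one, one_mul, Nat.sub_zero,
          zero_add, pow_one]
        rw [add_comm]
        congr 1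
        refine Finset.sum_congr rfl fun u _ => ?_
        have h1 : ((u + 1).factorial : ℝ) * ((k + 1).choose (u + 1) : ℝ) =
            (k + 1) * ((u.factorial : ℝ) * (k.choose u : ℝ)) := by
          have := Nat.add_one_mul_choose_eq k u
          rw [Nat.factorial_succ]
          have h3 : ((k + 1 : ℕ) : ℝ) * (k.choose u : ℝ) = ((k + 1).choose (u + 1) : ℝ) * (u + 1 : ℕ) := by
            exact_mod_cast this
          push_cast at h3 ⊢
          linear_combination (-(u.factorial : ℝ)) * h3
        rw [h1, Nat.add_sub_add_right]
        field_simp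
        ring
      simp_rw [hS]
      have h0 := (((hasDerivAt_id z).const_mul r).neg.exp).mul (hasDerivAt_pow (k + 1) z)
      have h := (h0.mul_const (1 / r)).neg.add (ih.const_mul ((k + 1) / r))
      refine (h.congr_of_eventuallyEq (Eventually.of_forall fun z => ?_)).congr_deriv ?_
      · simp; ring
      · simp; field_simp; ring
  have hlim : Tendsto (fun z => -(Real.exp (-(r * z)) *
        ∑ u ∈ Finset.range (k + 1), (u.factorial : ℝ) * (k.choose u : ℝ) * z ^ (k - u) /
          r ^ (u + 1))) atTop (𝓝 0) := by
    have : Tendsto (fun z => -(∑ u ∈ Finset.range (k + 1),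
        ((u.factorial : ℝ) * (k.choose u : ℝ) / r ^ (u + 1)) *
          (z ^ (k - u) * Real.exp (-(r * z))))) atTop
        (𝓝 (-(∑ u ∈ Finset.range (k + 1),
          ((u.factorial : ℝ) * (k.choose u : ℝ) / r ^ (u + 1)) * 0))) :=
      (tendsto_finsetSum _ fun u _ => (tendsto_pow_mul_exp_neg_mul (k - u) hr).const_mul _).neg
    simp only [mul_zero, Finset.sum_const_zero, neg_zero] at this
    refine this.congr fun z => ?_
    rw [Finset.mul_sum]
    congr 1
    refine Finset.sum_congr rfl fun u _ => by ring
  have hpos : ∀ x ∈ Ioi b, 0 ≤ x ^ k * Real.exp (-(r * x)) := fun x hx => by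
    have : 0 ≤ x := hb.trans (le_of_lt hx)
    positivity
  refine ⟨integrableOn_Ioi_deriv_of_nonneg' (fun x _ => key x) hpos hlim, ?_⟩
  rw [integral_Ioi_of_hasDerivAt_of_nonneg' (fun x _ => key x) hpos hlim]
  ring

open Set Filter Topology in
/-- `∫_b^∞ z^k e^{-rz} Ei(-z) dz`. -/
lemma integral_Ioi_pow_mul_exp_mul_expIntegralEi (k : ℕ) {r b : ℝ} (hr0 : r ≠ 0) (hr : 0 < r + 1)
    (hb : 0 < b) :
    IntegrableOn (fun z : ℝ => z ^ k * Real.exp (-(r * z)) * expIntegralEi (-z)) (Ioi b) ∧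
    ∫ z in Ioi b, z ^ k * Real.exp (-(r * z)) * expIntegralEi (-z) =
      (∑ s ∈ Finset.range (k + 1), (k.descFactorial s : ℝ) * b ^ (k - s) / r ^ (s + 1)) *
          Real.exp (-(r * b)) * expIntegralEi (-b)
        - (k.factorial : ℝ) / r ^ (k + 1) * expIntegralEi (-((r + 1) * b))
        + Real.exp (-((r + 1) * b)) / r *
          ∑ s ∈ Finset.range k, ∑ u ∈ Finset.range (k - s),
            (u.factorial : ℝ) * (k.descFactorial s : ℝ) * ((k - s - 1).choose u : ℝ) *
              b ^ (k - s - u - 1) / (r ^ s * (r + 1) ^ (u + 1)) := by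
  have hint : ∀ k : ℕ,
      IntegrableOn (fun z : ℝ => z ^ k * Real.exp (-(r * z)) * expIntegralEi (-z)) (Ioi b) := by
    intro k
    refine Integrable.mono' (((integral_Ioi_pow_mul_exp k hr hb.le).1).const_mul (1 / b)) ?_ ?_
    · refine ContinuousOn.aestronglyMeasurable (fun z hz => ContinuousAt.continuousWithinAt ?_)
        measurableSet_Ioi
      have hz0 : 0 < z := hb.trans hz
      exact (by fun_prop : ContinuousAt (fun z : ℝ => z ^ k * Real.exp (-(r * z))) z).mul
        (hasDerivAt_expIntegralEi_neg hz0).continuousAt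
    · filter_upwards [ae_restrict_mem measurableSet_Ioi] with z hz
      have hzb : b < z := hz
      have hz0 : 0 < z := hb.trans hz
      rw [norm_mul, norm_mul, norm_pow, Real.norm_eq_abs, Real.norm_eq_abs, Real.norm_eq_abs,
        abs_of_pos hz0, abs_of_pos (Real.exp_pos _)]
      have h1 := abs_expIntegralEi_le (neg_lt_zero.2 hz0)
      calc z ^ k * Real.exp (-(r * z)) * |expIntegralEi (-z)|
          ≤ z ^ k * Real.exp (-(r * z)) * (Real.exp (-z) / b) := by
            gcongr
            refine h1.trans ?_
            rw [neg_neg]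
            gcongr
        _ = 1 / b * (z ^ k * Real.exp (-((r + 1) * z))) := by
            rw [show -((r + 1) * z) = -(r * z) + -z by ring, Real.exp_add]; ring
  refine ⟨hint k, ?_⟩
  have hEi1 : IntegrableOn (fun z => Real.exp (-((r + 1) * z)) / z) (Ioi b) ∧
      ∫ z in Ioi b, Real.exp (-((r + 1) * z)) / z = -expIntegralEi (-((r + 1) * b)) := by
    have hder : ∀ z ∈ Ici b, HasDerivAt (fun z => expIntegralEi (-((r + 1) * z)))
        (Real.exp (-((r + 1) * z)) / z) z := by
      intro z hz
      have hz0 : 0 < z := hb.trans_le hz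
      have := (hasDerivAt_expIntegralEi_neg (mul_pos hr hz0)).comp z
        ((hasDerivAt_id z).const_mul (r + 1))
      refine this.congr_deriv ?_
      field_simp
    have hpos : ∀ z ∈ Ioi b, 0 ≤ Real.exp (-((r + 1) * z)) / z := fun z hz => by
      have hz0 : 0 < z := hb.trans hz
      positivity
    have hlim : Tendsto (fun z => expIntegralEi (-((r + 1) * z))) atTop (𝓝 0) := by
      have := (tendsto_pow_mul_exp_mul_expIntegralEi 0 (r := 0) (by norm_num)).comp
        (tendsto_id.const_mul_atTop hr)
      simpa [Function.comp_def] using this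
    refine ⟨integrableOn_Ioi_deriv_of_nonneg' hder hpos hlim, ?_⟩
    rw [integral_Ioi_of_hasDerivAt_of_nonneg' hder hpos hlim]; ring
  -- Integrating the derivative of z^k e^{-rz} Ei(-z) gives a recursion in k whose solution divides
  -- by r, whence `r ≠ 0`. The derivative of Ei leaves z^{k-1} e^{-(r+1)z}, which is elementary
  -- except at k = 0, where it gives the second Ei term, at (r+1)b.
  induction k with
  | zero =>
    have hder : ∀ z ∈ Ici b, HasDerivAt (fun z => Real.exp (-(r * z)) * expIntegralEi (-z))
        (-r * (z ^ 0 * Real.exp (-(r * z)) * expIntegralEi (-z)) +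
          Real.exp (-((r + 1) * z)) / z) z := by
      intro z hz
      have hz0 : 0 < z := hb.trans_le hz
      refine ((((hasDerivAt_id z).const_mul r).neg.exp).mul
        (hasDerivAt_expIntegralEi_neg hz0)).congr_deriv ?_
      rw [show -((r + 1) * z) = -(r * z) + -z by ring, Real.exp_add]
      simp; ring
    have hlim := tendsto_pow_mul_exp_mul_expIntegralEi 0 hr
    simp only [pow_zero, one_mul] at hlim
    have h := integral_Ioi_of_hasDerivAt_of_tendsto' hder
      (((hint 0).const_mul (-r)).add hEi1.1) hlim
    rw [integral_add ((hint 0).const_mul (-r)) hEi1.1, integral_const_mul, hEi1.2] at h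
    simp only [zero_add, Finset.range_one, Finset.sum_singleton, Finset.range_zero,
      Finset.sum_empty, Nat.descFactorial_zero, Nat.factorial_zero, Nat.cast_one, pow_one,
      pow_zero, mul_zero, add_zero, Nat.sub_zero]
    simp only [pow_zero, one_mul] at h
    generalize expIntegralEi (-((r + 1) * b)) = e at h ⊢
    field_simp
    linear_combination -h
  | succ k ih =>
    obtain ⟨hGi, hG⟩ := integral_Ioi_pow_mul_exp k hr hb.le
    have hder : ∀ z ∈ Ici b,
        HasDerivAt (fun z => z ^ (k + 1) * Real.exp (-(r * z)) * expIntegralEi (-z))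
        ((k + 1) * (z ^ k * Real.exp (-(r * z)) * expIntegralEi (-z)) +
          -r * (z ^ (k + 1) * Real.exp (-(r * z)) * expIntegralEi (-z)) +
          z ^ k * Real.exp (-((r + 1) * z))) z := by
      intro z hz
      have hz0 : 0 < z := hb.trans_le hz
      refine (((hasDerivAt_pow (k + 1) z).mul (((hasDerivAt_id z).const_mul r).neg.exp)).mul
        (hasDerivAt_expIntegralEi_neg hz0)).congr_deriv ?_
      rw [show -((r + 1) * z) = -(r * z) + -z by ring, Real.exp_add]
      simp; field_simp; ring
    have h := integral_Ioi_of_hasDerivAt_of_tendsto' hder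
      ((((hint k).const_mul (k + 1 : ℝ)).add ((hint (k + 1)).const_mul (-r))).add hGi)
      (tendsto_pow_mul_exp_mul_expIntegralEi (k + 1) hr)
    have hsum : IntegrableOn (fun z => (k + 1) * (z ^ k * Real.exp (-(r * z)) * expIntegralEi (-z)) +
          -r * (z ^ (k + 1) * Real.exp (-(r * z)) * expIntegralEi (-z))) (Ioi b) :=
      ((hint k).const_mul (k + 1 : ℝ)).add ((hint (k + 1)).const_mul (-r))
    rw [integral_add hsum hGi,
      integral_add ((hint k).const_mul (k + 1 : ℝ)) ((hint (k + 1)).const_mul (-r)),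
      integral_const_mul, integral_const_mul, hG, ih] at h
    -- Splitting off s = 0 shows that both sums of the closed form obey the recursion just derived.
    have hS1 : ∑ s ∈ Finset.range (k + 1 + 1),
          ((k + 1).descFactorial s : ℝ) * b ^ (k + 1 - s) / r ^ (s + 1) =
        b ^ (k + 1) / r + (k + 1) / r *
          ∑ s ∈ Finset.range (k + 1), (k.descFactorial s : ℝ) * b ^ (k - s) / r ^ (s + 1) := by
      rw [Finset.sum_range_succ', Finset.mul_sum, add_comm]
      congr 1
      · simp
      · refine Finset.sum_congr rfl fun s _ => ?_
        rw [Nat.succ_descFactorial_succ, Nat.add_sub_add_right]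
        push_cast; field_simp; ring
    have hS2 : ∑ s ∈ Finset.range (k + 1), ∑ u ∈ Finset.range (k + 1 - s),
            (u.factorial : ℝ) * ((k + 1).descFactorial s : ℝ) * ((k + 1 - s - 1).choose u : ℝ) *
              b ^ (k + 1 - s - u - 1) / (r ^ s * (r + 1) ^ (u + 1)) =
        ∑ u ∈ Finset.range (k + 1), (u.factorial : ℝ) * (k.choose u : ℝ) * b ^ (k - u) /
          (r + 1) ^ (u + 1) + (k + 1) / r *
          ∑ s ∈ Finset.range k, ∑ u ∈ Finset.range (k - s),
            (u.factorial : ℝ) * (k.descFactorial s : ℝ) * ((k - s - 1).choose u : ℝ) *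
              b ^ (k - s - u - 1) / (r ^ s * (r + 1) ^ (u + 1)) := by
      rw [Finset.sum_range_succ', Finset.mul_sum, add_comm]
      congr 1
      · refine Finset.sum_congr rfl fun u _ => ?_
        simp only [Nat.descFactorial_zero, Nat.cast_one, mul_one, Nat.sub_zero, pow_zero, one_mul,
          Nat.add_sub_cancel]
        rw [show k + 1 - u - 1 = k - u by omega]
      · refine Finset.sum_congr rfl fun s _ => ?_
        rw [Finset.mul_sum, Nat.add_sub_add_right]
        refine Finset.sum_congr rfl fun u _ => ?_
        rw [Nat.succ_descFactorial_succ]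
        push_cast; field_simp; ring
    rw [hS1, hS2, Nat.factorial_succ]
    push_cast
    generalize (∑ s ∈ Finset.range (k + 1), (k.descFactorial s : ℝ) * b ^ (k - s) / r ^ (s + 1)) = A
      at h ⊢
    generalize (∑ u ∈ Finset.range (k + 1), (u.factorial : ℝ) * (k.choose u : ℝ) * b ^ (k - u) /
      (r + 1) ^ (u + 1)) = B at h ⊢
    generalize (∑ s ∈ Finset.range k, ∑ u ∈ Finset.range (k - s), (u.factorial : ℝ) *
      (k.descFactorial s : ℝ) * ((k - s - 1).choose u : ℝ) * b ^ (k - s - u - 1) /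
      (r ^ s * (r + 1) ^ (u + 1))) = D at h ⊢
    generalize expIntegralEi (-((r + 1) * b)) = e at h ⊢
    generalize (∫ z in Ioi b, z ^ (k + 1) * Real.exp (-(r * z)) * expIntegralEi (-z)) = J at h ⊢
    generalize Real.exp (-((r + 1) * b)) = E at h ⊢
    have h' : J = (1 / r) * ((k + 1) * (A * Real.exp (-(r * b)) * expIntegralEi (-b) -
        k.factorial / r ^ (k + 1) * e + E / r * D) + E * B +
        b ^ (k + 1) * Real.exp (-(r * b)) * expIntegralEi (-b)) := by
      field_simp at h ⊢
      linear_combination -h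
    rw [h']
    field_simp
    ring

/-! ### The integral represented by `calJ`. -/

open Set in
lemma integrableOn_comp_affine_Ioi {f : ℝ → ℝ} {a b : ℝ} (ha : 0 < a)
    (hf : IntegrableOn f (Ioi b)) : IntegrableOn (fun y => f (a * y + b)) (Ioi 0) := by
  have h1 : IntegrableOn (fun x => f (x + b)) (Ioi 0) := by
    have := (measurePreserving_add_right (volume : Measure ℝ) b).integrableOn_comp_preimage
      (measurableEmbedding_addRight b) (f := f) (s := Ioi b)
    simpa [Function.comp_def] using this.2 hf
  have := (integrableOn_Ioi_comp_mul_left_iff (fun x => f (x + b)) 0 ha).2 (by simpa using h1)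
  simpa using this

open Set in
lemma integral_comp_affine_Ioi (f : ℝ → ℝ) {a : ℝ} (b : ℝ) (ha : 0 < a) :
    ∫ y in Ioi 0, f (a * y + b) = a⁻¹ * ∫ z in Ioi b, f z := by
  have h1 : ∫ x in Ioi 0, f (x + b) = ∫ z in Ioi b, f z := by
    have := (measurePreserving_add_right (volume : Measure ℝ) b).setIntegral_preimage_emb
      (measurableEmbedding_addRight b) f (Ioi b)
    simpa using this
  have := integral_comp_mul_left_Ioi (fun x => f (x + b)) 0 ha
  rw [this, mul_zero, h1, smul_eq_mul]

open Set in
-- Substitute z = ay + b and expand y^m = ((z - b)/a)^m by the binomial theorem. The exponential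
-- becomes e^{cb/a} e^{-(c/a)z}, so each term is an integral of z^{n+r} e^{-(c/a)z} Ei(-z) over (b,
-- ∞). Convergence needs c/a > -1, i.e. c + a > 0, not c > 0.
lemma integral_calJ (m n : ℕ) {a b c : ℝ} (ha : 0 < a) (hb : 0 < b) (hc : c ≠ 0)
    (hac : 0 < c + a) :
    IntegrableOn (fun y : ℝ => y ^ m * (a * y + b) ^ n * Real.exp (-(c * y)) *
      expIntegralEi (-(a * y + b))) (Ioi 0) ∧
    ∫ y in Ioi 0, y ^ m * (a * y + b) ^ n * Real.exp (-(c * y)) * expIntegralEi (-(a * y + b)) =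
      calJ m n a b c := by
  have hr0 : c / a ≠ 0 := div_ne_zero hc ha.ne'
  have hr : 0 < c / a + 1 := by
    have : c / a + 1 = (c + a) / a := by field_simp
    rw [this]; positivity
  have hI := fun r : ℕ => integral_Ioi_pow_mul_exp_mul_expIntegralEi (n + r) hr0 hr hb
  have hexp : ∀ y : ℝ, Real.exp (-(c * y)) =
      Real.exp (c * b / a) * Real.exp (-(c / a * (a * y + b))) := fun y => by
    rw [← Real.exp_add]; congr 1; field_simp; ring
  have hfun : ∀ y : ℝ,
      y ^ m * (a * y + b) ^ n * Real.exp (-(c * y)) * expIntegralEi (-(a * y + b)) =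
      ∑ r ∈ Finset.range (m + 1), ((m.choose r : ℝ) * (-b) ^ (m - r)) *
        (Real.exp (c * b / a) / a ^ m * ((a * y + b) ^ (n + r) *
          Real.exp (-(c / a * (a * y + b))) * expIntegralEi (-(a * y + b)))) := by
    intro y
    have hy : y ^ m = (∑ r ∈ Finset.range (m + 1), (a * y + b) ^ r * (-b) ^ (m - r) *
        (m.choose r : ℝ)) / a ^ m := by
      rw [← add_pow, eq_div_iff (by positivity), ← mul_pow]; congr 1; ring
    rw [hy, hexp, Finset.sum_div, Finset.sum_mul, Finset.sum_mul, Finset.sum_mul]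
    refine Finset.sum_congr rfl fun r _ => ?_
    rw [pow_add]; ring
  have hii : ∀ r, IntegrableOn (fun y : ℝ => ((m.choose r : ℝ) * (-b) ^ (m - r)) *
        (Real.exp (c * b / a) / a ^ m * ((a * y + b) ^ (n + r) *
          Real.exp (-(c / a * (a * y + b))) * expIntegralEi (-(a * y + b))))) (Ioi 0) := fun r =>
    ((integrableOn_comp_affine_Ioi ha (hI r).1).const_mul _).const_mul _
  simp_rw [hfun]
  refine ⟨integrable_finsetSum _ fun r _ => hii r, ?_⟩
  rw [integral_finsetSum _ fun r _ => hii r, calJ]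
  refine Finset.sum_congr rfl fun r _ => ?_
  rw [integral_const_mul, integral_const_mul]
  congr 1
  rw [integral_comp_affine_Ioi (fun z => z ^ (n + r) * Real.exp (-(c / a * z)) *
    expIntegralEi (-z)) b ha, (hI r).2]
  have he1 : Real.exp (-(c / a * b)) = (Real.exp (c * b / a))⁻¹ := by
    rw [← Real.exp_neg]; congr 1; ring
  have he2 : Real.exp (-((c / a + 1) * b)) = (Real.exp (c * b / a))⁻¹ * Real.exp (-b) := by
    rw [← Real.exp_neg, ← Real.exp_add]; congr 1; ring
  have he3 : -(c * b / a) - b = -((c / a + 1) * b) := by ring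
  rw [he1, he2, he3, mul_add, mul_sub, mul_add, mul_sub, ← Finset.sum_mul]
  have hz : ∀ s : ℕ, a ^ ((m : ℤ) - s) = a ^ m / a ^ s := fun s => by
    rw [zpow_sub₀ ha.ne', zpow_natCast, zpow_natCast]
  have hE := (Real.exp_pos (c * b / a)).ne'
  generalize Real.exp (c * b / a) = E at hE ⊢
  congr 1
  · congr 1
    · rw [← mul_assoc, ← mul_assoc, ← mul_assoc, Finset.mul_sum, Finset.sum_mul]
      congr 1
      refine Finset.sum_congr rfl fun s _ => ?_
      rw [hz, div_pow]
      field_simp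
      try ring
    · rw [sub_sub, ← Nat.cast_add, hz, div_pow]
      generalize expIntegralEi _ = e
      field_simp
      try ring
  · rw [Finset.mul_sum, Finset.mul_sum, Finset.mul_sum, Finset.mul_sum]
    refine Finset.sum_congr rfl fun s _ => ?_
    rw [Finset.mul_sum, Finset.mul_sum, Finset.mul_sum, Finset.mul_sum]
    refine Finset.sum_congr rfl fun u _ => ?_
    rw [hz, div_pow]
    have : c / a + 1 ≠ 0 := hr.ne'
    generalize c / a + 1 = w at this ⊢
    field_simp
    try ring

/-! ### Gamma integrals against 1/(x + w) and log(1 + x/w). -/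

open Set in
lemma integral_pow_mul_exp_neg (j : ℕ) :
    IntegrableOn (fun x : ℝ => x ^ j * Real.exp (-x)) (Ioi 0) ∧
    ∫ x in Ioi 0, x ^ j * Real.exp (-x) = (j.factorial : ℝ) := by
  have h := integral_Ioi_pow_mul_exp j one_pos le_rfl
  simp only [one_mul, neg_zero, Real.exp_zero, mul_zero, one_pow, div_one] at h
  refine ⟨h.1, h.2.trans ?_⟩
  rw [Finset.sum_eq_single j]
  · simp
  · intro u hu huj
    rw [zero_pow (by grind), mul_zero]
  · grind

open Set in
lemma integrableOn_pow_mul_exp_div (j : ℕ) {w : ℝ} (hw : 0 < w) :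
    IntegrableOn (fun x : ℝ => x ^ j * Real.exp (-x) / (x + w)) (Ioi 0) := by
  refine Integrable.mono' ((integral_pow_mul_exp_neg j).1.mul_const (1 / w)) ?_ ?_
  · exact (by fun_prop : Measurable fun x : ℝ => x ^ j * Real.exp (-x) / (x + w)).aestronglyMeasurable
  · filter_upwards [ae_restrict_mem measurableSet_Ioi] with x hx
    have hx0 : 0 < x := hx
    rw [Real.norm_eq_abs, abs_of_pos (by positivity), div_eq_mul_one_div]
    gcongr
    linarith

open Set Filter Topology in
/-- `∫_0^∞ x^j e^{-x} / (x + w) dx`. -/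
lemma integral_pow_mul_exp_div (j : ℕ) {w : ℝ} (hw : 0 < w) :
    ∫ x in Ioi 0, x ^ j * Real.exp (-x) / (x + w) =
      (-1) ^ j * (-(w ^ j * Real.exp w * expIntegralEi (-w)) +
        ∑ u ∈ Finset.Icc 1 j, ((u - 1).factorial : ℝ) * (-1) ^ u * w ^ (j - u)) := by
  induction j with
  | zero =>
    -- For j = 0 an antiderivative is e^w Ei(-(x + w)); higher j reduce to it through x^{j+1}/(x+w)
    -- = x^j - w x^j/(x+w).
    have hder : ∀ x ∈ Ici (0 : ℝ), HasDerivAt (fun x => Real.exp w * expIntegralEi (-(x + w)))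
        (x ^ 0 * Real.exp (-x) / (x + w)) x := by
      intro x hx
      have hx0 : 0 ≤ x := hx
      have := ((hasDerivAt_expIntegralEi_neg (by positivity : 0 < x + w)).comp x
        ((hasDerivAt_id x).add_const w)).const_mul (Real.exp w)
      refine this.congr_deriv ?_
      rw [neg_add, Real.exp_add, Real.exp_neg w]
      field_simp
    have hlim : Tendsto (fun x => Real.exp w * expIntegralEi (-(x + w))) atTop (𝓝 0) := by
      have := ((tendsto_pow_mul_exp_mul_expIntegralEi 0 (r := 0) (by norm_num)).comp
        (tendsto_atTop_add_const_right atTop w tendsto_id)).const_mul (Real.exp w)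
      simpa [Function.comp_def] using this
    rw [integral_Ioi_of_hasDerivAt_of_tendsto' hder (integrableOn_pow_mul_exp_div 0 hw) hlim]
    simp
  | succ j ih =>
    have h : ∀ x ∈ Ioi (0 : ℝ), x ^ (j + 1) * Real.exp (-x) / (x + w) =
        x ^ j * Real.exp (-x) - w * (x ^ j * Real.exp (-x) / (x + w)) := by
      intro x hx
      have hx0 : 0 < x := hx
      field_simp
      ring
    rw [setIntegral_congr_fun measurableSet_Ioi h,
      integral_sub (integral_pow_mul_exp_neg j).1 ((integrableOn_pow_mul_exp_div j hw).const_mul w),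
      integral_const_mul, ih, (integral_pow_mul_exp_neg j).2, Finset.sum_Icc_succ_top (by omega)]
    have hs : ∑ u ∈ Finset.Icc 1 j, ((u - 1).factorial : ℝ) * (-1) ^ u * w ^ (j + 1 - u) =
        w * ∑ u ∈ Finset.Icc 1 j, ((u - 1).factorial : ℝ) * (-1) ^ u * w ^ (j - u) := by
      rw [Finset.mul_sum]
      refine Finset.sum_congr rfl fun u hu => ?_
      rw [Nat.sub_add_comm (Finset.mem_Icc.1 hu).2, pow_succ]
      ring
    rw [hs]
    simp only [Nat.add_sub_cancel, Nat.sub_self, pow_zero, mul_one]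
    have : ((-1 : ℝ) ^ (j + 1)) * (-1) ^ (j + 1) = 1 := by
      rw [← mul_pow]; simp
    linear_combination (-(j.factorial : ℝ)) * this

open Set in
lemma integrableOn_pow_mul_exp_mul_log (j : ℕ) {w : ℝ} (hw : 0 < w) :
    IntegrableOn (fun x : ℝ => x ^ j * Real.exp (-x) * Real.log (1 + x / w)) (Ioi 0) := by
  refine Integrable.mono' ((integral_pow_mul_exp_neg (j + 1)).1.mul_const (1 / w)) ?_ ?_
  · exact (by fun_prop : Measurable fun x : ℝ =>
      x ^ j * Real.exp (-x) * Real.log (1 + x / w)).aestronglyMeasurable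
  · filter_upwards [ae_restrict_mem measurableSet_Ioi] with x hx
    have hx0 : 0 < x := hx
    have hl0 : 0 ≤ Real.log (1 + x / w) := Real.log_nonneg (by simp; positivity)
    have hl1 : Real.log (1 + x / w) ≤ x / w := by
      have := Real.log_le_sub_one_of_pos (by positivity : 0 < 1 + x / w)
      linarith
    rw [Real.norm_eq_abs, abs_of_nonneg (by positivity)]
    calc x ^ j * Real.exp (-x) * Real.log (1 + x / w) ≤ x ^ j * Real.exp (-x) * (x / w) := by
          gcongr
      _ = _ := by ring

open Set Filter Topology in
-- Integration by parts lowers the exponent M by one at the cost of a factor M and an integral of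
-- x^M e^{-x}/(x + w). Unrolling yields the factors M!/j!, and the boundary terms vanish at 0 and at
-- infinity.
lemma integral_pow_mul_exp_mul_log (M : ℕ) {w : ℝ} (hw : 0 < w) :
    ∫ x in Ioi 0, x ^ M * Real.exp (-x) * Real.log (1 + x / w) =
      ∑ j ∈ Finset.range (M + 1), (M.factorial : ℝ) / j.factorial *
        ∫ x in Ioi 0, x ^ j * Real.exp (-x) / (x + w) := by
  have hlim : ∀ j : ℕ, Tendsto (fun x : ℝ => x ^ j * Real.exp (-x) * Real.log (1 + x / w)) atTop
      (𝓝 0) := by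
    intro j
    have h1 := (tendsto_pow_mul_exp_neg_mul (j + 1) one_pos).mul_const (1 / w)
    rw [zero_mul] at h1
    refine squeeze_zero' ?_ ?_ h1
    · filter_upwards [eventually_gt_atTop 0] with x hx
      have : 0 ≤ Real.log (1 + x / w) := Real.log_nonneg (by simp; positivity)
      positivity
    · filter_upwards [eventually_gt_atTop 0] with x hx
      have hl1 : Real.log (1 + x / w) ≤ x / w := by
        have := Real.log_le_sub_one_of_pos (by positivity : 0 < 1 + x / w)
        linarith
      calc x ^ j * Real.exp (-x) * Real.log (1 + x / w) ≤ x ^ j * Real.exp (-x) * (x / w) := by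
            gcongr
        _ = _ := by rw [one_mul]; ring
  have hlog : ∀ x ∈ Ici (0 : ℝ), HasDerivAt (fun x => Real.log (1 + x / w)) (1 / (x + w)) x := by
    intro x hx
    have hx0 : 0 ≤ x := hx
    have := (((hasDerivAt_id x).div_const w).const_add 1).log (by simp; positivity)
    refine this.congr_deriv ?_
    simp only [id]
    have : w + x ≠ 0 := by positivity
    field_simp
    ring
  induction M with
  | zero =>
    have hder : ∀ x ∈ Ici (0 : ℝ), HasDerivAt (fun x => Real.exp (-x) * Real.log (1 + x / w))
        (-(x ^ 0 * Real.exp (-x) * Real.log (1 + x / w)) + x ^ 0 * Real.exp (-x) / (x + w)) x := by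
      intro x hx
      refine (((hasDerivAt_id x).neg.exp).mul (hlog x hx)).congr_deriv ?_
      simp; ring
    have hl := hlim 0
    simp only [pow_zero, one_mul] at hl
    have hi : IntegrableOn (fun x => -(x ^ 0 * Real.exp (-x) * Real.log (1 + x / w))) (Ioi 0) :=
      (integrableOn_pow_mul_exp_mul_log 0 hw).neg
    have h := integral_Ioi_of_hasDerivAt_of_tendsto' hder
      (hi.add (integrableOn_pow_mul_exp_div 0 hw)) hl
    rw [integral_add hi (integrableOn_pow_mul_exp_div 0 hw), integral_neg] at h
    simp at h ⊢
    linarith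
  | succ M ih =>
    have hder : ∀ x ∈ Ici (0 : ℝ),
        HasDerivAt (fun x => x ^ (M + 1) * Real.exp (-x) * Real.log (1 + x / w))
        ((M + 1) * (x ^ M * Real.exp (-x) * Real.log (1 + x / w)) -
          x ^ (M + 1) * Real.exp (-x) * Real.log (1 + x / w) +
          x ^ (M + 1) * Real.exp (-x) / (x + w)) x := by
      intro x hx
      refine (((hasDerivAt_pow (M + 1) x).mul ((hasDerivAt_id x).neg.exp)).mul
        (hlog x hx)).congr_deriv ?_
      simp; ring
    have hi1 := (integrableOn_pow_mul_exp_mul_log M hw).const_mul (M + 1 : ℝ)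
    have hi2 := integrableOn_pow_mul_exp_mul_log (M + 1) hw
    have hi3 := integrableOn_pow_mul_exp_div (M + 1) hw
    have h := integral_Ioi_of_hasDerivAt_of_tendsto' hder ((hi1.sub hi2).add hi3) (hlim (M + 1))
    have hi12 : IntegrableOn (fun x => (M + 1) * (x ^ M * Real.exp (-x) * Real.log (1 + x / w)) -
          x ^ (M + 1) * Real.exp (-x) * Real.log (1 + x / w)) (Ioi 0) := hi1.sub hi2
    rw [integral_add hi12 hi3, integral_sub hi1 hi2, integral_const_mul, ih] at h
    rw [Finset.sum_range_succ]
    have : ∑ j ∈ Finset.range (M + 1), ((M + 1).factorial : ℝ) / j.factorial *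
        ∫ x in Ioi 0, x ^ j * Real.exp (-x) / (x + w) =
        (M + 1) * ∑ j ∈ Finset.range (M + 1), (M.factorial : ℝ) / j.factorial *
        ∫ x in Ioi 0, x ^ j * Real.exp (-x) / (x + w) := by
      rw [Finset.mul_sum]
      refine Finset.sum_congr rfl fun j _ => ?_
      rw [Nat.factorial_succ]; push_cast; ring
    rw [this, div_self (by positivity)]
    simp at h
    linarith

open Set in
/-- `∫_0^∞ x^M e^{-x/s} log(1 + x/(s w)) dx`. -/
lemma integral_gamma_log (M : ℕ) {s w : ℝ} (hs : 0 < s) (hw : 0 < w) :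
    IntegrableOn (fun x : ℝ => x ^ M * Real.exp (-(x / s)) * Real.log (1 + x / (s * w))) (Ioi 0) ∧
    ∫ x in Ioi 0, x ^ M * Real.exp (-(x / s)) * Real.log (1 + x / (s * w)) =
      ∑ t ∈ Finset.range (M + 1),
        (-1) ^ (M - t) * (M.factorial : ℝ) * s ^ (M + 1) / ((M - t).factorial : ℝ) *
        (-(w ^ (M - t) * Real.exp w * expIntegralEi (-w)) +
          ∑ u ∈ Finset.Icc 1 (M - t), ((u - 1).factorial : ℝ) * (-1) ^ u * w ^ (M - t - u)) := by
  have hf : ∀ x : ℝ, x ^ M * Real.exp (-(x / s)) * Real.log (1 + x / (s * w)) =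
      s ^ M * ((s⁻¹ * x) ^ M * Real.exp (-(s⁻¹ * x)) * Real.log (1 + (s⁻¹ * x) / w)) := by
    intro x
    rw [mul_pow, inv_pow, show s⁻¹ * x = x / s by ring, div_div]
    field_simp
  simp_rw [hf]
  constructor
  · refine Integrable.const_mul ?_ _
    exact (integrableOn_Ioi_comp_mul_left_iff
      (fun x : ℝ => x ^ M * Real.exp (-x) * Real.log (1 + x / w)) 0 (inv_pos.2 hs)).2
      (by simpa using integrableOn_pow_mul_exp_mul_log M hw)
  -- The sum over j is reversed, j = M - t, to match the index of `auxI`.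
  · rw [integral_const_mul, integral_comp_mul_left_Ioi
      (fun x : ℝ => x ^ M * Real.exp (-x) * Real.log (1 + x / w)) 0 (inv_pos.2 hs), mul_zero,
      integral_pow_mul_exp_mul_log M hw, inv_inv, smul_eq_mul, ← mul_assoc, ← pow_succ,
      ← Finset.sum_range_reflect, Finset.mul_sum]
    refine Finset.sum_congr rfl fun t ht => ?_
    rw [integral_pow_mul_exp_div _ hw, show M + 1 - 1 - t = M - t by omega]
    ring

/-! ### The auxiliary sums `auxI` and `auxIBar` as integrals. -/

open Set in
lemma integrableOn_pow_mul_affine_pow_mul_exp (m n : ℕ) (a b : ℝ) {μ : ℝ} (hμ : 0 < μ) :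
    IntegrableOn (fun y : ℝ => y ^ m * (a * y + b) ^ n * Real.exp (-(y / μ))) (Ioi 0) := by
  have h : ∀ y : ℝ, y ^ m * (a * y + b) ^ n * Real.exp (-(y / μ)) =
      ∑ i ∈ Finset.range (n + 1), (a ^ i * b ^ (n - i) * (n.choose i : ℝ)) *
        (y ^ (m + i) * Real.exp (-(μ⁻¹ * y))) := by
    intro y
    rw [add_pow, Finset.mul_sum, Finset.sum_mul]
    refine Finset.sum_congr rfl fun i _ => ?_
    rw [mul_pow, pow_add, show y / μ = μ⁻¹ * y by ring]
    ring
  simp_rw [h]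
  exact integrable_finsetSum _ fun i _ =>
    ((integral_Ioi_pow_mul_exp (m + i) (inv_pos.2 hμ) le_rfl).1).const_mul _

open Set in
-- The affine factor is b(1 + py), so the substitution t = py gives the integral that defines U. It
-- applies because a_c = p b_c.
lemma integral_pow_mul_affine_pow_mul_exp_eq_confluentU {q : ℕ} (hq : 1 ≤ q) (n : ℕ) {b p μ : ℝ}
    (hp : 0 < p) (hμ : 0 < μ) :
    ∫ y in Ioi 0, y ^ (q - 1) * (p * b * y + b) ^ n * Real.exp (-(y / μ)) =
      b ^ n * (p ^ q)⁻¹ * Real.Gamma (q : ℝ) *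
        confluentU (q : ℝ) ((q + 1 + n : ℕ) : ℝ) (1 / (μ * p)) := by
  have hG : Real.Gamma (q : ℝ) ≠ 0 := (Real.Gamma_pos_of_pos (by exact_mod_cast hq)).ne'
  rw [confluentU, ← mul_assoc, mul_assoc _ (Real.Gamma _), mul_inv_cancel₀ hG, mul_one]
  have hg : ∀ y ∈ Ioi (0 : ℝ), y ^ (q - 1) * (p * b * y + b) ^ n * Real.exp (-(y / μ)) =
      b ^ n * (p ^ (q - 1))⁻¹ * (fun t : ℝ => Real.exp (-(1 / (μ * p) * t)) * t ^ ((q : ℝ) - 1) *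
        (1 + t) ^ (((q + 1 + n : ℕ) : ℝ) - q - 1)) (p * y) := by
    intro y hy
    have hy0 : 0 < y := hy
    have e1 : (q : ℝ) - 1 = ((q - 1 : ℕ) : ℝ) := by rw [Nat.cast_sub hq, Nat.cast_one]
    have e2 : ((q + 1 + n : ℕ) : ℝ) - q - 1 = (n : ℝ) := by push_cast; ring
    simp only [e1, e2, Real.rpow_natCast]
    rw [show p * b * y + b = b * (1 + p * y) by ring, mul_pow, mul_pow,
      show 1 / (μ * p) * (p * y) = y / μ by field_simp]
    field_simp
  rw [setIntegral_congr_fun measurableSet_Ioi hg, integral_const_mul,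
    integral_comp_mul_left_Ioi (fun t : ℝ => Real.exp (-(1 / (μ * p) * t)) * t ^ ((q : ℝ) - 1) *
        (1 + t) ^ (((q + 1 + n : ℕ) : ℝ) - q - 1)) 0 hp, mul_zero, smul_eq_mul, ← mul_assoc]
  congr 1
  rw [mul_assoc, ← mul_inv, ← pow_succ, Nat.sub_add_cancel hq]

open Set in
-- The substitution t = (y + 1/p)/μ moves the lower limit 0 to 1/(μp).
lemma integral_affine_pow_mul_exp_eq_upperGamma (n : ℕ) {a p μ : ℝ}
    (hp : 0 < p) (hμ : 0 < μ) :
    ∫ y in Ioi 0, (a * y + a / p) ^ n * Real.exp (-(y / μ)) =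
      a ^ n * Real.exp (1 / (μ * p)) * μ ^ (n + 1) *
        upperGamma ((n + 1 : ℕ) : ℝ) (1 / (μ * p)) := by
  have hg : ∀ y ∈ Ioi (0 : ℝ), (a * y + a / p) ^ n * Real.exp (-(y / μ)) =
      a ^ n * Real.exp (1 / (μ * p)) * μ ^ n *
        (fun t : ℝ => t ^ (((n + 1 : ℕ) : ℝ) - 1) * Real.exp (-t)) (μ⁻¹ * y + 1 / (μ * p)) := by
    intro y _
    have e1 : ((n + 1 : ℕ) : ℝ) - 1 = (n : ℝ) := by push_cast; ring
    simp only [e1, Real.rpow_natCast]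
    rw [neg_add, Real.exp_add, Real.exp_neg (1 / (μ * p)),
      show a * y + a / p = a * μ * (μ⁻¹ * y + 1 / (μ * p)) by field_simp, mul_pow, mul_pow,
      show y / μ = μ⁻¹ * y by ring]
    field_simp
  rw [setIntegral_congr_fun measurableSet_Ioi hg, integral_const_mul,
    integral_comp_affine_Ioi (fun t : ℝ => t ^ (((n + 1 : ℕ) : ℝ) - 1) * Real.exp (-t)) _
      (inv_pos.2 hμ), upperGamma, inv_inv, pow_succ]
  ring

open Set in
/-- The part of `auxI` that contains the exponential integral. -/
lemma integral_pow_mul_exp_mul_affine_expIntegralEi (m n : ℕ) {a b μ : ℝ} (ha : 0 < a) (hb : 0 < b)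
    (hμ : 0 < μ) (hc : 1 / μ - a ≠ 0) :
    IntegrableOn (fun y : ℝ => y ^ m * Real.exp (-(y / μ)) *
      ((a * y + b) ^ n * Real.exp (a * y + b) * expIntegralEi (-(a * y + b)))) (Ioi 0) ∧
    ∫ y in Ioi 0, y ^ m * Real.exp (-(y / μ)) *
      ((a * y + b) ^ n * Real.exp (a * y + b) * expIntegralEi (-(a * y + b))) =
      Real.exp b * calJ m n a b (1 / μ - a) := by
  -- The factor e^{ay} turns the rate 1/μ into c = 1/μ - a, possibly negative; still c + a = 1/μ >
  -- 0.
  obtain ⟨h1, h2⟩ := integral_calJ m n ha hb hc (by rw [sub_add_cancel]; positivity)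
  have hg : ∀ y : ℝ, y ^ m * Real.exp (-(y / μ)) *
      ((a * y + b) ^ n * Real.exp (a * y + b) * expIntegralEi (-(a * y + b))) =
      Real.exp b * (y ^ m * (a * y + b) ^ n * Real.exp (-((1 / μ - a) * y)) *
        expIntegralEi (-(a * y + b))) := by
    intro y
    rw [show -((1 / μ - a) * y) = -(y / μ) + a * y by ring, Real.exp_add, Real.exp_add]
    ring
  simp_rw [hg]
  exact ⟨h1.const_mul _, by rw [integral_const_mul, h2]⟩

open Set in
/-- The term of index `n = M - t` of the auxiliary sums, as an integral. -/
lemma integral_auxI_term (q n : ℕ) {a b μ : ℝ} (ha : 0 < a) (hb : 0 < b)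
    (hμ : 0 < μ) (hc : 1 / μ - a ≠ 0) :
    IntegrableOn (fun y : ℝ => y ^ (q - 1) * Real.exp (-(y / μ)) *
      (-((a * y + b) ^ n * Real.exp (a * y + b) * expIntegralEi (-(a * y + b))) +
        ∑ u ∈ Finset.Icc 1 n, ((u - 1).factorial : ℝ) * (-1) ^ u * (a * y + b) ^ (n - u))) (Ioi 0) ∧
    ∫ y in Ioi 0, y ^ (q - 1) * Real.exp (-(y / μ)) *
      (-((a * y + b) ^ n * Real.exp (a * y + b) * expIntegralEi (-(a * y + b))) +
        ∑ u ∈ Finset.Icc 1 n, ((u - 1).factorial : ℝ) * (-1) ^ u * (a * y + b) ^ (n - u)) =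
      -Real.exp b * calJ (q - 1) n a b (1 / μ - a) +
        ∑ u ∈ Finset.Icc 1 n, ((u - 1).factorial : ℝ) * (-1) ^ u *
          ∫ y in Ioi 0, y ^ (q - 1) * (a * y + b) ^ (n - u) * Real.exp (-(y / μ)) := by
  obtain ⟨h1, h2⟩ := integral_pow_mul_exp_mul_affine_expIntegralEi (q - 1) n ha hb hμ hc
  have h3 : ∀ u, IntegrableOn (fun y : ℝ => ((u - 1).factorial : ℝ) * (-1) ^ u *
      (y ^ (q - 1) * (a * y + b) ^ (n - u) * Real.exp (-(y / μ)))) (Ioi 0) := fun u =>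
    (integrableOn_pow_mul_affine_pow_mul_exp (q - 1) (n - u) a b hμ).const_mul _
  have hg : ∀ y : ℝ, y ^ (q - 1) * Real.exp (-(y / μ)) *
      (-((a * y + b) ^ n * Real.exp (a * y + b) * expIntegralEi (-(a * y + b))) +
        ∑ u ∈ Finset.Icc 1 n, ((u - 1).factorial : ℝ) * (-1) ^ u * (a * y + b) ^ (n - u)) =
      -(y ^ (q - 1) * Real.exp (-(y / μ)) *
      ((a * y + b) ^ n * Real.exp (a * y + b) * expIntegralEi (-(a * y + b)))) +
      ∑ u ∈ Finset.Icc 1 n, ((u - 1).factorial : ℝ) * (-1) ^ u *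
        (y ^ (q - 1) * (a * y + b) ^ (n - u) * Real.exp (-(y / μ))) := by
    intro y
    rw [mul_add, Finset.mul_sum]
    congr 1
    · ring
    · exact Finset.sum_congr rfl fun u _ => by ring
  simp_rw [hg]
  have h4 : IntegrableOn (fun y => ∑ u ∈ Finset.Icc 1 n, ((u - 1).factorial : ℝ) * (-1) ^ u *
      (y ^ (q - 1) * (a * y + b) ^ (n - u) * Real.exp (-(y / μ)))) (Ioi 0) :=
    integrable_finsetSum _ fun u _ => h3 u
  have h1' : IntegrableOn (fun y => -(y ^ (q - 1) * Real.exp (-(y / μ)) *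
      ((a * y + b) ^ n * Real.exp (a * y + b) * expIntegralEi (-(a * y + b))))) (Ioi 0) := h1.neg
  refine ⟨h1'.add h4, ?_⟩
  rw [integral_add h1' h4, integral_neg, h2, integral_finsetSum _ fun u _ => h3 u]
  simp_rw [integral_const_mul, neg_mul]

open Set in
/-- `auxI` as an iterated integral. -/
lemma integral_auxI {q : ℕ} (hq : 1 ≤ q) (M : ℕ) {s α p c μ : ℝ} (hs : 0 < s) (hα : α ≠ 0)
    (hp : 0 < p) (hc : 0 < c) (hμ : 0 < μ) (hne : 1 / μ - 1 / (s * α ^ 2 * c) ≠ 0) :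
    IntegrableOn (fun y : ℝ => y ^ (q - 1) * Real.exp (-(y / μ)) *
      ∫ x in Ioi 0, x ^ M * Real.exp (-(x / s)) *
        Real.log (1 + α ^ 2 * p * c * x / (p * y + 1))) (Ioi 0) ∧
    ∫ y in Ioi 0, y ^ (q - 1) * Real.exp (-(y / μ)) *
      ∫ x in Ioi 0, x ^ M * Real.exp (-(x / s)) *
        Real.log (1 + α ^ 2 * p * c * x / (p * y + 1)) = auxI M q s α p c μ := by
  have hα2 : 0 < α ^ 2 := by positivity
  set a := 1 / (s * α ^ 2 * c) with ha_def
  set b := 1 / (s * α ^ 2 * p * c) with hb_def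
  have ha : 0 < a := by positivity
  have hb : 0 < b := by positivity
  have hab : a = p * b := by rw [ha_def, hb_def]; field_simp
  have hg : ∀ y ∈ Ioi (0 : ℝ), y ^ (q - 1) * Real.exp (-(y / μ)) *
      ∫ x in Ioi 0, x ^ M * Real.exp (-(x / s)) *
        Real.log (1 + α ^ 2 * p * c * x / (p * y + 1)) =
      ∑ t ∈ Finset.range (M + 1),
        (-1) ^ (M - t) * (M.factorial : ℝ) * s ^ (M + 1) / ((M - t).factorial : ℝ) *
        (y ^ (q - 1) * Real.exp (-(y / μ)) *
          (-((a * y + b) ^ (M - t) * Real.exp (a * y + b) * expIntegralEi (-(a * y + b))) +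
          ∑ u ∈ Finset.Icc 1 (M - t), ((u - 1).factorial : ℝ) * (-1) ^ u *
            (a * y + b) ^ (M - t - u))) := by
    intro y hy
    have hy0 : 0 < y := hy
    -- The parameter w of the inner integral is (py + 1)/(sα²pc), which is exactly ay + b.
    have h1 : ∀ x : ℝ, α ^ 2 * p * c * x / (p * y + 1) = x / (s * (a * y + b)) := by
      intro x
      rw [ha_def, hb_def]
      have : p * y + 1 ≠ 0 := by positivity
      field_simp
    simp_rw [h1]
    rw [(integral_gamma_log M hs (by positivity : 0 < a * y + b)).2, Finset.mul_sum]
    exact Finset.sum_congr rfl fun t _ => by ring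
  have hT := fun t : ℕ => integral_auxI_term q (M - t) ha hb hμ hne
  have hI : ∀ t ∈ Finset.range (M + 1), IntegrableOn (fun y : ℝ =>
      (-1) ^ (M - t) * (M.factorial : ℝ) * s ^ (M + 1) / ((M - t).factorial : ℝ) *
        (y ^ (q - 1) * Real.exp (-(y / μ)) *
          (-((a * y + b) ^ (M - t) * Real.exp (a * y + b) * expIntegralEi (-(a * y + b))) +
          ∑ u ∈ Finset.Icc 1 (M - t), ((u - 1).factorial : ℝ) * (-1) ^ u *
            (a * y + b) ^ (M - t - u)))) (Ioi 0) := fun t _ => (hT t).1.const_mul _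
  refine ⟨(integrableOn_congr_fun hg measurableSet_Ioi).2 (integrable_finsetSum _ hI), ?_⟩
  rw [setIntegral_congr_fun measurableSet_Ioi hg, integral_finsetSum _ hI, auxI]
  refine Finset.sum_congr rfl fun t _ => ?_
  rw [integral_const_mul, (hT t).2]
  congr 2
  refine Finset.sum_congr rfl fun u _ => ?_
  rw [hab, integral_pow_mul_affine_pow_mul_exp_eq_confluentU hq (M - t - u) hp hμ, hb_def, one_div,
    inv_pow]
  rw [one_div]
  ring

open Set in
/-- For simple diagonal elements, `auxI` is a combination of the terms `auxIBar`. -/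
lemma auxI_one (M : ℕ) {s α p c μ : ℝ} (hs : 0 < s) (hα : α ≠ 0)
    (hp : 0 < p) (hc : 0 < c) (hμ : 0 < μ) :
    auxI M 1 s α p c μ = ∑ t ∈ Finset.range (M + 1),
      (-1) ^ (M - t) * (M.factorial : ℝ) * s ^ (M + 1) / ((M - t).factorial : ℝ) *
        auxIBar M t s α p c μ := by
  rw [auxI]
  refine Finset.sum_congr rfl fun t _ => ?_
  rw [auxIBar]
  congr 2
  refine Finset.sum_congr rfl fun u _ => ?_
  -- For q = 1, U and the incomplete gamma function evaluate the same integral; equating the two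
  -- evaluations converts one into the other.
  have h1 := integral_pow_mul_affine_pow_mul_exp_eq_confluentU le_rfl (M - t - u)
    (b := 1 / (s * α ^ 2 * p * c)) hp hμ
  have h2 := integral_affine_pow_mul_exp_eq_upperGamma (M - t - u)
    (a := 1 / (s * α ^ 2 * c)) hp hμ
  have e1 : p * (1 / (s * α ^ 2 * p * c)) = 1 / (s * α ^ 2 * c) := by field_simp
  have e2 : 1 / (s * α ^ 2 * c) / p = 1 / (s * α ^ 2 * p * c) := by field_simp
  simp only [Nat.sub_self, pow_zero, one_mul, e1] at h1
  rw [e2, h1] at h2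
  simp only [one_div, inv_pow] at h2 ⊢
  linear_combination (((u - 1).factorial : ℝ) * (-1) ^ u) * h2

/-! ## Partial fractions -/

open Polynomial Filter Topology in
-- The expansion comes from repeated Euclidean division by the coprime factors X + μ⁻¹. Their
-- remainders have degree 0, and the polynomial part has to be shown to vanish.
lemma exists_partialFraction (S : Finset ℝ) (n : ℝ → ℕ) (hS : ∀ μ ∈ S, μ ≠ 0)
    (hne : S.Nonempty) (hn : ∀ μ ∈ S, 1 ≤ n μ) :
    ∃ c : ℝ → ℕ → ℝ, ∀ v : ℝ, (∀ μ ∈ S, 1 + μ * v ≠ 0) →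
      ∏ μ ∈ S, ((1 + μ * v) ^ n μ)⁻¹ =
        ∑ μ ∈ S, ∑ q ∈ Finset.Icc 1 (n μ), c μ q * ((1 + μ * v) ^ q)⁻¹ := by
  classical
  obtain ⟨Q, r, hr, hf⟩ := eq_quo_mul_prod_pow_add_sum_rem_mul_prod_pow (R := ℝ) (s := S) 1
    (g := fun μ => X - C (-μ⁻¹)) (fun μ _ => monic_X_sub_C _)
    (fun μ _ ν _ h => isCoprime_X_sub_C_of_isUnit_sub (by
      rw [isUnit_iff_ne_zero]; intro h0; apply h
      have : μ⁻¹ = ν⁻¹ := by linarith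
      exact inv_injective this)) n
  choose! R hR using fun μ (hμ : μ ∈ S) => (show ∃ R : Fin (n μ) → ℝ, ∀ j, r μ j = C (R j) from
    ⟨fun j => (r μ j).coeff 0, fun j => eq_C_of_degree_le_zero (by
      have := hr μ hμ j
      rw [degree_X_sub_C] at this
      exact Nat.WithBot.lt_one_iff_le_zero.1 this)⟩)
  have hev : ∀ v : ℝ, (∀ μ ∈ S, v + μ⁻¹ ≠ 0) → ∏ μ ∈ S, ((v + μ⁻¹) ^ n μ)⁻¹ =
      Q.eval v + ∑ μ ∈ S, ∑ j : Fin (n μ), R μ j * ((v + μ⁻¹) ^ (n μ - j))⁻¹ := by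
    intro v hv
    have h := congrArg (Polynomial.eval v) hf
    have hP : ∏ μ ∈ S, (v + μ⁻¹) ^ n μ ≠ 0 := Finset.prod_ne_zero_iff.2 fun μ hμ => pow_ne_zero _ (hv μ hμ)
    rw [Finset.prod_inv_distrib, inv_eq_iff_eq_inv, eq_comm, inv_eq_iff_eq_inv, ← mul_eq_one_iff_eq_inv₀ hP,
      add_mul, Finset.sum_mul]
    simp only [eval_one, eval_add, eval_mul, eval_prod, eval_pow, eval_sub, eval_X, eval_C,
      sub_neg_eq_add, eval_finsetSum] at h
    rw [h]
    congr 1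
    refine Finset.sum_congr rfl fun μ hμ => ?_
    rw [Finset.sum_mul]
    refine Finset.sum_congr rfl fun j _ => ?_
    rw [hR μ hμ j, eval_C, ← Finset.mul_prod_erase S _ hμ, ← mul_assoc]
    congr 1
    have h1 : (v + μ⁻¹) ^ n μ = (v + μ⁻¹) ^ (n μ - j) * (v + μ⁻¹) ^ (j : ℕ) := by
      rw [← pow_add, Nat.sub_add_cancel j.2.le]
    have h2 := pow_ne_zero (n μ - j) (hv μ hμ)
    rw [h1]
    generalize (v + μ⁻¹) ^ (n μ - j) = w at h2 ⊢
    field_simp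
  have hinv : ∀ (μ : ℝ) (k : ℕ), 1 ≤ k →
      Tendsto (fun v : ℝ => ((v + μ⁻¹) ^ k)⁻¹) atTop (𝓝 0) := fun μ k hk =>
    ((tendsto_pow_atTop (by omega)).comp
      (tendsto_atTop_add_const_right atTop μ⁻¹ tendsto_id)).inv_tendsto_atTop
  -- All other terms of `hev` tend to 0 at infinity, and a polynomial with limit 0 at infinity is
  -- zero.
  have hQ : Q = 0 := by
    have hlim : Tendsto (fun v => Q.eval v) atTop (𝓝 0) := by
      have h1 : Tendsto (fun v : ℝ => ∏ μ ∈ S, ((v + μ⁻¹) ^ n μ)⁻¹ -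
          ∑ μ ∈ S, ∑ j : Fin (n μ), R μ j * ((v + μ⁻¹) ^ (n μ - j))⁻¹) atTop
          (𝓝 (∏ μ ∈ S, 0 - ∑ μ ∈ S, ∑ j : Fin (n μ), R μ j * 0)) := by
        refine Tendsto.sub (tendsto_finsetProd _ fun μ hμ => hinv μ _ (hn μ hμ))
          (tendsto_finsetSum _ fun μ _ => tendsto_finsetSum _ fun j _ => (hinv μ _ ?_).const_mul _)
        have := j.2
        omega
      simp only [mul_zero, Finset.sum_const_zero, sub_zero, Finset.prod_const,
        zero_pow (Finset.card_ne_zero.2 hne)] at h1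
      refine h1.congr' ?_
      have : ∀ᶠ v : ℝ in atTop, ∀ μ ∈ S, v + μ⁻¹ ≠ 0 :=
        (Finset.eventually_all S).2 fun μ _ =>
          (tendsto_atTop_add_const_right atTop μ⁻¹ tendsto_id).eventually_ne_atTop 0
      filter_upwards [this] with v hv
      rw [hev v hv]; ring
    exact leadingCoeff_eq_zero.1 ((Q.tendsto_nhds_iff).1 hlim).1
  -- The remainder of index j sits over (v + μ⁻¹)^(n μ - j), hence q = n μ - j. The extra factors
  -- come from 1 + μv = μ(v + μ⁻¹).
  refine ⟨fun μ q => if h : n μ - q < n μ then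
    (∏ ν ∈ S, (ν ^ n ν)⁻¹) * R μ ⟨n μ - q, h⟩ * μ ^ q else 0, fun v hv => ?_⟩
  have hrel : ∀ μ ∈ S, v + μ⁻¹ = (1 + μ * v) / μ := fun μ hμ => by
    have := hS μ hμ
    field_simp; ring
  have hv' : ∀ μ ∈ S, v + μ⁻¹ ≠ 0 := fun μ hμ => by
    rw [hrel μ hμ]; exact div_ne_zero (hv μ hμ) (hS μ hμ)
  have h := hev v hv'
  rw [hQ, eval_zero, zero_add] at h
  have hl : ∏ μ ∈ S, ((1 + μ * v) ^ n μ)⁻¹ =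
      (∏ ν ∈ S, (ν ^ n ν)⁻¹) * ∏ μ ∈ S, ((v + μ⁻¹) ^ n μ)⁻¹ := by
    rw [← Finset.prod_mul_distrib]
    refine Finset.prod_congr rfl fun μ hμ => ?_
    rw [hrel μ hμ, div_pow, ← mul_inv]
    congr 1
    have := pow_ne_zero (n μ) (hS μ hμ)
    field_simp
  rw [hl, h, Finset.mul_sum]
  refine Finset.sum_congr rfl fun μ hμ => ?_
  rw [Finset.mul_sum]
  symm
  refine Finset.sum_bij (fun q hq => ⟨n μ - q, by
    have := Finset.mem_Icc.1 hq; omega⟩) (fun _ _ => Finset.mem_univ _) ?_ ?_ ?_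
  · intro q₁ h₁ q₂ h₂ h12
    have := Finset.mem_Icc.1 h₁
    have := Finset.mem_Icc.1 h₂
    simp only [Fin.mk.injEq] at h12
    omega
  · intro j _
    have := j.2
    exact ⟨n μ - j, Finset.mem_Icc.2 ⟨by omega, by omega⟩, Fin.ext (by simp; omega)⟩
  · intro q hq
    have hq' := Finset.mem_Icc.1 hq
    simp only [dif_pos (show n μ - q < n μ by omega)]
    rw [hrel μ hμ, div_pow, show n μ - (n μ - q) = q by omega, inv_div]
    ring

open Filter Topology in
lemma iteratedDeriv_affine_pow {μ : ℝ} (hμ : μ ≠ 0) (m k : ℕ) :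
    iteratedDeriv m (fun v : ℝ => (1 + μ * v) ^ k) (-1 / μ) =
      if m = k then (m.factorial : ℝ) * μ ^ m else 0 := by
  have h : (fun v : ℝ => (1 + μ * v) ^ k) = fun v => μ ^ k * (v - (-1 / μ)) ^ k := by
    funext v
    rw [← mul_pow]; congr 1; field_simp; ring
  rw [h, iteratedDeriv_const_mul_field,
    iteratedDeriv_comp_sub_const (f := fun v : ℝ => v ^ k)]
  simp only [sub_self]
  rw [iteratedDeriv_fun_pow_zero]
  split_ifs with h1
  · rw [h1]; ring
  · simp

open Filter Topology in
-- By Leibniz, every term contains a derivative of order at most m < k of the k-th power, which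
-- vanishes at -1/μ.
lemma iteratedDeriv_affine_pow_mul {μ : ℝ} (hμ : μ ≠ 0) {m k : ℕ} (hmk : m < k) {h : ℝ → ℝ}
    (hh : ContDiffAt ℝ m h (-1 / μ)) :
    iteratedDeriv m (fun v : ℝ => (1 + μ * v) ^ k * h v) (-1 / μ) = 0 := by
  rw [iteratedDeriv_fun_mul (by fun_prop) hh]
  refine Finset.sum_eq_zero fun i hi => ?_
  rw [iteratedDeriv_affine_pow hμ, if_neg (by grind)]
  simp

open Filter Topology in
/-- The coefficients of a partial fraction expansion are given by derivatives. -/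
lemma partialFraction_coeff_eq (S : Finset ℝ) (n : ℝ → ℕ) (hS : ∀ μ ∈ S, μ ≠ 0) (c : ℝ → ℕ → ℝ)
    (hc : ∀ v : ℝ, (∀ μ ∈ S, 1 + μ * v ≠ 0) → ∏ μ ∈ S, ((1 + μ * v) ^ n μ)⁻¹ =
        ∑ μ ∈ S, ∑ q ∈ Finset.Icc 1 (n μ), c μ q * ((1 + μ * v) ^ q)⁻¹)
    {μ : ℝ} (hμ : μ ∈ S) {q : ℕ} (hq : q ∈ Finset.Icc 1 (n μ)) :
    c μ q = (((n μ - q).factorial : ℝ) * μ ^ (n μ - q))⁻¹ *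
      iteratedDeriv (n μ - q) (fun v : ℝ => ∏ ν ∈ S.erase μ, ((1 + ν * v) ^ n ν)⁻¹) (-1 / μ) := by
  have hμ0 := hS μ hμ
  have hne : ∀ ν ∈ S.erase μ, 1 + ν * (-1 / μ) ≠ 0 := by
    intro ν hν h
    apply (Finset.mem_erase.1 hν).1
    field_simp at h
    linarith
  have hcd : ∀ ν ∈ S.erase μ, ∀ k m : ℕ,
      ContDiffAt ℝ m (fun v : ℝ => ((1 + ν * v) ^ k)⁻¹) (-1 / μ) := fun ν hν k m =>
    ContDiffAt.inv (by fun_prop) (pow_ne_zero _ (hne ν hν))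
  set g := fun v : ℝ => ∏ ν ∈ S.erase μ, ((1 + ν * v) ^ n ν)⁻¹ with hg
  set h := fun v : ℝ => ∑ ν ∈ S.erase μ, ∑ q ∈ Finset.Icc 1 (n ν), c ν q * ((1 + ν * v) ^ q)⁻¹
    with hh
  have hhcd : ∀ m : ℕ, ContDiffAt ℝ m h (-1 / μ) := fun m =>
    ContDiffAt.sum fun ν hν => ContDiffAt.sum fun q _ => contDiffAt_const.mul (hcd ν hν q m)
  have hgcd : ContDiffAt ℝ 0 g (-1 / μ) := contDiffAt_prod fun ν hν => hcd ν hν _ 0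
  -- `f` is the expansion multiplied by (1 + μv)^(n μ). The terms at μ become a polynomial in 1 + μv
  -- and all others vanish to order n μ, so c μ q is a Taylor coefficient at -1/μ.
  set f := fun v : ℝ => ∑ q' ∈ Finset.Icc 1 (n μ), c μ q' * (1 + μ * v) ^ (n μ - q') +
    (1 + μ * v) ^ n μ * h v with hf
  have hfcd1 : ∀ m : ℕ, ∀ q' ∈ Finset.Icc 1 (n μ),
      ContDiffAt ℝ m (fun v : ℝ => c μ q' * (1 + μ * v) ^ (n μ - q')) (-1 / μ) := fun m q' _ => by
    fun_prop
  have hfcd2 : ∀ m : ℕ, ContDiffAt ℝ m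
      (fun v : ℝ => ∑ q' ∈ Finset.Icc 1 (n μ), c μ q' * (1 + μ * v) ^ (n μ - q')) (-1 / μ) :=
    fun m => ContDiffAt.sum fun q' hq' => hfcd1 m q' hq'
  have hfcd3 : ∀ m : ℕ, ContDiffAt ℝ m (fun v : ℝ => (1 + μ * v) ^ n μ * h v) (-1 / μ) :=
    fun m => ContDiffAt.mul (by fun_prop) (hhcd m)
  -- The expansion is only available away from the pole; continuity of both sides extends the
  -- equality to -1/μ.
  have heq : g =ᶠ[𝓝 (-1 / μ)] f := by
    rw [← ContinuousAt.eventuallyEq_nhds_iff_eventuallyEq_nhdsNE hgcd.continuousAt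
      ((hfcd2 0).add (hfcd3 0)).continuousAt]
    have hev : ∀ᶠ v in 𝓝[≠] (-1 / μ), ∀ ν ∈ S.erase μ, 1 + ν * v ≠ 0 := by
      refine (Finset.eventually_all _).2 fun ν hν => ?_
      exact ((by fun_prop : ContinuousAt (fun v : ℝ => 1 + ν * v) (-1 / μ)).eventually_ne
        (hne ν hν)).filter_mono nhdsWithin_le_nhds
    filter_upwards [hev, self_mem_nhdsWithin] with v hv hvne
    have hvμ : 1 + μ * v ≠ 0 := by
      intro h0
      apply hvne
      show v = -1 / μ
      field_simp
      linarith
    have hall : ∀ ν ∈ S, 1 + ν * v ≠ 0 := fun ν hν => by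
      by_cases hνμ : ν = μ
      · rw [hνμ]; exact hvμ
      · exact hv ν (Finset.mem_erase.2 ⟨hνμ, hν⟩)
    have h1 := hc v hall
    rw [← Finset.mul_prod_erase S _ hμ, ← Finset.add_sum_erase S _ hμ] at h1
    have hpow := pow_ne_zero (n μ) hvμ
    have h2 : g v = (1 + μ * v) ^ n μ * (((1 + μ * v) ^ n μ)⁻¹ * g v) := by field_simp
    rw [h2]
    simp only [hg, hh]
    rw [h1, mul_add, Finset.mul_sum]
    congr 1
    refine Finset.sum_congr rfl fun q' hq' => ?_
    have h3 : (1 + μ * v) ^ n μ = (1 + μ * v) ^ (n μ - q') * (1 + μ * v) ^ q' := by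
      rw [← pow_add, Nat.sub_add_cancel (Finset.mem_Icc.1 hq').2]
    have h4 := pow_ne_zero q' hvμ
    rw [h3]; field_simp
  have hq' := Finset.mem_Icc.1 hq
  rw [heq.iteratedDeriv_eq, hf, iteratedDeriv_fun_add (hfcd2 _) (hfcd3 _),
    iteratedDeriv_affine_pow_mul hμ0 (by omega) (hhcd _), add_zero,
    iteratedDeriv_fun_sum (hfcd1 _), Finset.sum_eq_single q]
  · rw [iteratedDeriv_const_mul_field, iteratedDeriv_affine_pow hμ0, if_pos rfl]
    have := pow_ne_zero (n μ - q) hμ0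
    have : ((n μ - q).factorial : ℝ) ≠ 0 := by positivity
    field_simp
  · intro q₁ h₁ h₁q
    have := Finset.mem_Icc.1 h₁
    rw [iteratedDeriv_const_mul_field, iteratedDeriv_affine_pow hμ0, if_neg (by omega), mul_zero]
  · exact fun h => absurd hq h

lemma mem_distinctEntries {ι : Type*} [Fintype ι] {d : ι → ℝ} {μ : ℝ} :
    μ ∈ distinctEntries d ↔ ∃ s, d s = μ := by
  simp [distinctEntries]

lemma one_le_entryMult {ι : Type*} [Fintype ι] {d : ι → ℝ} {μ : ℝ} (h : μ ∈ distinctEntries d) :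
    1 ≤ entryMult d μ := by
  classical
  obtain ⟨s, rfl⟩ := mem_distinctEntries.1 h
  exact Finset.card_pos.2 ⟨s, by simp⟩

lemma prod_distinctEntries {ι : Type*} [Fintype ι] (d : ι → ℝ) (f : ℝ → ℝ) :
    ∏ s, f (d s) = ∏ μ ∈ distinctEntries d, f μ ^ entryMult d μ := by
  classical
  rw [distinctEntries]
  convert Finset.prod_comp f d
  unfold entryMult
  congr

/-- The partial fraction expansion of `det (I + v diag d)⁻¹`. -/
lemma prod_inv_eq_sum_charCoeff {ι : Type*} [Fintype ι] [Nonempty ι] {d : ι → ℝ}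
    (hd : ∀ s, 0 < d s) {v : ℝ} (hv : 0 ≤ v) :
    ∏ s, (1 + d s * v)⁻¹ = ∑ μ ∈ distinctEntries d, ∑ q ∈ Finset.Icc 1 (entryMult d μ),
      charCoeff d μ q * ((1 + μ * v) ^ q)⁻¹ := by
  have hpos : ∀ μ ∈ distinctEntries d, 0 < μ := fun μ hμ => by
    obtain ⟨s, rfl⟩ := mem_distinctEntries.1 hμ
    exact hd s
  have hS : ∀ μ ∈ distinctEntries d, μ ≠ 0 := fun μ hμ => (hpos μ hμ).ne'
  obtain ⟨c, hc⟩ := exists_partialFraction (distinctEntries d) (entryMult d) hS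
    ⟨d (Classical.arbitrary ι), mem_distinctEntries.2 ⟨_, rfl⟩⟩ fun μ hμ => one_le_entryMult hμ
  rw [prod_distinctEntries d fun x => (1 + x * v)⁻¹]
  simp_rw [inv_pow]
  rw [hc v fun μ hμ => by have := hpos μ hμ; positivity]
  refine Finset.sum_congr rfl fun μ hμ => Finset.sum_congr rfl fun q hq => ?_
  rw [partialFraction_coeff_eq _ _ hS c hc hμ hq, charCoeff]

/-! ## Logarithms and Laplace transforms -/

open Set in
-- The inequality 1 - e^{-h} ≤ h bounds the integrand by (v - u) e^{-uz}, which removes the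
-- singularity at z = 0.
lemma integrableOn_frullani_exp {u v : ℝ} (hu : 0 < u) (huv : u ≤ v) :
    IntegrableOn (fun z : ℝ => z⁻¹ * (Real.exp (-(z * u)) - Real.exp (-(z * v)))) (Ioi 0) := by
  refine Integrable.mono' (((integral_Ioi_pow_mul_exp 0 hu le_rfl).1).const_mul (v - u)) ?_ ?_
  · exact (by fun_prop : Measurable fun z : ℝ =>
      z⁻¹ * (Real.exp (-(z * u)) - Real.exp (-(z * v)))).aestronglyMeasurable
  · filter_upwards [ae_restrict_mem measurableSet_Ioi] with z hz
    have hz0 : 0 < z := hz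
    have h0 : Real.exp (-(z * v)) ≤ Real.exp (-(z * u)) := by
      apply Real.exp_le_exp.2; nlinarith
    have h1 : -(z * (v - u)) + 1 ≤ Real.exp (-(z * (v - u))) := Real.add_one_le_exp _
    have h2 : Real.exp (-(z * v)) = Real.exp (-(z * u)) * Real.exp (-(z * (v - u))) := by
      rw [← Real.exp_add]; congr 1; ring
    rw [Real.norm_eq_abs, abs_of_nonneg (mul_nonneg (by positivity) (sub_nonneg.2 h0)), pow_zero,
      one_mul, inv_mul_le_iff₀ hz0, h2, mul_comm u z]
    nlinarith [Real.exp_pos (-(z * u))]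

open Set Filter Topology in
lemma integral_frullani_exp {u v : ℝ} (hu : 0 < u) (huv : u ≤ v) :
    ∫ z in Ioi 0, z⁻¹ * (Real.exp (-(z * u)) - Real.exp (-(z * v))) = Real.log (v / u) := by
  have hc : Continuous fun x : ℝ => Real.exp (-x) := by fun_prop
  have hL : Tendsto (fun x : ℝ => Real.exp (-x)) (𝓝[>] 0) (𝓝 1) := by
    have := hc.tendsto 0
    simp only [neg_zero, Real.exp_zero] at this
    exact this.mono_left nhdsWithin_le_nhds
  have hR : Tendsto (fun x : ℝ => Real.exp (-x)) atTop (𝓝 0) :=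
    Real.tendsto_exp_comp_nhds_zero.2 tendsto_neg_atTop_atBot
  have h := Frullani.integral_Ioi_eq (f := fun x : ℝ => Real.exp (-x))
    (hc.locallyIntegrable.locallyIntegrableOn _) hu (hu.trans_le huv) hL hR (by
      simpa only [smul_eq_mul, mul_comm u, mul_comm v] using integrableOn_frullani_exp hu huv)
  simpa only [smul_eq_mul, sub_zero, mul_one, mul_comm u, mul_comm v] using h

open Set in
/-- The expectation of `log (V / U)` in terms of the Laplace transforms of `U` and `V`. -/
lemma integral_log_div_eq_integral_laplace {Ω : Type*} [MeasurableSpace Ω] {P : Measure Ω}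
    [IsFiniteMeasure P] {U V : Ω → ℝ} (hU : AEMeasurable U P) (hV : AEMeasurable V P)
    (h : ∀ᵐ ω ∂P, 0 < U ω ∧ U ω ≤ V ω) (hi : Integrable (fun ω => Real.log (V ω / U ω)) P) :
    IntegrableOn (fun z => z⁻¹ * ((∫ ω, Real.exp (-(z * U ω)) ∂P) -
      ∫ ω, Real.exp (-(z * V ω)) ∂P)) (Ioi 0) ∧
    ∫ z in Ioi 0, z⁻¹ * ((∫ ω, Real.exp (-(z * U ω)) ∂P) - ∫ ω, Real.exp (-(z * V ω)) ∂P) =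
      ∫ ω, Real.log (V ω / U ω) ∂P := by
  have hpos : ∀ ω, 0 < U ω ∧ U ω ≤ V ω → ∀ z ∈ Ioi (0 : ℝ),
      0 ≤ z⁻¹ * (Real.exp (-(z * U ω)) - Real.exp (-(z * V ω))) := by
    intro ω hω z hz
    have hz0 : 0 < z := hz
    refine mul_nonneg (by positivity) (sub_nonneg.2 (Real.exp_le_exp.2 ?_))
    nlinarith [hω.2]
  have hint : Integrable (fun x : Ω × ℝ =>
      x.2⁻¹ * (Real.exp (-(x.2 * U x.1)) - Real.exp (-(x.2 * V x.1))))
      (P.prod (volume.restrict (Ioi 0))) := by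
    have hm : AEStronglyMeasurable (fun x : Ω × ℝ =>
        x.2⁻¹ * (Real.exp (-(x.2 * U x.1)) - Real.exp (-(x.2 * V x.1))))
        (P.prod (volume.restrict (Ioi 0))) := by
      have h1 : AEMeasurable (fun x : Ω × ℝ => U x.1) (P.prod (volume.restrict (Ioi 0))) :=
        hU.comp_quasiMeasurePreserving Measure.quasiMeasurePreserving_fst
      have h2 : AEMeasurable (fun x : Ω × ℝ => V x.1) (P.prod (volume.restrict (Ioi 0))) :=
        hV.comp_quasiMeasurePreserving Measure.quasiMeasurePreserving_fst
      exact AEMeasurable.aestronglyMeasurable (by fun_prop)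
    rw [integrable_prod_iff hm]
    refine ⟨?_, ?_⟩
    · filter_upwards [h] with ω hω
      exact integrableOn_frullani_exp hω.1 hω.2
    -- The integrand is nonnegative, so its L¹ norm in z is log(V/U) itself, and Fubini needs no
    -- more than `hi`.
    · refine hi.congr ?_
      filter_upwards [h] with ω hω
      rw [← integral_frullani_exp hω.1 hω.2]
      refine setIntegral_congr_fun measurableSet_Ioi fun z hz => ?_
      exact (Real.norm_of_nonneg (hpos ω hω z hz)).symm
  have heq : ∀ z ∈ Ioi (0 : ℝ),
      ∫ ω, z⁻¹ * (Real.exp (-(z * U ω)) - Real.exp (-(z * V ω))) ∂P =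
      z⁻¹ * ((∫ ω, Real.exp (-(z * U ω)) ∂P) - ∫ ω, Real.exp (-(z * V ω)) ∂P) := by
    intro z hz
    have hz0 : 0 < z := hz
    have hb : ∀ W : Ω → ℝ, AEMeasurable W P → (∀ᵐ ω ∂P, 0 ≤ W ω) →
        Integrable (fun ω => Real.exp (-(z * W ω))) P := fun W hW hW0 => by
      refine Integrable.mono' (integrable_const 1)
        (AEMeasurable.aestronglyMeasurable (by fun_prop)) ?_
      filter_upwards [hW0] with ω hω
      rw [Real.norm_eq_abs, abs_of_pos (Real.exp_pos _), Real.exp_le_one_iff]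
      have := mul_nonneg hz0.le hω
      linarith
    rw [integral_const_mul, integral_sub (hb U hU ?_) (hb V hV ?_)]
    · filter_upwards [h] with ω hω using hω.1.le
    · filter_upwards [h] with ω hω using hω.1.le.trans hω.2
  refine ⟨(integrableOn_congr_fun heq measurableSet_Ioi).1 hint.integral_prod_right, ?_⟩
  rw [← setIntegral_congr_fun measurableSet_Ioi heq]
  rw [← integral_integral_swap hint]
  refine integral_congr_ae ?_
  filter_upwards [h] with ω hω using integral_frullani_exp hω.1 hω.2

/-! ### Erlang laws, log ratios and the closed form as a Laplace integral. -/

open Set in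
lemma integral_pow_mul_exp_neg_mul (j : ℕ) {r : ℝ} (hr : 0 < r) :
    IntegrableOn (fun x : ℝ => x ^ j * Real.exp (-(r * x))) (Ioi 0) ∧
    ∫ x in Ioi 0, x ^ j * Real.exp (-(r * x)) = (j.factorial : ℝ) / r ^ (j + 1) := by
  have h := integral_Ioi_pow_mul_exp j hr le_rfl
  refine ⟨h.1, h.2.trans ?_⟩
  rw [Finset.sum_eq_single j]
  · simp
  · intro u hu huj
    rw [zero_pow (by grind), mul_zero, zero_div]
  · grind

/-- The Erlang distribution with shape `n + 1` and scale `s`. -/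
noncomputable def erlangMeasure (n : ℕ) (s : ℝ) : Measure ℝ :=
  (volume.restrict (Set.Ioi 0)).withDensity fun x =>
    ENNReal.ofReal (x ^ n * Real.exp (-(x / s)) / ((n.factorial : ℝ) * s ^ (n + 1)))

open Set in
lemma erlangMeasure_density (n : ℕ) {s : ℝ} (hs : 0 < s) :
    IntegrableOn (fun x : ℝ => x ^ n * Real.exp (-(x / s)) / ((n.factorial : ℝ) * s ^ (n + 1)))
      (Ioi 0) ∧
    ∫ x in Ioi 0, x ^ n * Real.exp (-(x / s)) / ((n.factorial : ℝ) * s ^ (n + 1)) = 1 := by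
  obtain ⟨h1, h2⟩ := integral_pow_mul_exp_neg_mul n (inv_pos.2 hs)
  have : ∀ x : ℝ, s⁻¹ * x = x / s := fun x => by ring
  simp_rw [this] at h1 h2
  refine ⟨h1.div_const _, ?_⟩
  rw [integral_div, h2, inv_pow]
  have := pow_pos hs (n + 1)
  have : (0 : ℝ) < n.factorial := by positivity
  field_simp

open Set in
lemma isProbabilityMeasure_erlangMeasure (n : ℕ) {s : ℝ} (hs : 0 < s) :
    IsProbabilityMeasure (erlangMeasure n s) := by
  obtain ⟨h1, h2⟩ := erlangMeasure_density n hs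
  constructor
  rw [erlangMeasure, withDensity_apply _ MeasurableSet.univ, Measure.restrict_univ,
    ← ofReal_integral_eq_lintegral_ofReal h1, h2, ENNReal.ofReal_one]
  filter_upwards [ae_restrict_mem measurableSet_Ioi] with x hx
  have hx0 : 0 < x := hx
  simp only [Pi.zero_apply]
  positivity

open Set in
lemma integral_erlangMeasure (n : ℕ) {s : ℝ} (hs : 0 < s) (f : ℝ → ℝ) :
    ∫ x, f x ∂(erlangMeasure n s) =
      ((n.factorial : ℝ) * s ^ (n + 1))⁻¹ * ∫ x in Ioi 0, x ^ n * Real.exp (-(x / s)) * f x := by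
  rw [erlangMeasure, integral_withDensity_eq_integral_toReal_smul (by fun_prop) (by simp),
    ← integral_const_mul]
  refine setIntegral_congr_fun measurableSet_Ioi fun x hx => ?_
  have hx0 : 0 < x := hx
  simp only [smul_eq_mul]
  rw [ENNReal.toReal_ofReal (by positivity)]
  ring

open Set in
lemma ae_pos_erlangMeasure (n : ℕ) (s : ℝ) : ∀ᵐ x ∂(erlangMeasure n s), 0 < x :=
  (withDensity_absolutelyContinuous _ _).ae_le (ae_restrict_mem measurableSet_Ioi)

/-- The Laplace transform of the Erlang distribution. -/
lemma integral_exp_erlangMeasure (n : ℕ) {s t : ℝ} (hs : 0 < s) (ht : 0 ≤ t) :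
    ∫ x, Real.exp (-(t * x)) ∂(erlangMeasure n s) = ((1 + s * t) ^ (n + 1))⁻¹ := by
  rw [integral_erlangMeasure n hs]
  have hr : 0 < s⁻¹ + t := by positivity
  have := (integral_pow_mul_exp_neg_mul n hr).2
  have h2 : ∀ x : ℝ, x ^ n * Real.exp (-(x / s)) * Real.exp (-(t * x)) =
      x ^ n * Real.exp (-((s⁻¹ + t) * x)) := fun x => by
    rw [mul_assoc, ← Real.exp_add]; congr 2; ring
  simp_rw [h2]
  rw [this, show 1 + s * t = s * (s⁻¹ + t) by field_simp, mul_pow]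
  have : (0 : ℝ) < n.factorial := by positivity
  field_simp

/-- With U and V the denominator and numerator, (1 + 1/C)U = V + Q/C. The logarithm is thus bounded
by a constant, and no tail estimate is needed for integrability. -/
lemma log_ratio_bounds {Q x C A : ℝ} (hQ : 0 < Q) (hx : 0 ≤ x) (hC : 0 < C) (hA : 0 < A) :
    0 < Q + A * C * x ∧ Q + A * C * x ≤ Q + A * (C + 1) * x ∧
    0 ≤ Real.log ((Q + A * (C + 1) * x) / (Q + A * C * x)) ∧
    Real.log ((Q + A * (C + 1) * x) / (Q + A * C * x)) ≤ Real.log (1 + 1 / C) := by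
  have h0 : 0 < Q + A * C * x := by positivity
  have h1 : Q + A * C * x ≤ Q + A * (C + 1) * x := by nlinarith [mul_nonneg hA.le hx]
  refine ⟨h0, h1, Real.log_nonneg ((one_le_div h0).2 h1), ?_⟩
  refine Real.log_le_log (div_pos (h0.trans_le h1) h0) ?_
  rw [div_le_iff₀ h0]
  have h2 : (1 + 1 / C) * (Q + A * C * x) = Q + A * (C + 1) * x + Q / C := by
    field_simp; ring
  rw [h2]
  have : 0 < Q / C := by positivity
  linarith

lemma integrable_log_ratio {Ω : Type*} [MeasurableSpace Ω] {P : Measure Ω}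
    [IsFiniteMeasure P] {Q X : Ω → ℝ} (hQ : AEMeasurable Q P) (hX : AEMeasurable X P)
    (hpos : ∀ᵐ ω ∂P, 0 < Q ω ∧ 0 ≤ X ω) {A C : ℝ} (hA : 0 < A) (hC : 0 < C) :
    Integrable (fun ω => Real.log ((Q ω + A * (C + 1) * X ω) / (Q ω + A * C * X ω))) P := by
  refine Integrable.mono' (integrable_const (Real.log (1 + 1 / C)))
    (AEMeasurable.aestronglyMeasurable (by fun_prop)) ?_
  filter_upwards [hpos] with ω hω
  obtain ⟨-, -, h0, h1⟩ := log_ratio_bounds hω.1 hω.2 hC hA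
  rwa [Real.norm_eq_abs, abs_of_nonneg h0]

open Set in
-- The right-hand side sees the probability space only through `F`. The lemma is used twice, for the
-- channel and for pairs of Erlang variables, and this is how the two are compared.
lemma integral_log_ratio_eq {Ω : Type*} [MeasurableSpace Ω] {P : Measure Ω}
    [IsFiniteMeasure P] {Q X : Ω → ℝ} (hQ : AEMeasurable Q P) (hX : AEMeasurable X P)
    (hpos : ∀ᵐ ω ∂P, 0 < Q ω ∧ 0 ≤ X ω) {A C : ℝ} (hA : 0 < A) (hC : 0 < C) {F : ℝ → ℝ → ℝ}
    (hF : ∀ z c, 0 < z → 0 < c → ∫ ω, Real.exp (-(z * (Q ω + A * c * X ω))) ∂P = F z c) :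
    IntegrableOn (fun z => z⁻¹ * (F z C - F z (C + 1))) (Ioi 0) ∧
    ∫ ω, Real.log ((Q ω + A * (C + 1) * X ω) / (Q ω + A * C * X ω)) ∂P =
      ∫ z in Ioi 0, z⁻¹ * (F z C - F z (C + 1)) := by
  have h := integral_log_div_eq_integral_laplace (P := P) (U := fun ω => Q ω + A * C * X ω)
    (V := fun ω => Q ω + A * (C + 1) * X ω) (by fun_prop) (by fun_prop)
    (hpos.mono fun ω hω => by
      obtain ⟨h0, h1, -⟩ := log_ratio_bounds hω.1 hω.2 hC hA
      exact ⟨h0, h1⟩) (integrable_log_ratio hQ hX hpos hA hC)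
  have heq : ∀ z ∈ Ioi (0 : ℝ), z⁻¹ * ((∫ ω, Real.exp (-(z * (Q ω + A * C * X ω))) ∂P) -
      ∫ ω, Real.exp (-(z * (Q ω + A * (C + 1) * X ω))) ∂P) = z⁻¹ * (F z C - F z (C + 1)) := by
    intro z hz
    rw [hF z C hz hC, hF z (C + 1) hz (by positivity)]
  exact ⟨(integrableOn_congr_fun heq measurableSet_Ioi).1 h.1, by
    rw [← setIntegral_congr_fun measurableSet_Ioi heq, h.2]⟩

/-- The Laplace transform, in the variable `z`, of `p Y + 1 + α² p c X` for independent Erlang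
variables `Y` and `X`. -/
noncomputable def erlangLaplace (m M : ℕ) (μ s A p z c : ℝ) : ℝ :=
  Real.exp (-z) * ((1 + μ * (p * z)) ^ m)⁻¹ * ((1 + s * (z * A * c)) ^ (M + 1))⁻¹

open Set in
-- The Frullani identity read backwards: the z-integral is the expectation of a log ratio under a
-- product of two Erlang laws, and this expectation is a difference of two iterated integrals
-- `auxI`.
lemma integral_erlang_log_ratio {q : ℕ} (hq : 1 ≤ q) (M : ℕ) {s α p C μ : ℝ} (hs : 0 < s)
    (hα : α ≠ 0) (hp : 0 < p) (hC : 0 < C) (hμ : 0 < μ)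
    (h1 : 1 / μ - 1 / (s * α ^ 2 * (C + 1)) ≠ 0) (h0 : 1 / μ - 1 / (s * α ^ 2 * C) ≠ 0) :
    IntegrableOn (fun z => z⁻¹ * (erlangLaplace q M μ s (α ^ 2 * p) p z C -
      erlangLaplace q M μ s (α ^ 2 * p) p z (C + 1))) (Ioi 0) ∧
    (μ ^ q)⁻¹ / (((q - 1).factorial : ℝ) * (M.factorial : ℝ) * s ^ (M + 1)) *
      (auxI M q s α p (C + 1) μ - auxI M q s α p C μ) =
    ∫ z in Ioi 0, z⁻¹ * (erlangLaplace q M μ s (α ^ 2 * p) p z C -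
      erlangLaplace q M μ s (α ^ 2 * p) p z (C + 1)) := by
  have := isProbabilityMeasure_erlangMeasure (q - 1) hμ
  have := isProbabilityMeasure_erlangMeasure M hs
  set A := α ^ 2 * p with hA_def
  have hA : 0 < A := by positivity
  set ν := (erlangMeasure (q - 1) μ).prod (erlangMeasure M s) with hν
  have hpos : ∀ᵐ ω ∂ν, 0 < p * ω.1 + 1 ∧ 0 ≤ ω.2 := by
    have e1 : ∀ᵐ ω ∂ν, 0 < ω.1 :=
      Measure.quasiMeasurePreserving_fst.ae (ae_pos_erlangMeasure (q - 1) μ)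
    have e2 : ∀ᵐ ω ∂ν, 0 < ω.2 :=
      Measure.quasiMeasurePreserving_snd.ae (ae_pos_erlangMeasure M s)
    filter_upwards [e1, e2] with ω h1 h2
    exact ⟨by positivity, h2.le⟩
  have hF : ∀ z c : ℝ, 0 < z → 0 < c →
      ∫ ω, Real.exp (-(z * (p * ω.1 + 1 + A * c * ω.2))) ∂ν = erlangLaplace q M μ s A p z c := by
    intro z c hz hc
    have : ∀ ω : ℝ × ℝ, Real.exp (-(z * (p * ω.1 + 1 + A * c * ω.2))) =
        Real.exp (-z) * (Real.exp (-(p * z * ω.1)) * Real.exp (-(z * A * c * ω.2))) := fun ω => by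
      rw [← Real.exp_add, ← Real.exp_add]; congr 1; ring
    simp_rw [this]
    rw [integral_const_mul, hν, integral_prod_mul (fun y : ℝ => Real.exp (-(p * z * y)))
      (fun x : ℝ => Real.exp (-(z * A * c * x))), integral_exp_erlangMeasure _ hμ (by positivity),
      integral_exp_erlangMeasure _ hs (by positivity), Nat.sub_add_cancel hq, erlangLaplace]
    ring
  have hmain := integral_log_ratio_eq (P := ν) (Q := fun ω => p * ω.1 + 1) (X := fun ω => ω.2)
    (by fun_prop) (by fun_prop) hpos hA hC hF
  refine ⟨hmain.1, ?_⟩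
  rw [← hmain.2]
  have hint := integrable_log_ratio (P := ν) (Q := fun ω => p * ω.1 + 1) (X := fun ω => ω.2)
    (by fun_prop) (by fun_prop) hpos hA hC
  rw [integral_prod _ hint, integral_erlangMeasure _ hμ, Nat.sub_add_cancel hq]
  obtain ⟨i1, j1⟩ := integral_auxI hq M hs hα hp (by positivity : 0 < C + 1) hμ h1
  obtain ⟨i0, j0⟩ := integral_auxI hq M hs hα hp hC hμ h0
  have hinner : ∀ y ∈ Ioi (0 : ℝ), y ^ (q - 1) * Real.exp (-(y / μ)) *
      ∫ x, Real.log ((p * y + 1 + A * (C + 1) * x) / (p * y + 1 + A * C * x)) ∂(erlangMeasure M s) =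
      ((M.factorial : ℝ) * s ^ (M + 1))⁻¹ *
      (y ^ (q - 1) * Real.exp (-(y / μ)) *
        (∫ x in Ioi 0, x ^ M * Real.exp (-(x / s)) *
          Real.log (1 + α ^ 2 * p * (C + 1) * x / (p * y + 1))) -
      y ^ (q - 1) * Real.exp (-(y / μ)) *
        (∫ x in Ioi 0, x ^ M * Real.exp (-(x / s)) *
          Real.log (1 + α ^ 2 * p * C * x / (p * y + 1)))) := by
    intro y hy
    have hy0 : 0 < y := hy
    have hI : ∀ c : ℝ, 0 < c → IntegrableOn (fun x : ℝ => x ^ M * Real.exp (-(x / s)) *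
        Real.log (1 + α ^ 2 * p * c * x / (p * y + 1))) (Ioi 0) := fun c hc => by
      have := (integral_gamma_log M hs
        (by positivity : 0 < (p * y + 1) / (s * (α ^ 2 * p * c)))).1
      refine (integrableOn_congr_fun (fun x _ => ?_) measurableSet_Ioi).1 this
      congr 3
      field_simp
    rw [integral_erlangMeasure _ hs, ← mul_sub, ← integral_sub (hI _ (by positivity)) (hI _ hC)]
    -- Dividing both parts of the ratio by py + 1 splits its logarithm into the c = C + 1 and c = C
    -- integrands of `auxI`.
    have : ∀ x ∈ Ioi (0 : ℝ), x ^ M * Real.exp (-(x / s)) *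
        Real.log ((p * y + 1 + A * (C + 1) * x) / (p * y + 1 + A * C * x)) =
        x ^ M * Real.exp (-(x / s)) * Real.log (1 + α ^ 2 * p * (C + 1) * x / (p * y + 1)) -
        x ^ M * Real.exp (-(x / s)) * Real.log (1 + α ^ 2 * p * C * x / (p * y + 1)) := by
      intro x hx
      have hx0 : 0 < x := hx
      have p1 : 0 < 1 + α ^ 2 * p * (C + 1) * x / (p * y + 1) := by positivity
      have p0 : 0 < 1 + α ^ 2 * p * C * x / (p * y + 1) := by positivity
      rw [← mul_sub, ← Real.log_div p1.ne' p0.ne']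
      congr 2
      rw [hA_def]
      have : 0 < p * y + 1 + α ^ 2 * p * C * x := by positivity
      field_simp
    rw [setIntegral_congr_fun measurableSet_Ioi this]
    ring
  rw [setIntegral_congr_fun measurableSet_Ioi hinner, integral_const_mul, integral_sub i1 i0, j1, j0]
  field_simp

open Set in
/-- The closed form of the rate as a single integral of Laplace transforms. -/
lemma rateClosedForm_eq_integral {ι : Type*} [Fintype ι] [Nonempty ι] {d : ι → ℝ}
    (hd : ∀ i, 0 < d i) (M : ℕ) {s α p C : ℝ} (hs : 0 < s)
    (hα : α ≠ 0) (hp : 0 < p) (hC : 0 < C)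
    (hne : ∀ i, 1 / d i - 1 / (s * α ^ 2 * (C + 1)) ≠ 0 ∧ 1 / d i - 1 / (s * α ^ 2 * C) ≠ 0) :
    rateClosedForm d M s α p C = (Real.log 2)⁻¹ *
      ∫ z in Ioi 0, z⁻¹ *
        (Real.exp (-z) * (∏ i, (1 + d i * (p * z))⁻¹) *
            ((1 + s * (z * (α ^ 2 * p) * C)) ^ (M + 1))⁻¹ -
          Real.exp (-z) * (∏ i, (1 + d i * (p * z))⁻¹) *
            ((1 + s * (z * (α ^ 2 * p) * (C + 1))) ^ (M + 1))⁻¹) := by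
  have hμ : ∀ μ ∈ distinctEntries d, 0 < μ ∧ 1 / μ - 1 / (s * α ^ 2 * (C + 1)) ≠ 0 ∧
      1 / μ - 1 / (s * α ^ 2 * C) ≠ 0 := fun μ hμ => by
    obtain ⟨i, rfl⟩ := mem_distinctEntries.1 hμ
    exact ⟨hd i, hne i⟩
  have hE := fun μ (h : μ ∈ distinctEntries d) q (hq : q ∈ Finset.Icc 1 (entryMult d μ)) =>
    integral_erlang_log_ratio (Finset.mem_Icc.1 hq).1 M hs hα hp hC (hμ μ h).1
      (hμ μ h).2.1 (hμ μ h).2.2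
  -- The coefficients may be negative, so this need not be a mixture of probability laws. Linearity
  -- of the z-integral is all that is used.
  have hz : ∀ z ∈ Ioi (0 : ℝ), z⁻¹ *
        (Real.exp (-z) * (∏ i, (1 + d i * (p * z))⁻¹) *
            ((1 + s * (z * (α ^ 2 * p) * C)) ^ (M + 1))⁻¹ -
          Real.exp (-z) * (∏ i, (1 + d i * (p * z))⁻¹) *
            ((1 + s * (z * (α ^ 2 * p) * (C + 1))) ^ (M + 1))⁻¹) =
      ∑ μ ∈ distinctEntries d, ∑ q ∈ Finset.Icc 1 (entryMult d μ), charCoeff d μ q *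
        (z⁻¹ * (erlangLaplace q M μ s (α ^ 2 * p) p z C -
          erlangLaplace q M μ s (α ^ 2 * p) p z (C + 1))) := by
    intro z hz
    have hz0 : 0 < z := hz
    rw [prod_inv_eq_sum_charCoeff hd (by positivity : 0 ≤ p * z), ← mul_sub, Finset.mul_sum,
      Finset.sum_mul, Finset.mul_sum]
    refine Finset.sum_congr rfl fun μ _ => ?_
    rw [Finset.mul_sum, Finset.sum_mul, Finset.mul_sum]
    refine Finset.sum_congr rfl fun q _ => ?_
    simp only [erlangLaplace]
    ring
  rw [setIntegral_congr_fun measurableSet_Ioi hz,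
    integral_finsetSum _ fun μ hμ => integrable_finsetSum _ fun q hq =>
      ((hE μ hμ q hq).1).const_mul _, rateClosedForm, Finset.mul_sum]
  refine Finset.sum_congr rfl fun μ hμ => ?_
  rw [integral_finsetSum _ fun q hq => ((hE μ hμ q hq).1).const_mul _, Finset.mul_sum]
  refine Finset.sum_congr rfl fun q hq => ?_
  rw [integral_const_mul, ← (hE μ hμ q hq).2, Real.logb, Real.log_exp]
  ring

/-! ## Distinct diagonal elements -/

section DistinctEntries

variable {ι : Type*} [Fintype ι] {d : ι → ℝ}

lemma card_distinctEntries (h : Function.Injective d) :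
    (distinctEntries d).card = Fintype.card ι := by
  classical
  rw [distinctEntries, Finset.card_image_of_injective _ h, Finset.card_univ]

lemma entryMult_eq_one (h : Function.Injective d) (i : ι) : entryMult d (d i) = 1 := by
  classical
  rw [entryMult, Finset.card_eq_one]
  exact ⟨i, by ext j; simp [h.eq_iff]⟩

lemma charCoeff_one_eq_prod (h : Function.Injective d) [DecidableEq ι] (i : ι) :
    charCoeff d (d i) 1 = ∏ j ∈ Finset.univ.erase i, (1 - d j / d i)⁻¹ := by
  classical
  rw [charCoeff, entryMult_eq_one h]
  simp only [Nat.sub_self, Nat.factorial_zero, Nat.cast_one, pow_zero, mul_one, inv_one, one_mul,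
    iteratedDeriv_zero]
  have : (distinctEntries d).erase (d i) = (Finset.univ.erase i).image d := by
    rw [distinctEntries, Finset.image_erase h]
  rw [this, Finset.prod_image h.injOn]
  refine Finset.prod_congr rfl fun j _ => ?_
  rw [entryMult_eq_one h, pow_one]
  congr 1
  ring

lemma rateClosedForm_eq_distinct (h : Function.Injective d) (hd : ∀ i, 0 < d i) (M : ℕ)
    {s α p C : ℝ} (hs : 0 < s) (hα : α ≠ 0) (hp : 0 < p) (hC : 0 < C) :
    rateClosedForm d M s α p C = rateClosedFormDistinct d M s α p C := by
  classical
  have hsum : ∀ f : ℝ → ℝ, ∑ μ ∈ distinctEntries d, f μ = ∑ i, f (d i) := fun f => by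
    rw [distinctEntries, ← Finset.sum_image (f := f) (s := Finset.univ) h.injOn]
  rw [rateClosedForm, rateClosedFormDistinct, hsum]
  refine Finset.sum_congr rfl fun i _ => ?_
  rw [entryMult_eq_one h, Finset.Icc_self, Finset.sum_singleton, charCoeff_one_eq_prod h,
    auxI_one M hs hα hp (by positivity : 0 < C + 1) (hd i), auxI_one M hs hα hp hC (hd i),
    ← Finset.sum_sub_distrib, Finset.mul_sum]
  refine Finset.sum_congr rfl fun t _ => ?_
  have h1 : (0 : ℝ) < M.factorial := by positivity
  have h2 : (0 : ℝ) < (M - t).factorial := by positivity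
  have h3 := (hd i).ne'
  have h4 : ((-1 : ℝ) ^ (M - t)) * (-1) ^ (M - t) = 1 := by rw [← mul_pow]; simp
  have h5 : ((-1 : ℝ) ^ (M - t)) ≠ 0 := by simp
  have h6 := pow_pos hs (M + 1)
  generalize ((-1 : ℝ) ^ (M - t)) = e at h4 h5 ⊢
  -- The sign (-1)^(M-t) is a factor in `auxI` but a divisor in `rateClosedFormDistinct`.
  have h7 : e = e⁻¹ := eq_inv_of_mul_eq_one_left h4
  convert_to _ = (∏ j ∈ Finset.univ.erase i, (1 - d j / d i)⁻¹) * Real.logb 2 (Real.exp 1) /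
        (((M - t).factorial : ℝ) * e * d i) *
      (auxIBar M t s α p (C + 1) (d i) - auxIBar M t s α p C (d i))
  rw [← mul_sub]
  nth_rewrite 1 [h7]
  simp only [Nat.sub_self, Nat.factorial_zero, Nat.cast_one, pow_one, one_mul]
  field_simp

end DistinctEntries

/-! ## Complex Gaussian variables -/

instance isProbabilityMeasure_complexGaussian (v : ℝ) :
    IsProbabilityMeasure (complexGaussian v) :=
  Measure.isProbabilityMeasure_map Complex.measurableEquivRealProd.symm.measurable.aemeasurable

lemma integral_complexGaussian {E : Type*} [NormedAddCommGroup E] [NormedSpace ℝ E] (v : ℝ)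
    (f : ℂ → E) : ∫ y, f y ∂(complexGaussian v) =
      ∫ x, f ⟨x.1, x.2⟩ ∂((gaussianReal 0 (v / 2).toNNReal).prod
        (gaussianReal 0 (v / 2).toNNReal)) := by
  rw [complexGaussian, integral_map_equiv]
  rfl

open ComplexConjugate in
/-- The characteristic function of the circularly symmetric complex Gaussian law. -/
lemma integral_cexp_complexGaussian {v : ℝ} (hv : 0 ≤ v) (t : ℂ) :
    ∫ y, Complex.exp (((conj t * y).re : ℝ) * Complex.I) ∂(complexGaussian v) =
      Complex.exp ((-(v * ‖t‖ ^ 2 / 4) : ℝ)) := by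
  rw [integral_complexGaussian]
  have h : ∀ x : ℝ × ℝ, Complex.exp (((conj t * (⟨x.1, x.2⟩ : ℂ)).re : ℝ) * Complex.I) =
      Complex.exp (t.re * x.1 * Complex.I) * Complex.exp (t.im * x.2 * Complex.I) := by
    intro x
    rw [← Complex.exp_add]
    congr 1
    simp only [Complex.mul_re, Complex.conj_re, Complex.conj_im]
    push_cast
    ring
  simp_rw [h]
  rw [integral_prod_mul (fun x : ℝ => Complex.exp (t.re * x * Complex.I))
    (fun x : ℝ => Complex.exp (t.im * x * Complex.I)), ← charFun_apply_real, ← charFun_apply_real,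
    charFun_gaussianReal, charFun_gaussianReal, ← Complex.exp_add]
  congr 1
  have hv2 : ((v / 2).toNNReal : ℝ) = v / 2 := Real.coe_toNNReal _ (by positivity)
  have hc : (((v / 2).toNNReal : ℝ) : ℂ) = v / 2 := by rw [hv2]; push_cast; rfl
  rw [Complex.sq_norm, Complex.normSq_apply]
  push_cast
  rw [hc]
  ring

lemma integral_exp_sq_gaussianReal {v s : ℝ} (hv : 0 ≤ v) (hs : 0 ≤ s) :
    ∫ x, Real.exp (-(s * x ^ 2)) ∂(gaussianReal 0 v.toNNReal) = √((1 + 2 * s * v)⁻¹) := by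
  -- Variance zero must be allowed: the innovations vanish when |α| = 1.
  rcases hv.eq_or_lt with rfl | hv
  · simp
  · rw [integral_gaussianReal_eq_integral_smul (by simpa using hv)]
    have h : ∀ x : ℝ, gaussianPDFReal 0 v.toNNReal x • Real.exp (-(s * x ^ 2)) =
        (√(2 * Real.pi * v))⁻¹ * Real.exp (-((2 * v)⁻¹ + s) * x ^ 2) := by
      intro x
      rw [gaussianPDFReal, Real.coe_toNNReal _ hv.le, smul_eq_mul, mul_assoc, ← Real.exp_add]
      congr 2
      field_simp
      ring
    simp_rw [h]
    rw [integral_const_mul, integral_gaussian, ← Real.sqrt_inv, ← Real.sqrt_mul (by positivity)]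
    congr 1
    have := Real.pi_pos
    have : (2 * v)⁻¹ + s ≠ 0 := by positivity
    have : 1 + 2 * s * v ≠ 0 := by positivity
    field_simp

lemma integral_exp_sq_complexGaussian {v s : ℝ} (hv : 0 ≤ v) (hs : 0 ≤ s) :
    ∫ y, Real.exp (-(s * ‖y‖ ^ 2)) ∂(complexGaussian v) = (1 + s * v)⁻¹ := by
  rw [integral_complexGaussian]
  have h : ∀ x : ℝ × ℝ, Real.exp (-(s * ‖(⟨x.1, x.2⟩ : ℂ)‖ ^ 2)) =
      Real.exp (-(s * x.1 ^ 2)) * Real.exp (-(s * x.2 ^ 2)) := by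
    intro x
    rw [← Real.exp_add, Complex.sq_norm, Complex.normSq_apply]
    congr 1
    ring
  simp_rw [h]
  rw [integral_prod_mul (fun x : ℝ => Real.exp (-(s * x ^ 2)))
    (fun x : ℝ => Real.exp (-(s * x ^ 2))), integral_exp_sq_gaussianReal (by positivity) hs,
    Real.mul_self_sqrt (by positivity)]
  congr 1
  ring

open ComplexConjugate in
/-- If the rows of `A` are orthogonal with respect to the weights `v`, then the entries of `A Z`,
for independent `Z s` of law `CN(0, v s)`, are independent complex Gaussian variables; this is the
Laplace transform of the sum of their squares. -/
lemma integral_exp_sum_sq_complexGaussian {S I : Type*} [Fintype S] [Fintype I] [DecidableEq I]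
    {v : S → ℝ} (hv : ∀ s, 0 ≤ v s) (A : I → S → ℂ) {D : I → ℝ} (hD : ∀ i, 0 ≤ D i)
    (hA : ∀ i j, ∑ s, (v s : ℂ) * (A i s * conj (A j s)) = if i = j then (D i : ℂ) else 0)
    {z : ℝ} (hz : 0 ≤ z) :
    ∫ Z, Real.exp (-(z * ∑ i, ‖∑ s, A i s * Z s‖ ^ 2)) ∂(Measure.pi fun s => complexGaussian (v s)) =
      ∏ i, (1 + z * D i)⁻¹ := by
  set ν := Measure.pi fun s => complexGaussian (v s) with hν
  -- The characteristic function of CN(0, 4z) at w is e^{-z|w|²}. Averaging over an auxiliary y of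
  -- law ρ therefore replaces the quadratic exponent by one linear in Z, and Fubini allows Z to be
  -- integrated first.
  set ρ := Measure.pi fun _ : I => complexGaussian (4 * z) with hρ
  have hswap : ∀ (Z : S → ℂ) (y : I → ℂ),
      ∏ i, Complex.exp (((conj (∑ s, A i s * Z s) * y i).re : ℝ) * Complex.I) =
      ∏ s, Complex.exp (((conj (∑ i, conj (A i s) * y i) * Z s).re : ℝ) * Complex.I) := by
    intro Z y
    rw [← Complex.exp_sum, ← Complex.exp_sum, ← Finset.sum_mul, ← Finset.sum_mul,
      ← Complex.ofReal_sum, ← Complex.ofReal_sum, ← Complex.re_sum, ← Complex.re_sum]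
    congr 3
    simp only [map_sum, map_mul, Complex.conj_conj, Finset.sum_mul]
    rw [Finset.sum_comm, ← Complex.conj_re]
    simp only [map_sum, map_mul, Complex.conj_conj]
    congr 1
    refine Finset.sum_congr rfl fun s _ => Finset.sum_congr rfl fun i _ => by ring
  -- Integrating Z out leaves a quadratic form in y; orthogonality of the rows makes it diagonal, so
  -- the y-integral factors.
  have hquad : ∀ y : I → ℂ, ∑ s, v s * ‖∑ i, conj (A i s) * y i‖ ^ 2 = ∑ i, D i * ‖y i‖ ^ 2 := by
    intro y
    apply Complex.ofReal_injective
    push_cast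
    have h1 : ∀ w : ℂ, ((‖w‖ : ℂ)) ^ 2 = conj w * w := fun w => by rw [Complex.conj_mul']
    simp_rw [h1]
    have h2 : ∀ s, (v s : ℂ) * (conj (∑ i, conj (A i s) * y i) * ∑ i, conj (A i s) * y i) =
        ∑ i, ∑ j, (conj (y i) * y j) * ((v s : ℂ) * (A i s * conj (A j s))) := by
      intro s
      rw [map_sum, Finset.sum_mul_sum, Finset.mul_sum]
      refine Finset.sum_congr rfl fun i _ => ?_
      rw [Finset.mul_sum]
      refine Finset.sum_congr rfl fun j _ => ?_
      rw [map_mul, Complex.conj_conj]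
      ring
    simp_rw [h2]
    rw [Finset.sum_comm]
    refine Finset.sum_congr rfl fun i _ => ?_
    rw [Finset.sum_comm]
    simp_rw [← Finset.mul_sum, hA]
    simp
    ring
  have hHS : ∀ Z : S → ℂ, (Real.exp (-(z * ∑ i, ‖∑ s, A i s * Z s‖ ^ 2)) : ℂ) =
      ∫ y, ∏ i, Complex.exp (((conj (∑ s, A i s * Z s) * y i).re : ℝ) * Complex.I) ∂ρ := by
    intro Z
    rw [hρ, integral_fintype_prod_eq_prod
      (fun i (y : ℂ) => Complex.exp (((conj (∑ s, A i s * Z s) * y).re : ℝ) * Complex.I))]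
    simp_rw [integral_cexp_complexGaussian (by positivity : 0 ≤ 4 * z)]
    rw [← Complex.exp_sum, ← Complex.ofReal_sum, ← Complex.ofReal_exp, Finset.mul_sum,
      ← Finset.sum_neg_distrib]
    congr 2
    exact Finset.sum_congr rfl fun i _ => by ring
  have hint : Integrable (Function.uncurry fun (Z : S → ℂ) (y : I → ℂ) =>
      ∏ i, Complex.exp (((conj (∑ s, A i s * Z s) * y i).re : ℝ) * Complex.I)) (ν.prod ρ) := by
    refine Integrable.mono' (integrable_const (1 : ℝ)) ?_ ?_
    · refine Continuous.aestronglyMeasurable ?_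
      simp only [Function.uncurry_def]
      fun_prop
    · refine Filter.Eventually.of_forall fun x => ?_
      simp only [Function.uncurry_def, norm_prod, Complex.norm_exp_ofReal_mul_I,
        Finset.prod_const_one, le_refl]
  apply Complex.ofReal_injective
  rw [← integral_complex_ofReal]
  calc ∫ Z, ((Real.exp (-(z * ∑ i, ‖∑ s, A i s * Z s‖ ^ 2)) : ℝ) : ℂ) ∂ν
      = ∫ y, ∫ Z, ∏ i, Complex.exp (((conj (∑ s, A i s * Z s) * y i).re : ℝ) * Complex.I) ∂ν ∂ρ := by
        rw [← integral_integral_swap hint]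
        exact integral_congr_ae (Filter.Eventually.of_forall hHS)
    _ = ∫ y, ((∏ i, Real.exp (-(D i / 4 * ‖y i‖ ^ 2)) : ℝ) : ℂ) ∂ρ := by
        refine integral_congr_ae (Filter.Eventually.of_forall fun y => ?_)
        simp only [hswap]
        rw [hν, integral_fintype_prod_eq_prod (fun s (w : ℂ) =>
          Complex.exp (((conj (∑ i, conj (A i s) * y i) * w).re : ℝ) * Complex.I))]
        simp_rw [fun s => integral_cexp_complexGaussian (hv s)]
        rw [← Complex.exp_sum, ← Complex.ofReal_sum, ← Complex.ofReal_exp, ← Real.exp_sum]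
        congr 2
        have := hquad y
        rw [Finset.sum_neg_distrib, ← Finset.sum_div, this, Finset.sum_neg_distrib, Finset.sum_div]
        congr 1
        exact Finset.sum_congr rfl fun i _ => by ring
    _ = _ := by
        rw [integral_complex_ofReal, hρ, integral_fintype_prod_eq_prod
          (fun i (w : ℂ) => Real.exp (-(D i / 4 * ‖w‖ ^ 2)))]
        congr 1
        refine Finset.prod_congr rfl fun i _ => ?_
        rw [integral_exp_sq_complexGaussian (by positivity) (by have := hD i; positivity)]
        congr 1
        ring

/-! ## The rows of the pseudo-inverse -/

section PseudoInverse

variable {N K : ℕ}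

/-- The column `j` of a matrix as a vector of the Euclidean space. -/
noncomputable def colVec (G : Matrix (Fin N) (Fin K) ℂ) (j : Fin K) : EuclideanSpace ℂ (Fin N) :=
  WithLp.toLp 2 fun a => G a j

/-- The orthogonal complement of the span of the columns with index in `T`. -/
noncomputable def colsOrthogonal (G : Matrix (Fin N) (Fin K) ℂ) (T : Finset (Fin K)) :
    Submodule ℂ (EuclideanSpace ℂ (Fin N)) :=
  (Submodule.span ℂ (colVec G '' (T : Set (Fin K))))ᗮ

lemma mem_colsOrthogonal {G : Matrix (Fin N) (Fin K) ℂ} {T : Finset (Fin K)}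
    {x : EuclideanSpace ℂ (Fin N)} :
    x ∈ colsOrthogonal G T ↔ ∀ j ∈ T, inner ℂ x (colVec G j) = 0 := by
  rw [colsOrthogonal, Submodule.mem_orthogonal']
  constructor
  · exact fun h j hj => h _ (Submodule.subset_span ⟨j, hj, rfl⟩)
  · intro h y hy
    induction hy using Submodule.span_induction with
    | mem y hy => obtain ⟨j, hj, rfl⟩ := hy; exact h j hj
    | zero => simp
    | add y z _ _ h1 h2 => rw [inner_add_right, h1, h2, add_zero]
    | smul c y _ h1 => rw [inner_smul_right, h1, mul_zero]

lemma finrank_colsOrthogonal {G : Matrix (Fin N) (Fin K) ℂ} {T : Finset (Fin K)}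
    (h : LinearIndepOn ℂ (colVec G) (T : Set (Fin K))) :
    Module.finrank ℂ (colsOrthogonal G T) = N - T.card := by
  have h1 := Submodule.finrank_add_finrank_orthogonal
    (Submodule.span ℂ (colVec G '' (T : Set (Fin K))))
  have h2 : Module.finrank ℂ (Submodule.span ℂ (colVec G '' (T : Set (Fin K)))) = T.card := by
    rw [Set.image_eq_range]
    rw [finrank_span_eq_card (b := fun j : (T : Set (Fin K)) => colVec G j) h]
    simp
  rw [h2, finrank_euclideanSpace_fin] at h1
  rw [colsOrthogonal]
  omega

lemma isUnit_gram {G : Matrix (Fin N) (Fin K) ℂ} (h : LinearIndependent ℂ (colVec G)) :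
    IsUnit (G.conjTranspose * G) := by
  open scoped ComplexOrder in
  refine (Matrix.PosDef.conjTranspose_mul_self G ?_).isUnit
  rw [Matrix.mulVec_injective_iff]
  exact h.map' (WithLp.linearEquiv 2 ℂ (Fin N → ℂ)).toLinearMap
    (LinearMap.ker_eq_bot.2 (WithLp.linearEquiv 2 ℂ (Fin N → ℂ)).injective)

lemma pinv_mul_self {G : Matrix (Fin N) (Fin K) ℂ} (h : LinearIndependent ℂ (colVec G)) :
    pinv G * G = 1 := by
  rw [pinv, Matrix.mul_assoc, Matrix.nonsing_inv_mul _ ((Matrix.isUnit_iff_isUnit_det _).1 (isUnit_gram h))]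

open ComplexConjugate in
/-- The squared norm of the row `k` of the pseudo-inverse is the inverse of the squared norm of the
component of the column `k` that is orthogonal to the other columns. -/
lemma rowNormSq_pinv_mul {G : Matrix (Fin N) (Fin K) ℂ} (h : LinearIndependent ℂ (colVec G))
    (k : Fin K) {ι : Type*} [Fintype ι]
    (b : OrthonormalBasis ι ℂ (colsOrthogonal G (Finset.univ.erase k))) :
    rowNormSq (pinv G) k *
      ∑ i, ‖inner ℂ (b i : EuclideanSpace ℂ (Fin N)) (colVec G k)‖ ^ 2 = 1 := by
  set B := (G.conjTranspose * G)⁻¹ with hB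
  -- The inner product is conjugate linear on the left, so conjugating the row makes the pairings
  -- with the columns the entries of `pinv G * G`.
  set x : EuclideanSpace ℂ (Fin N) := WithLp.toLp 2 fun a => conj (pinv G k a) with hx
  have hxg : ∀ j, inner ℂ x (colVec G j) = if k = j then 1 else 0 := by
    intro j
    have := congrFun (congrFun (pinv_mul_self h) k) j
    rw [Matrix.mul_apply, Matrix.one_apply] at this
    rw [← this, PiLp.inner_apply]
    refine Finset.sum_congr rfl fun a _ => ?_
    simp [hx, colVec, mul_comm]
  have hxsum : x = ∑ j, conj (B k j) • colVec G j := by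
    ext a
    simp only [hx, pinv, Matrix.mul_apply, Matrix.conjTranspose_apply, map_sum, map_mul,
      WithLp.ofLp_sum, WithLp.ofLp_smul, colVec, Finset.sum_apply, Pi.smul_apply, smul_eq_mul]
    simp [hB]
  have hxW : x ∈ colsOrthogonal G (Finset.univ.erase k) :=
    mem_colsOrthogonal.2 fun j hj => by
      rw [hxg, if_neg (Finset.ne_of_mem_erase hj).symm]
  -- x is a combination of the columns, and y is orthogonal to all of them but column k. So x is
  -- conj (B k k) times the projection of column k.
  have hproj : ∀ y ∈ colsOrthogonal G (Finset.univ.erase k),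
      inner ℂ y x = conj (B k k) * inner ℂ y (colVec G k) := by
    intro y hy
    rw [hxsum, inner_sum, Finset.sum_eq_single k]
    · rw [inner_smul_right]
    · intro j _ hj
      rw [inner_smul_right, mem_colsOrthogonal.1 hy j (Finset.mem_erase.2 ⟨hj, Finset.mem_univ _⟩),
        mul_zero]
    · simp
  have hnorm : rowNormSq (pinv G) k = ‖x‖ ^ 2 := by
    rw [EuclideanSpace.norm_sq_eq, rowNormSq]
    simp [hx]
  -- Taking y = x, whose pairing with column k is 1, identifies the scalar as ‖x‖².
  have hself : ((‖x‖ ^ 2 : ℝ) : ℂ) = conj (B k k) := by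
    have h1 := hproj x hxW
    rw [hxg, if_pos rfl, mul_one, inner_self_eq_norm_sq_to_K] at h1
    rw [← h1]
    push_cast
    rfl
  have hx0 : x ≠ 0 := by
    intro h0
    have := hxg k
    rw [h0, inner_zero_left, if_pos rfl] at this
    exact zero_ne_one this
  have hsum : ∑ i, ‖inner ℂ (b i : EuclideanSpace ℂ (Fin N)) x‖ ^ 2 = ‖x‖ ^ 2 := by
    have := b.sum_sq_norm_inner_right ⟨x, hxW⟩
    simpa using this
  have hr : ‖conj (B k k)‖ = ‖x‖ ^ 2 := by
    rw [← hself, Complex.norm_real, Real.norm_of_nonneg (by positivity)]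
  simp_rw [fun i => hproj _ (b i).2, norm_mul, mul_pow, hr] at hsum
  rw [← Finset.mul_sum] at hsum
  have hpos : 0 < ‖x‖ ^ 2 := by positivity
  rw [hnorm]
  have h2 : ‖x‖ ^ 2 * (‖x‖ ^ 2 * ∑ i, ‖inner ℂ (b i : EuclideanSpace ℂ (Fin N)) (colVec G k)‖ ^ 2)
      = ‖x‖ ^ 2 * 1 := by
    rw [mul_one]
    linarith [hsum]
  exact mul_left_cancel₀ hpos.ne' h2

end PseudoInverse

/-! ## Gaussian matrices -/

section GaussianMatrix

variable {N K : ℕ}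

/-- The law of the family of the entries of a matrix with independent entries of law `CN(0, v j)`
in column `j`. -/
noncomputable def gaussianEntries (N : ℕ) {K : ℕ} (v : Fin K → ℝ) :
    Measure (Fin N × Fin K → ℂ) :=
  Measure.pi fun s => complexGaussian (v s.2)

instance (v : Fin K → ℝ) : IsProbabilityMeasure (gaussianEntries N v) := by
  unfold gaussianEntries; infer_instance

/-- The law of a vector with independent entries of law `CN(0, c)`. -/
noncomputable def gaussianVector (N : ℕ) (c : ℝ) : Measure (Fin N → ℂ) :=
  Measure.pi fun _ => complexGaussian c

instance (c : ℝ) : IsProbabilityMeasure (gaussianVector N c) := by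
  unfold gaussianVector; infer_instance

/-- Replace the column `k` of a family of matrix entries. -/
def replaceCol (k : Fin K) (x : (Fin N × Fin K → ℂ) × (Fin N → ℂ)) : Fin N × Fin K → ℂ :=
  fun s => if s.2 = k then x.2 s.1 else x.1 s

lemma measurable_replaceCol (k : Fin K) : Measurable (replaceCol (N := N) k) := by
  refine measurable_pi_lambda _ fun s => ?_
  unfold replaceCol
  split_ifs <;> fun_prop

/-- Resampling one column preserves the law. -/
lemma measurePreserving_replaceCol (v : Fin K → ℝ) (k : Fin K) :
    MeasurePreserving (replaceCol k) ((gaussianEntries N v).prod (gaussianVector N (v k)))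
      (gaussianEntries N v) := by
  refine ⟨measurable_replaceCol k, ?_⟩
  conv_rhs => rw [gaussianEntries]
  symm
  refine Measure.pi_eq fun s hs => ?_
  rw [Measure.map_apply (measurable_replaceCol k) (MeasurableSet.univ_pi hs)]
  -- The preimage of a box is again a product: the old column k is unconstrained and the new column
  -- takes over its constraints.
  have hpre : replaceCol k ⁻¹' (Set.univ.pi s) =
      (Set.univ.pi fun i : Fin N × Fin K => if i.2 = k then Set.univ else s i) ×ˢ
        (Set.univ.pi fun a : Fin N => s (a, k)) := by
    ext x
    simp only [Set.mem_preimage, Set.mem_pi, Set.mem_univ, true_imp_iff, Set.mem_prod, replaceCol]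
    constructor
    · refine fun h => ⟨fun i => ?_, fun a => by simpa using h (a, k)⟩
      have := h i
      split_ifs at this ⊢
      · trivial
      · exact this
    · rintro ⟨h1, h2⟩ ⟨a, j⟩
      have := h1 (a, j)
      dsimp only at this ⊢
      split_ifs at this ⊢ with hj
      · subst hj; exact h2 a
      · exact this
  rw [hpre, Measure.prod_prod, gaussianEntries, gaussianVector, Measure.pi_pi, Measure.pi_pi,
    Fintype.prod_prod_type, Fintype.prod_prod_type, ← Finset.prod_mul_distrib]
  refine Finset.prod_congr rfl fun a _ => ?_
  rw [← Finset.mul_prod_erase Finset.univ _ (Finset.mem_univ k),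
    ← Finset.mul_prod_erase Finset.univ _ (Finset.mem_univ k), if_pos rfl, measure_univ, one_mul,
    mul_comm]
  congr 1
  refine Finset.prod_congr rfl fun j hj => ?_
  simp only [if_neg (Finset.ne_of_mem_erase hj)]

open ComplexConjugate in
/-- The Laplace transform of the squared norm of an orthogonal projection of a Gaussian vector. -/
lemma integral_exp_orthonormal_gaussianVector {ι : Type*} [Fintype ι] {c z : ℝ} (hc : 0 ≤ c)
    (hz : 0 ≤ z) {b : ι → EuclideanSpace ℂ (Fin N)} (hb : Orthonormal ℂ b) :
    ∫ g, Real.exp (-(z * ∑ i, ‖inner ℂ (b i) (WithLp.toLp 2 g : EuclideanSpace ℂ (Fin N))‖ ^ 2))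
      ∂(gaussianVector N c) = ((1 + z * c) ^ Fintype.card ι)⁻¹ := by
  classical
  have h := integral_exp_sum_sq_complexGaussian (S := Fin N) (v := fun _ => c) (fun _ => hc)
    (fun (i : ι) a => conj (b i a)) (D := fun _ => c) (fun _ => hc) (fun i j => by
      have := orthonormal_iff_ite.1 hb i j
      rw [PiLp.inner_apply] at this
      rw [← Finset.mul_sum]
      have h2 : ∑ a, conj (b i a) * conj (conj (b j a)) = if i = j then (1 : ℂ) else 0 := by
        rw [← this]
        exact Finset.sum_congr rfl fun a _ => by simp [mul_comm]
      rw [h2]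
      split_ifs <;> simp) hz
  rw [Finset.prod_const, Finset.card_univ, inv_pow] at h
  rw [← h]
  have h3 : ∀ (g : Fin N → ℂ) (i : ι), inner ℂ (b i) (WithLp.toLp 2 g : EuclideanSpace ℂ (Fin N)) =
      ∑ a, conj (b i a) * g a := fun g i => by
    rw [PiLp.inner_apply]
    exact Finset.sum_congr rfl fun a _ => by simp [mul_comm]
  simp_rw [h3]
  rfl

open Filter Topology in
-- For f ≥ 0 one has P(f = 0) ≤ E e^{-zf}; here the right side is (1 + zc)^{-card ι}, which tends to
-- 0 as z grows.
lemma ae_orthonormal_gaussianVector_ne_zero {ι : Type*} [Fintype ι] [Nonempty ι] {c : ℝ}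
    (hc : 0 < c) {b : ι → EuclideanSpace ℂ (Fin N)} (hb : Orthonormal ℂ b) :
    ∀ᵐ g ∂(gaussianVector N c),
      ∑ i, ‖inner ℂ (b i) (WithLp.toLp 2 g : EuclideanSpace ℂ (Fin N))‖ ^ 2 ≠ 0 := by
  set f : (Fin N → ℂ) → ℝ := fun g =>
    ∑ i, ‖inner ℂ (b i) (WithLp.toLp 2 g : EuclideanSpace ℂ (Fin N))‖ ^ 2 with hf
  have hcont : Continuous f := by
    have : Continuous fun g : Fin N → ℂ => (WithLp.toLp 2 g : EuclideanSpace ℂ (Fin N)) :=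
      PiLp.continuous_toLp 2 _
    fun_prop
  have hf0 : ∀ g, 0 ≤ f g := fun g => by positivity
  have hms : MeasurableSet {g | f g = 0} := (isClosed_singleton.preimage hcont).measurableSet
  have hle : ∀ z : ℝ, 0 ≤ z →
      (gaussianVector N c).real {g | f g = 0} ≤ ((1 + z * c) ^ Fintype.card ι)⁻¹ := by
    intro z hz
    rw [← integral_exp_orthonormal_gaussianVector hc.le hz hb, ← integral_indicator_one hms]
    refine integral_mono ((integrable_const _).indicator hms) ?_ fun g => ?_
    · refine Integrable.mono' (integrable_const (1 : ℝ)) ?_ (Eventually.of_forall fun g => ?_)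
      · exact (Real.continuous_exp.comp (continuous_const.mul hcont).neg).aestronglyMeasurable
      · rw [Real.norm_eq_abs, abs_of_pos (Real.exp_pos _), Real.exp_le_one_iff]
        have := mul_nonneg hz (hf0 g)
        linarith
    · by_cases hg : f g = 0
      · have : Real.exp (-(z * f g)) = 1 := by rw [hg]; simp
        simp only [Set.indicator, Set.mem_ofPred_eq, hg, if_true, Pi.one_apply]
        exact this.ge
      · simp only [Set.indicator, Set.mem_ofPred_eq, hg, if_false]
        positivity
  have hlim : Tendsto (fun z : ℝ => ((1 + z * c) ^ Fintype.card ι)⁻¹) atTop (𝓝 0) :=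
    ((tendsto_pow_atTop Fintype.card_ne_zero).comp
      (tendsto_atTop_add_const_left atTop 1 (tendsto_id.atTop_mul_const hc))).inv_tendsto_atTop
  have h0 : (gaussianVector N c).real {g | f g = 0} ≤ 0 :=
    ge_of_tendsto hlim ((eventually_ge_atTop 0).mono hle)
  have h1 : (gaussianVector N c) {g | f g = 0} = 0 := by
    have := le_antisymm h0 measureReal_nonneg
    rwa [measureReal_eq_zero_iff] at this
  rw [ae_iff]
  simpa using h1

lemma colVec_replaceCol_of_ne {k j : Fin K} (h : j ≠ k)
    (x : (Fin N × Fin K → ℂ) × (Fin N → ℂ)) :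
    colVec (Matrix.of fun a j => replaceCol k x (a, j)) j =
      colVec (Matrix.of fun a j => x.1 (a, j)) j := by
  ext a
  simp [colVec, replaceCol, h]

lemma colVec_replaceCol_self (k : Fin K) (x : (Fin N × Fin K → ℂ) × (Fin N → ℂ)) :
    colVec (Matrix.of fun a j => replaceCol k x (a, j)) k = WithLp.toLp 2 x.2 := by
  ext a
  simp [colVec, replaceCol]

/-- Linear independence is an open condition on the columns. -/
lemma measurableSet_linearIndepOn_colVec (T : Finset (Fin K)) :
    MeasurableSet {x : Fin N × Fin K → ℂ |
      LinearIndepOn ℂ (colVec (Matrix.of fun a j => x (a, j))) (T : Set (Fin K))} := by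
  have hcont : Continuous fun (x : Fin N × Fin K → ℂ) (j : (T : Set (Fin K))) =>
      colVec (Matrix.of fun a j => x (a, j)) j := by
    refine continuous_pi fun j => ?_
    refine (PiLp.continuous_toLp 2 _).comp ?_
    simp only [Matrix.of_apply]
    fun_prop
  exact (isOpen_setOfPred_linearIndependent.preimage hcont).measurableSet

/-- Add one column at a time. With the columns of T fixed, their orthogonal complement has dimension
N - |T| > 0, and a freshly sampled Gaussian column almost surely has a nonzero component in it,
hence lies outside their span. -/
lemma ae_linearIndepOn_colVec {v : Fin K → ℝ} (hv : ∀ j, 0 < v j) (T : Finset (Fin K))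
    (hT : T.card ≤ N) :
    ∀ᵐ x ∂(gaussianEntries N v),
      LinearIndepOn ℂ (colVec (Matrix.of fun a j => x (a, j))) (T : Set (Fin K)) := by
  induction T using Finset.induction_on with
  | empty => simp
  | insert k T hk ih =>
    rw [Finset.card_insert_of_notMem hk] at hT
    have hm := measurableSet_linearIndepOn_colVec (N := N) (insert k T)
    rw [← (measurePreserving_replaceCol v k).map_eq,
      ae_map_iff (measurable_replaceCol k).aemeasurable hm]
    refine (Measure.ae_prod_iff_ae_ae (p := fun x => LinearIndepOn ℂ
      (colVec (Matrix.of fun a j => replaceCol k x (a, j))) ((insert k T : Finset (Fin K)) :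
        Set (Fin K))) (measurable_replaceCol k hm)).2 ?_
    filter_upwards [ih (by omega)] with y hy
    set G := (Matrix.of fun a j => y (a, j) : Matrix (Fin N) (Fin K) ℂ) with hG
    have hfin := finrank_colsOrthogonal hy
    set b := stdOrthonormalBasis ℂ (colsOrthogonal G T) with hb
    have hon : Orthonormal ℂ fun i => (b i : EuclideanSpace ℂ (Fin N)) :=
      b.orthonormal.comp_linearIsometry (colsOrthogonal G T).subtypeₗᵢ
    have : Nonempty (Fin (Module.finrank ℂ (colsOrthogonal G T))) := ⟨⟨0, by omega⟩⟩
    filter_upwards [ae_orthonormal_gaussianVector_ne_zero (hv k) hon] with g hg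
    have heq : Set.EqOn (colVec (Matrix.of fun a j => replaceCol k (y, g) (a, j))) (colVec G)
        (T : Set (Fin K)) := fun j hj =>
      colVec_replaceCol_of_ne (fun h : j = k => hk (by rw [← h]; exact hj)) _
    rw [Finset.coe_insert]
    refine LinearIndepOn.insert (hy.congr heq.symm) ?_
    rw [heq.image_eq, colVec_replaceCol_self]
    intro hspan
    refine hg (Finset.sum_eq_zero fun i _ => ?_)
    have := (Submodule.mem_orthogonal' _ _).1 (b i).2 _ hspan
    rw [this]
    simp

end GaussianMatrix

/-! ### The law of the rows of the pseudo-inverse. -/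

section GaussianMatrix

variable {N K : ℕ}

/-- The inverse is the adjugate divided by the determinant. With the convention 0⁻¹ = 0 this also
covers singular Gram matrices, where the inverse is not continuous. -/
lemma measurable_pinv_apply (k : Fin K) (a : Fin N) :
    Measurable fun x : Fin N × Fin K → ℂ => pinv (Matrix.of fun a j => x (a, j)) k a := by
  have h : ∀ G : Matrix (Fin N) (Fin K) ℂ, pinv G k a =
      ((G.conjTranspose * G).det)⁻¹ * ((G.conjTranspose * G).adjugate * G.conjTranspose) k a := by
    intro G
    rw [pinv, Matrix.inv_def, Matrix.smul_mul, Matrix.smul_apply, Ring.inverse_eq_inv', smul_eq_mul]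
  simp_rw [h]
  have hc : Continuous fun x : Fin N × Fin K → ℂ =>
      (Matrix.of fun a j => x (a, j) : Matrix (Fin N) (Fin K) ℂ) :=
    continuous_matrix fun a j => continuous_apply (a, j)
  have hg : Continuous fun x : Fin N × Fin K → ℂ =>
      (Matrix.of fun a j => x (a, j) : Matrix (Fin N) (Fin K) ℂ).conjTranspose *
        (Matrix.of fun a j => x (a, j) : Matrix (Fin N) (Fin K) ℂ) :=
    hc.matrix_conjTranspose.matrix_mul hc
  exact hg.matrix_det.measurable.inv.mul
    (((hg.matrix_adjugate.matrix_mul hc.matrix_conjTranspose).matrix_elem k a).measurable)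

lemma measurable_rowNormSq_pinv (k : Fin K) :
    Measurable fun x : Fin N × Fin K → ℂ =>
      rowNormSq (pinv (Matrix.of fun (a : Fin N) j => x (a, j))) k := by
  unfold rowNormSq
  exact Finset.measurable_sum _ fun a _ => (measurable_pinv_apply k a).norm.pow_const 2

/-- For a matrix of full column rank, the squared norm of a row of the pseudo-inverse is
positive. -/
lemma rowNormSq_pinv_pos {G : Matrix (Fin N) (Fin K) ℂ} (h : LinearIndependent ℂ (colVec G))
    (k : Fin K) : 0 < rowNormSq (pinv G) k := by
  have h1 := rowNormSq_pinv_mul h k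
    (stdOrthonormalBasis ℂ (colsOrthogonal G (Finset.univ.erase k)))
  have h2 : 0 ≤ rowNormSq (pinv G) k := by unfold rowNormSq; positivity
  refine lt_of_le_of_ne h2 fun h0 => ?_
  rw [← h0, zero_mul] at h1
  exact zero_ne_one h1

lemma ae_linearIndependent_colVec (hKN : K ≤ N) {v : Fin K → ℝ} (hv : ∀ j, 0 < v j) :
    ∀ᵐ x ∂(gaussianEntries N v),
      LinearIndependent ℂ (colVec (Matrix.of fun a j => x (a, j))) := by
  filter_upwards [ae_linearIndepOn_colVec hv Finset.univ (by simpa using hKN)] with x hx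
  rw [Finset.coe_univ] at hx
  exact linearIndepOn_univ_iff.1 hx

/-- The Laplace transform of the reciprocal of the squared norm of a row of the pseudo-inverse of
a Gaussian matrix: the reciprocal has an Erlang distribution with shape `N - K + 1`. -/
lemma integral_exp_inv_rowNormSq_pinv (hKN : K ≤ N) {v : Fin K → ℝ} (hv : ∀ j, 0 < v j)
    (k : Fin K) {z : ℝ} (hz : 0 ≤ z) :
    ∫ x, Real.exp (-(z * (rowNormSq (pinv (Matrix.of fun a j => x (a, j))) k)⁻¹))
      ∂(gaussianEntries N v) = ((1 + z * v k) ^ (N - K + 1))⁻¹ := by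
  have hK : 0 < K := k.pos
  have hmp := measurePreserving_replaceCol (N := N) v k
  set f : (Fin N × Fin K → ℂ) → ℝ := fun x =>
    Real.exp (-(z * (rowNormSq (pinv (Matrix.of fun a j => x (a, j))) k)⁻¹)) with hf
  have hfm : Measurable f :=
    ((measurable_rowNormSq_pinv k).inv.const_mul z).neg.exp
  have hfb : ∀ x, ‖f x‖ ≤ 1 := fun x => by
    rw [hf, Real.norm_eq_abs, abs_of_pos (Real.exp_pos _), Real.exp_le_one_iff]
    have : 0 ≤ (rowNormSq (pinv (Matrix.of fun a j => x (a, j))) k)⁻¹ := by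
      unfold rowNormSq; positivity
    have := mul_nonneg hz this
    linarith
  have hint : Integrable (fun x => f (replaceCol k x))
      ((gaussianEntries N v).prod (gaussianVector N (v k))) :=
    Integrable.mono' (integrable_const (1 : ℝ)) (hfm.comp hmp.measurable).aestronglyMeasurable
      (Filter.Eventually.of_forall fun x => hfb _)
  have hli := ae_linearIndependent_colVec hKN hv
  rw [← hmp.map_eq] at hli
  have hli2 := Measure.ae_ae_of_ae_prod (ae_of_ae_map hmp.measurable.aemeasurable hli)
  rw [← hmp.map_eq, integral_map hmp.measurable.aemeasurable hfm.aestronglyMeasurable,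
    integral_prod _ hint]
  have hcard : (Finset.univ.erase k).card = K - 1 := by
    rw [Finset.card_erase_of_mem (Finset.mem_univ _), Finset.card_univ, Fintype.card_fin]
  have hinner : ∀ᵐ y ∂(gaussianEntries N v),
      ∫ g, f (replaceCol k (y, g)) ∂(gaussianVector N (v k)) =
        ((1 + z * v k) ^ (N - K + 1))⁻¹ := by
    filter_upwards [hli2, ae_linearIndepOn_colVec hv (Finset.univ.erase k) (by omega)] with y hy hyT
    set G := (Matrix.of fun a j => y (a, j) : Matrix (Fin N) (Fin K) ℂ) with hG
    have hfin := finrank_colsOrthogonal hyT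
    set b := stdOrthonormalBasis ℂ (colsOrthogonal G (Finset.univ.erase k)) with hb
    have hon : Orthonormal ℂ fun i => (b i : EuclideanSpace ℂ (Fin N)) :=
      b.orthonormal.comp_linearIsometry (colsOrthogonal G (Finset.univ.erase k)).subtypeₗᵢ
    have hL := integral_exp_orthonormal_gaussianVector (hv k).le hz hon
    rw [Fintype.card_fin] at hL
    -- The complement of the K - 1 other columns has dimension N - (K - 1); the existence of `k`
    -- gives K ≥ 1.
    rw [show N - K + 1 = Module.finrank ℂ (colsOrthogonal G (Finset.univ.erase k)) by omega, ← hL]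
    refine integral_congr_ae ?_
    filter_upwards [hy] with g hg
    -- The subspace ignores column k, so one orthonormal basis, chosen from y alone, serves for all
    -- values of the resampled column.
    have hW : colsOrthogonal (Matrix.of fun a j => replaceCol k (y, g) (a, j))
        (Finset.univ.erase k) = colsOrthogonal G (Finset.univ.erase k) := by
      ext u
      simp only [mem_colsOrthogonal]
      refine forall₂_congr fun j hj => ?_
      rw [colVec_replaceCol_of_ne (Finset.ne_of_mem_erase hj)]
    -- The basis type depends on the subspace; generalizing to a variable W lets the equality `hW`
    -- be substituted.
    have hmul : ∀ (W : Submodule ℂ (EuclideanSpace ℂ (Fin N)))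
        (b : OrthonormalBasis (Fin (Module.finrank ℂ W)) ℂ W),
        colsOrthogonal (Matrix.of fun a j => replaceCol k (y, g) (a, j)) (Finset.univ.erase k) = W →
        rowNormSq (pinv (Matrix.of fun a j => replaceCol k (y, g) (a, j))) k *
          ∑ i, ‖inner ℂ (b i : EuclideanSpace ℂ (Fin N))
            (colVec (Matrix.of fun a j => replaceCol k (y, g) (a, j)) k)‖ ^ 2 = 1 := by
      rintro W b rfl
      exact rowNormSq_pinv_mul hg k b
    have h1 := hmul _ b hW
    rw [colVec_replaceCol_self] at h1
    simp only [hf]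
    rw [← eq_inv_of_mul_eq_one_right h1]
  rw [integral_congr_ae hinner]
  simp

end GaussianMatrix

/-! ## Filtered noise -/

open ComplexConjugate in
-- Each variable enters exactly one of the sums, so the rows have disjoint supports and are
-- orthogonal for any weights.
lemma integral_exp_sum_sq_fiberwise {S I : Type*} [Fintype S] [Fintype I] [DecidableEq I]
    {v : S → ℝ} (hv : ∀ s, 0 ≤ v s) (idx : S → I) (w : S → ℂ) {z : ℝ} (hz : 0 ≤ z) :
    ∫ Z, Real.exp (-(z * ∑ i, ‖∑ s, if idx s = i then w s * Z s else 0‖ ^ 2))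
        ∂(Measure.pi fun s => complexGaussian (v s)) =
      ∏ i, (1 + z * ∑ s, if idx s = i then v s * ‖w s‖ ^ 2 else 0)⁻¹ := by
  have h := integral_exp_sum_sq_complexGaussian hv (fun i s => if idx s = i then w s else 0)
    (D := fun i => ∑ s, if idx s = i then v s * ‖w s‖ ^ 2 else 0)
    (fun i => Finset.sum_nonneg fun s _ => by
      have := hv s
      split_ifs <;> positivity) (fun i j => by
      split_ifs with hij
      · subst hij
        push_cast
        refine Finset.sum_congr rfl fun s _ => ?_
        split_ifs
        · rw [Complex.mul_conj']; push_cast; ring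
        · simp
      · refine Finset.sum_eq_zero fun s _ => ?_
        by_cases h1 : idx s = i
        · rw [if_neg (fun h2 : idx s = j => hij (h1.symm.trans h2))]; simp
        · rw [if_neg h1]; simp) hz
  rw [← h]
  simp only [ite_mul, zero_mul]

section Noise

variable {N K L : ℕ}

/-- The Laplace transform of the power of the combined error after a linear combination of its
rows. -/
lemma integral_exp_rowNormSq_noise {e f : Fin L → Fin K → ℝ} (he : ∀ i j, 0 ≤ e i j)
    (hf : ∀ i j, 0 ≤ f i j) (α : ℝ) (W : Matrix (Fin K) (Fin N) ℂ) (k : Fin K) {z : ℝ}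
    (hz : 0 ≤ z) :
    ∫ Z, Real.exp (-(z * ∑ i, rowNormSq (W * combinedError α
        (Matrix.of fun a j => Z (Sum.inl (i, a, j))) (Matrix.of fun a j => Z (Sum.inr (i, a, j)))) k))
      ∂(Measure.pi fun s : (Fin L × Fin N × Fin K) ⊕ (Fin L × Fin N × Fin K) => complexGaussian
        (Sum.elim (fun t : Fin L × Fin N × Fin K => e t.1 t.2.2) (fun t : Fin L × Fin N × Fin K => f t.1 t.2.2) s)) =
      ∏ s : Fin L × Fin K, (1 + z * (rowNormSq W k * (α ^ 2 * e s.1 s.2 + f s.1 s.2)))⁻¹ := by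
  -- The error entry (i, a, j) contributes only to the output (i, j): filtering by row k of W sums
  -- over the antennas a.
  have h := integral_exp_sum_sq_fiberwise
    (v := Sum.elim (fun t : Fin L × Fin N × Fin K => e t.1 t.2.2) (fun t : Fin L × Fin N × Fin K => f t.1 t.2.2))
    (fun s => by rcases s with t | t <;> simp [he, hf])
    (Sum.elim (fun t : Fin L × Fin N × Fin K => (t.1, t.2.2)) (fun t : Fin L × Fin N × Fin K => (t.1, t.2.2)))
    (Sum.elim (fun t : Fin L × Fin N × Fin K => (α : ℂ) * W k t.2.1) (fun t : Fin L × Fin N × Fin K => W k t.2.1)) hz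
  have hprod : ∀ s : Fin L × Fin K, (∑ t : (Fin L × Fin N × Fin K) ⊕ (Fin L × Fin N × Fin K),
      if Sum.elim (fun t : Fin L × Fin N × Fin K => (t.1, t.2.2)) (fun t : Fin L × Fin N × Fin K => (t.1, t.2.2)) t = s then
        Sum.elim (fun t : Fin L × Fin N × Fin K => e t.1 t.2.2) (fun t : Fin L × Fin N × Fin K => f t.1 t.2.2) t *
        ‖Sum.elim (fun t : Fin L × Fin N × Fin K => (α : ℂ) * W k t.2.1)
          (fun t : Fin L × Fin N × Fin K => W k t.2.1) t‖ ^ 2 else 0) =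
      rowNormSq W k * (α ^ 2 * e s.1 s.2 + f s.1 s.2) := by
    rintro ⟨i, j⟩
    rw [Fintype.sum_sum_type]
    simp only [Sum.elim_inl, Sum.elim_inr, Fintype.sum_prod_type, Prod.mk.injEq, ite_and]
    simp only [Finset.sum_ite_eq', Finset.sum_ite_irrel, Finset.sum_const_zero, Finset.mem_univ,
      if_true, norm_mul, mul_pow, Complex.norm_real, Real.norm_eq_abs, sq_abs, rowNormSq]
    rw [mul_add, Finset.sum_mul, Finset.sum_mul]
    congr 1 <;> exact Finset.sum_congr rfl fun a _ => by ring
  simp_rw [hprod] at h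
  rw [← h]
  refine integral_congr_ae (Filter.Eventually.of_forall fun Z => ?_)
  simp only
  congr 3
  rw [Fintype.sum_prod_type]
  refine Finset.sum_congr rfl fun i _ => ?_
  rw [rowNormSq]
  refine Finset.sum_congr rfl fun j _ => ?_
  congr 2
  rw [Fintype.sum_sum_type]
  simp only [Sum.elim_inl, Sum.elim_inr, Fintype.sum_prod_type, Prod.mk.injEq, ite_and]
  simp only [Finset.sum_ite_eq', Finset.sum_ite_irrel, Finset.sum_const_zero, Finset.mem_univ,
    if_true]
  rw [Matrix.mul_apply, ← Finset.sum_add_distrib]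
  refine Finset.sum_congr rfl fun a _ => ?_
  simp [combinedError]
  ring

end Noise

/-! ## The rate -/

section Rate

variable {N K L : ℕ}

lemma betaHat_pos {β : Fin L → Fin L → Fin K → ℝ} (hβ : ∀ l i j, 0 < β l i j) {τ : ℕ} {p : ℝ}
    (hp : 0 < p) (l i : Fin L) (j : Fin K) : 0 < betaHat β τ p l i j := by
  unfold betaHat
  have h1 : 0 < ∑ i', β l i' j := Finset.sum_pos (fun i' _ => hβ l i' j) ⟨l, Finset.mem_univ _⟩
  have h2 := hβ l i j
  positivity

/-- The pilot noise 1/(τp) makes the inequality strict, which keeps the diagonal of 𝒜 positive even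
when |α| = 1. -/
lemma betaHat_lt {β : Fin L → Fin L → Fin K → ℝ} (hβ : ∀ l i j, 0 < β l i j) {τ : ℕ} {p : ℝ}
    (hp : 0 < p) (hτ : 0 < τ) (l i : Fin L) (j : Fin K) : betaHat β τ p l i j < β l i j := by
  unfold betaHat
  have h1 : β l i j ≤ ∑ i', β l i' j :=
    Finset.single_le_sum (f := fun i' => β l i' j) (fun i' _ => (hβ l i' j).le) (Finset.mem_univ i)
  have h2 := hβ l i j
  have h3 : 0 < 1 / ((τ : ℝ) * p) := by positivity
  rw [div_lt_iff₀ (by linarith)]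
  nlinarith

lemma errVar_pos {β : Fin L → Fin L → Fin K → ℝ} (hβ : ∀ l i j, 0 < β l i j) {τ : ℕ} {p α : ℝ}
    (hp : 0 < p) (hτ : 0 < τ) (hα : |α| ≤ 1) (l : Fin L) (s : Fin L × Fin K) :
    0 < errVar β τ p α l s := by
  unfold errVar
  have h1 := betaHat_lt hβ hp hτ l s.1 s.2
  have h2 := betaHat_pos hβ (τ := τ) hp l s.1 s.2
  have h3 : α ^ 2 ≤ 1 := (sq_le_one_iff_abs_le_one α).2 hα
  nlinarith

lemma pilotC_pos {β : Fin L → Fin L → Fin K → ℝ} (hβ : ∀ l i j, 0 < β l i j) (hL : 2 ≤ L)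
    (l : Fin L) (k : Fin K) : 0 < pilotC β l k := by
  unfold pilotC
  refine Finset.sum_pos (fun i _ => ?_) ?_
  · have := hβ l i k
    have := hβ l l k
    positivity
  · rw [← Finset.card_pos, Finset.card_erase_of_mem (Finset.mem_univ _), Finset.card_univ,
      Fintype.card_fin]
    omega

lemma rowNormSq_nonneg {m n : ℕ} (W : Matrix (Fin m) (Fin n) ℂ) (k : Fin m) :
    0 ≤ rowNormSq W k := by
  unfold rowNormSq; positivity

/-- Pilot reuse makes the interfering estimate Ĝ times a diagonal matrix, and zero forcing cancels
Ĝ, so the contamination is not random. -/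
lemma rowNormSq_pinv_mul_crossEstimate {G : Matrix (Fin N) (Fin K) ℂ}
    (h : LinearIndependent ℂ (colVec G)) (β : Fin L → Fin L → Fin K → ℝ) (l i : Fin L)
    (k : Fin K) :
    rowNormSq (pinv G * crossEstimate β l i G) k = (β l i k / β l l k) ^ 2 := by
  rw [crossEstimate, ← Matrix.mul_assoc, pinv_mul_self h, Matrix.one_mul, rowNormSq,
    Finset.sum_eq_single k]
  · rw [Matrix.diagonal_apply_eq, Complex.norm_real, Real.norm_eq_abs, sq_abs]
  · intro j _ hj
    rw [Matrix.diagonal_apply_ne _ hj.symm]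
    simp
  · simp

/-- The noise power after zero forcing, relative to the power of the filter. -/
noncomputable def noisePower (α : ℝ) (k : Fin K) (G : Matrix (Fin N) (Fin K) ℂ)
    (Gtil E : Fin L → Matrix (Fin N) (Fin K) ℂ) : ℝ :=
  (rowNormSq (pinv G) k)⁻¹ * ∑ i, rowNormSq (pinv G * combinedError α (Gtil i) (E i)) k

lemma noisePower_nonneg (α : ℝ) (k : Fin K) (G : Matrix (Fin N) (Fin K) ℂ)
    (Gtil E : Fin L → Matrix (Fin N) (Fin K) ℂ) : 0 ≤ noisePower α k G Gtil E :=
  mul_nonneg (inv_nonneg.2 (rowNormSq_nonneg _ _)) (Finset.sum_nonneg fun _ _ => rowNormSq_nonneg _ _)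

/-- Division by the squared filter norm isolates the two quantities, `noisePower` and the reciprocal
norm, whose joint Laplace transform factors. -/
lemma one_add_zfSINR {G : Matrix (Fin N) (Fin K) ℂ} (h : LinearIndependent ℂ (colVec G))
    {β : Fin L → Fin L → Fin K → ℝ} {p : ℝ} (hp : 0 < p) (α : ℝ) (l : Fin L) (k : Fin K)
    (Gtil E : Fin L → Matrix (Fin N) (Fin K) ℂ) :
    1 + zfSINR β p α l k G Gtil E =
      (p * noisePower α k G Gtil E + 1 + α ^ 2 * p * (pilotC β l k + 1) * (rowNormSq (pinv G) k)⁻¹) /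
      (p * noisePower α k G Gtil E + 1 + α ^ 2 * p * pilotC β l k * (rowNormSq (pinv G) k)⁻¹) := by
  have hn := rowNormSq_pinv_pos h k
  have hC : 0 ≤ pilotC β l k := by unfold pilotC; positivity
  unfold zfSINR noisePower
  simp_rw [rowNormSq_pinv_mul_crossEstimate h β l]
  rw [← pilotC]
  have hS : 0 ≤ ∑ i, rowNormSq (pinv G * combinedError α (Gtil i) (E i)) k :=
    Finset.sum_nonneg fun _ _ => rowNormSq_nonneg _ _
  generalize ∑ i, rowNormSq (pinv G * combinedError α (Gtil i) (E i)) k = S at hS ⊢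
  generalize rowNormSq (pinv G) k = n at hn ⊢
  generalize pilotC β l k = C at hC ⊢
  have h1 : 0 < α ^ 2 * p * C + p * S + n := by positivity
  have h2 : 0 < p * S + n + α ^ 2 * p * C := by positivity
  have e1 : p * (n⁻¹ * S) + 1 + α ^ 2 * p * C * n⁻¹ = (α ^ 2 * p * C + p * S + n) / n := by
    field_simp; ring
  have e2 : p * (n⁻¹ * S) + 1 + α ^ 2 * p * (C + 1) * n⁻¹ =
      (α ^ 2 * p * C + p * S + n + α ^ 2 * p) / n := by
    field_simp; ring
  rw [e1, e2, div_div_div_cancel_right₀ hn.ne', add_comm 1, div_add_one h1.ne', add_comm (α ^ 2 * p)]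

/-- The law of the entries of the estimation errors and of the innovations. -/
noncomputable def noiseEntries (N : ℕ) (e f : Fin L → Fin K → ℝ) :
    Measure ((Fin L × Fin N × Fin K) ⊕ (Fin L × Fin N × Fin K) → ℂ) :=
  Measure.pi fun s => complexGaussian
    (Sum.elim (fun t : Fin L × Fin N × Fin K => e t.1 t.2.2) (fun t => f t.1 t.2.2) s)

instance (e f : Fin L → Fin K → ℝ) : IsProbabilityMeasure (noiseEntries N e f) := by
  unfold noiseEntries; infer_instance

/-- The entries of all the random matrices at a base station. -/
def channelEntries {Ω : Type*} (Ghat : Ω → Matrix (Fin N) (Fin K) ℂ)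
    (Gtil E : Fin L → Ω → Matrix (Fin N) (Fin K) ℂ) (ω : Ω) :
    (Fin N × Fin K → ℂ) × ((Fin L × Fin N × Fin K) ⊕ (Fin L × Fin N × Fin K) → ℂ) :=
  (fun s => Ghat ω s.1 s.2,
    Sum.elim (fun t => Gtil t.1 ω t.2.1 t.2.2) (fun t => E t.1 ω t.2.1 t.2.2))

/-- Transfers expectations to a product space, where the noise can be integrated with the estimate
held fixed. -/
lemma hasLaw_channelEntries {Ω : Type*} [MeasurableSpace Ω] {P : Measure Ω}
    [IsProbabilityMeasure P] {β : Fin L → Fin L → Fin K → ℝ} {τ : ℕ} {p α : ℝ} {l : Fin L}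
    {Ghat : Ω → Matrix (Fin N) (Fin K) ℂ} {Gtil E : Fin L → Ω → Matrix (Fin N) (Fin K) ℂ}
    (h : IsChannelModel P β τ p α l Ghat Gtil E) :
    HasLaw (channelEntries Ghat Gtil E)
      ((gaussianEntries N fun j => betaHat β τ p l l j).prod
        (noiseEntries N (fun i j => β l i j - betaHat β τ p l i j)
          fun i j => (1 - α ^ 2) * β l i j)) P := by
  set V : (Fin N × Fin K) ⊕ ((Fin L × Fin N × Fin K) ⊕ (Fin L × Fin N × Fin K)) → ℝ :=
    Sum.elim (fun s => betaHat β τ p l l s.2)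
      (Sum.elim (fun t => β l t.1 t.2.2 - betaHat β τ p l t.1 t.2.2)
        (fun t => (1 - α ^ 2) * β l t.1 t.2.2)) with hV
  set Z : (Fin N × Fin K) ⊕ ((Fin L × Fin N × Fin K) ⊕ (Fin L × Fin N × Fin K)) → Ω → ℂ :=
    fun s ω => match s with
      | Sum.inl (a, j) => Ghat ω a j
      | Sum.inr (Sum.inl (i, a, j)) => Gtil i ω a j
      | Sum.inr (Sum.inr (i, a, j)) => E i ω a j with hZ
  have hlaw : ∀ s, HasLaw (Z s) (complexGaussian (V s)) P := by
    rintro (⟨a, j⟩ | ⟨i, a, j⟩ | ⟨i, a, j⟩)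
    · exact h.estimate_law a j
    · exact h.error_law i a j
    · exact h.innovation_law i a j
  have hjoint : HasLaw (fun ω s => Z s ω) (Measure.pi fun s => complexGaussian (V s)) P := by
    refine ⟨aemeasurable_pi_lambda _ fun s => (hlaw s).aemeasurable, ?_⟩
    rw [(iIndepFun_iff_map_fun_eq_pi_map fun s => (hlaw s).aemeasurable).1 h.indep]
    congr
    funext s
    exact (hlaw s).map_eq
  have hmp := measurePreserving_sumPiEquivProdPi (fun s => complexGaussian (V s))
  have := hmp.comp_hasLaw hjoint
  refine HasLaw.congr this (Filter.Eventually.of_forall fun ω => ?_)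
  refine Prod.ext (funext fun s => rfl) (funext fun t => ?_)
  rcases t with t | t <;> rfl

lemma measurable_noisePower (α : ℝ) (k : Fin K) :
    Measurable fun x : (Fin N × Fin K → ℂ) × ((Fin L × Fin N × Fin K) ⊕ (Fin L × Fin N × Fin K) → ℂ) =>
      noisePower α k (Matrix.of fun a j => x.1 (a, j))
        (fun i => Matrix.of fun a j => x.2 (Sum.inl (i, a, j)))
        (fun i => Matrix.of fun a j => x.2 (Sum.inr (i, a, j))) := by
  unfold noisePower
  refine ((measurable_rowNormSq_pinv k).comp measurable_fst).inv.mul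
    (Finset.measurable_sum _ fun i _ => ?_)
  unfold rowNormSq
  refine Finset.measurable_sum _ fun j _ => (Measurable.norm ?_).pow_const 2
  simp only [Matrix.mul_apply, combinedError, Matrix.add_apply, Matrix.smul_apply, Matrix.of_apply]
  refine Finset.measurable_sum _ fun a _ => ?_
  exact ((measurable_pinv_apply k a).comp measurable_fst).mul (by fun_prop)

/-- With Ĝ fixed, the noise transform is evaluated at zp/‖row‖², while the noise variances carry a
factor ‖row‖². The two cancel, so only the reciprocal norm still depends on Ĝ; this is the
independence of X and Y. -/
lemma integral_exp_noisePower (hKN : K ≤ N) {v : Fin K → ℝ} (hv : ∀ j, 0 < v j)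
    {e f : Fin L → Fin K → ℝ} (he : ∀ i j, 0 ≤ e i j) (hf : ∀ i j, 0 ≤ f i j) (k : Fin K)
    (α : ℝ) {p z r : ℝ} (hp : 0 < p) (hz : 0 < z) (hr : 0 ≤ r) :
    ∫ x, Real.exp (-(z * (p * noisePower α k (Matrix.of fun a j => x.1 (a, j))
        (fun i => Matrix.of fun a j => x.2 (Sum.inl (i, a, j)))
        (fun i => Matrix.of fun a j => x.2 (Sum.inr (i, a, j))) + 1 +
        r * (rowNormSq (pinv (Matrix.of fun a j => x.1 (a, j))) k)⁻¹)))
      ∂((gaussianEntries N v).prod (noiseEntries N e f)) =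
    Real.exp (-z) * (∏ s : Fin L × Fin K, (1 + (α ^ 2 * e s.1 s.2 + f s.1 s.2) * (p * z))⁻¹) *
      ((1 + v k * (z * r)) ^ (N - K + 1))⁻¹ := by
  have hX : ∀ x : Fin N × Fin K → ℂ, 0 ≤ (rowNormSq (pinv (Matrix.of fun a j => x (a, j))) k)⁻¹ :=
    fun x => inv_nonneg.2 (rowNormSq_nonneg _ _)
  rw [integral_prod]
  · rw [show 1 + v k * (z * r) = 1 + z * r * v k by ring,
      ← integral_exp_inv_rowNormSq_pinv hKN hv k (by positivity : 0 ≤ z * r), ← integral_const_mul]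
    refine integral_congr_ae ?_
    filter_upwards [ae_linearIndependent_colVec hKN hv] with x hx
    have hn := rowNormSq_pinv_pos hx k
    have hN := integral_exp_rowNormSq_noise he hf α (pinv (Matrix.of fun a j => x (a, j))) k
      (mul_nonneg (by positivity : 0 ≤ z * p) (hX x))
    have h1 : ∀ T : (Fin L × Fin N × Fin K) ⊕ (Fin L × Fin N × Fin K) → ℂ,
        Real.exp (-(z * (p * noisePower α k (Matrix.of fun a j => x (a, j))
          (fun i => Matrix.of fun a j => T (Sum.inl (i, a, j)))
          (fun i => Matrix.of fun a j => T (Sum.inr (i, a, j))) + 1 +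
          r * (rowNormSq (pinv (Matrix.of fun a j => x (a, j))) k)⁻¹))) =
        Real.exp (-z) * Real.exp (-(z * r * (rowNormSq (pinv (Matrix.of fun a j => x (a, j))) k)⁻¹)) *
        Real.exp (-(z * p * (rowNormSq (pinv (Matrix.of fun a j => x (a, j))) k)⁻¹ *
          ∑ i, rowNormSq (pinv (Matrix.of fun a j => x (a, j)) * combinedError α
            (Matrix.of fun a j => T (Sum.inl (i, a, j)))
            (Matrix.of fun a j => T (Sum.inr (i, a, j)))) k)) := by
      intro T
      rw [← Real.exp_add, ← Real.exp_add, noisePower]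
      congr 1
      ring
    simp_rw [h1]
    rw [integral_const_mul, noiseEntries, hN]
    have h2 : ∀ s : Fin L × Fin K,
        1 + z * p * (rowNormSq (pinv (Matrix.of fun a j => x (a, j))) k)⁻¹ *
          (rowNormSq (pinv (Matrix.of fun a j => x (a, j))) k * (α ^ 2 * e s.1 s.2 + f s.1 s.2)) =
        1 + (α ^ 2 * e s.1 s.2 + f s.1 s.2) * (p * z) := fun s => by
      field_simp
    simp_rw [h2]
    ring
  · refine Integrable.mono' (integrable_const (1 : ℝ)) ?_ (Filter.Eventually.of_forall fun x => ?_)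
    · have h1 := measurable_noisePower (N := N) (L := L) α k
      have h2 : Measurable fun x : (Fin N × Fin K → ℂ) ×
          ((Fin L × Fin N × Fin K) ⊕ (Fin L × Fin N × Fin K) → ℂ) =>
          rowNormSq (pinv (Matrix.of fun (a : Fin N) j => x.1 (a, j))) k :=
        (measurable_rowNormSq_pinv k).comp measurable_fst
      exact ((((h1.const_mul p).add_const 1).add
        (h2.inv.const_mul r)).const_mul z).neg.exp.aestronglyMeasurable
    · rw [Real.norm_eq_abs, abs_of_pos (Real.exp_pos _), Real.exp_le_one_iff, neg_nonpos]
      have h1 := noisePower_nonneg α k (Matrix.of fun a j => x.1 (a, j))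
        (fun i : Fin L => Matrix.of fun a j => x.2 (Sum.inl (i, a, j)))
        (fun i => Matrix.of fun a j => x.2 (Sum.inr (i, a, j)))
      have h2 := hX x.1
      positivity

end Rate

/-! ### Transfer to the channel model and the rate formula. -/

lemma aemeasurable_noisePower {Ω : Type*} [MeasurableSpace Ω] {P : Measure Ω} [IsProbabilityMeasure P]
    {N K L τ : ℕ} {β : Fin L → Fin L → Fin K → ℝ} {p α : ℝ} {l : Fin L}
    {Ghat : Ω → Matrix (Fin N) (Fin K) ℂ} {Gtil E : Fin L → Ω → Matrix (Fin N) (Fin K) ℂ}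
    (h : IsChannelModel P β τ p α l Ghat Gtil E) (k : Fin K) :
    AEMeasurable (fun ω => noisePower α k (Ghat ω) (fun i => Gtil i ω) (fun i => E i ω)) P :=
  AEMeasurable.congr ((measurable_noisePower α k).comp_aemeasurable
    (hasLaw_channelEntries h).aemeasurable) (Filter.Eventually.of_forall fun _ => rfl)

lemma aemeasurable_rowNormSq_pinv {Ω : Type*} [MeasurableSpace Ω] {P : Measure Ω} [IsProbabilityMeasure P]
    {N K L τ : ℕ} {β : Fin L → Fin L → Fin K → ℝ} {p α : ℝ} {l : Fin L}
    {Ghat : Ω → Matrix (Fin N) (Fin K) ℂ} {Gtil E : Fin L → Ω → Matrix (Fin N) (Fin K) ℂ}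
    (h : IsChannelModel P β τ p α l Ghat Gtil E) (k : Fin K) :
    AEMeasurable (fun ω => rowNormSq (pinv (Ghat ω)) k) P :=
  AEMeasurable.congr ((measurable_rowNormSq_pinv k).comp_aemeasurable
    (measurable_fst.comp_aemeasurable (hasLaw_channelEntries h).aemeasurable))
    (Filter.Eventually.of_forall fun _ => rfl)

lemma ae_linearIndependent_estimate {Ω : Type*} [MeasurableSpace Ω] {P : Measure Ω} [IsProbabilityMeasure P]
    {N K L τ : ℕ} {β : Fin L → Fin L → Fin K → ℝ} {p α : ℝ} {l : Fin L}
    {Ghat : Ω → Matrix (Fin N) (Fin K) ℂ} {Gtil E : Fin L → Ω → Matrix (Fin N) (Fin K) ℂ}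
    (h : IsChannelModel P β τ p α l Ghat Gtil E) (hKN : K ≤ N)
    (hβ : ∀ l i j, 0 < β l i j) (hp : 0 < p) :
    ∀ᵐ ω ∂P, LinearIndependent ℂ (colVec (Ghat ω)) := by
  have hlaw := hasLaw_channelEntries h
  have h1 := ae_linearIndependent_colVec hKN (v := fun j => betaHat β τ p l l j)
    fun j => betaHat_pos hβ hp l l j
  have h2 := (Measure.quasiMeasurePreserving_fst (ν := noiseEntries N
    (fun i j => β l i j - betaHat β τ p l i j) fun i j => (1 - α ^ 2) * β l i j)).ae h1
  rw [← hlaw.map_eq] at h2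
  exact ae_of_ae_map hlaw.aemeasurable h2

/-- The Laplace transform of the noise power, plus one, plus a multiple of the reciprocal of the
squared norm of the zero-forcing filter. -/
lemma integral_exp_noisePower_channel {Ω : Type*} [MeasurableSpace Ω] {P : Measure Ω} [IsProbabilityMeasure P]
    {N K L τ : ℕ} {β : Fin L → Fin L → Fin K → ℝ} {p α : ℝ} {l : Fin L}
    {Ghat : Ω → Matrix (Fin N) (Fin K) ℂ} {Gtil E : Fin L → Ω → Matrix (Fin N) (Fin K) ℂ}
    (h : IsChannelModel P β τ p α l Ghat Gtil E) (hKN : K ≤ N)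
    (hβ : ∀ l i j, 0 < β l i j) (hp : 0 < p) (hτ : 0 < τ) (hα : |α| ≤ 1) (k : Fin K) {z r : ℝ}
    (hz : 0 < z) (hr : 0 ≤ r) :
    ∫ ω, Real.exp (-(z * (p * noisePower α k (Ghat ω) (fun i => Gtil i ω) (fun i => E i ω) + 1 +
        r * (rowNormSq (pinv (Ghat ω)) k)⁻¹))) ∂P =
      Real.exp (-z) * (∏ i, (1 + errVar β τ p α l i * (p * z))⁻¹) *
        ((1 + betaHat β τ p l l k * (z * r)) ^ (N - K + 1))⁻¹ := by
  have hlaw := hasLaw_channelEntries h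
  have hα2 : α ^ 2 ≤ 1 := (sq_le_one_iff_abs_le_one α).2 hα
  have h1 := integral_exp_noisePower hKN (v := fun j => betaHat β τ p l l j)
    (fun j => betaHat_pos hβ hp l l j)
    (e := fun i j => β l i j - betaHat β τ p l i j) (f := fun i j => (1 - α ^ 2) * β l i j)
    (fun i j => sub_nonneg.2 (betaHat_lt hβ hp hτ l i j).le)
    (fun i j => mul_nonneg (sub_nonneg.2 hα2) (hβ l i j).le) k α hp hz hr
  -- The estimation error, scaled by α, and the innovation add up to the variance of an entry of the
  -- combined error, a diagonal entry of 𝒜.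
  have h2 : ∀ s : Fin L × Fin K, α ^ 2 * (β l s.1 s.2 - betaHat β τ p l s.1 s.2) +
      (1 - α ^ 2) * β l s.1 s.2 = errVar β τ p α l s := fun s => by
    rw [errVar]; ring
  simp_rw [h2] at h1
  rw [← h1]
  exact hlaw.integral_comp
    (((((measurable_noisePower α k).const_mul p).add_const 1).add
      (((measurable_rowNormSq_pinv k).comp measurable_fst).inv.const_mul
        r)).const_mul z).neg.exp.aestronglyMeasurable

theorem theorem1
    {Ω : Type*} [MeasurableSpace Ω] (P : Measure Ω) [IsProbabilityMeasure P]
    (N K L τ : ℕ) (hL : 2 ≤ L) (hKN : K ≤ N) (hKτ : K ≤ τ)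
    (β : Fin L → Fin L → Fin K → ℝ) (hβ : ∀ l i j, 0 < β l i j)
    (p α : ℝ) (hp : 0 < p) (hα : α ≠ 0) (hα1 : |α| ≤ 1)
    (l : Fin L) (k : Fin K)
    (Ghat : Ω → Matrix (Fin N) (Fin K) ℂ) (Gtil E : Fin L → Ω → Matrix (Fin N) (Fin K) ℂ)
    (hmodel : IsChannelModel P β τ p α l Ghat Gtil E)
    -- no third argument of `calJ` in the closed form vanishes
    (hnd : ∀ s : Fin L × Fin K,
      1 / errVar β τ p α l s
          - 1 / (betaHat β τ p l l k * α ^ 2 * (pilotC β l k + 1)) ≠ 0 ∧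
        1 / errVar β τ p α l s - 1 / (betaHat β τ p l l k * α ^ 2 * pilotC β l k) ≠ 0) :
    Integrable
        (fun ω => Real.logb 2 (1 + zfSINR β p α l k (Ghat ω) (fun i => Gtil i ω)
          (fun i => E i ω))) P ∧
      ergodicRate P (fun ω => zfSINR β p α l k (Ghat ω) (fun i => Gtil i ω) (fun i => E i ω)) =
        rateClosedForm (errVar β τ p α l) (N - K) (betaHat β τ p l l k) α p (pilotC β l k) ∧
      (Function.Injective (errVar β τ p α l) →
        (distinctEntries (errVar β τ p α l)).card = K * L ∧
        (∀ s, entryMult (errVar β τ p α l) (errVar β τ p α l s) = 1) ∧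
        (∀ s, charCoeff (errVar β τ p α l) (errVar β τ p α l s) 1 =
          ∏ s' ∈ Finset.univ.erase s, (1 - errVar β τ p α l s' / errVar β τ p α l s)⁻¹) ∧
        ergodicRate P
            (fun ω => zfSINR β p α l k (Ghat ω) (fun i => Gtil i ω) (fun i => E i ω)) =
          rateClosedFormDistinct (errVar β τ p α l) (N - K) (betaHat β τ p l l k) α p
            (pilotC β l k)) := by
  have hτ : 0 < τ := k.pos.trans_le hKτ
  have hd := errVar_pos hβ (α := α) hp hτ hα1 l
  have hC := pilotC_pos hβ hL l k
  have hs : 0 < betaHat β τ p l l k := betaHat_pos hβ hp l l k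
  have hA : 0 < α ^ 2 * p := by positivity
  have : Nonempty (Fin L × Fin K) := ⟨(l, k)⟩
  set Q : Ω → ℝ := fun ω =>
    p * noisePower α k (Ghat ω) (fun i => Gtil i ω) (fun i => E i ω) + 1 with hQ
  set X : Ω → ℝ := fun ω => (rowNormSq (pinv (Ghat ω)) k)⁻¹ with hX
  have hQm : AEMeasurable Q P := ((aemeasurable_noisePower hmodel k).const_mul p).add_const 1
  have hXm : AEMeasurable X P := (aemeasurable_rowNormSq_pinv hmodel k).inv
  have hpos : ∀ᵐ ω ∂P, 0 < Q ω ∧ 0 ≤ X ω := Filter.Eventually.of_forall fun ω =>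
    ⟨by have := noisePower_nonneg α k (Ghat ω) (fun i => Gtil i ω) (fun i => E i ω); positivity,
      inv_nonneg.2 (rowNormSq_nonneg _ _)⟩
  have hF : ∀ z c, 0 < z → 0 < c →
      ∫ ω, Real.exp (-(z * (Q ω + α ^ 2 * p * c * X ω))) ∂P =
        Real.exp (-z) * (∏ i, (1 + errVar β τ p α l i * (p * z))⁻¹) *
          ((1 + betaHat β τ p l l k * (z * (α ^ 2 * p) * c)) ^ (N - K + 1))⁻¹ := by
    intro z c hz hc
    simp_rw [mul_assoc z]
    exact integral_exp_noisePower_channel hmodel hKN hβ hp hτ hα1 k hz (by positivity)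
  -- This holds only almost everywhere, since the rewriting of the SINR needs Ĝ of full column rank.
  have hlog : (fun ω => Real.log ((Q ω + α ^ 2 * p * (pilotC β l k + 1) * X ω) /
        (Q ω + α ^ 2 * p * pilotC β l k * X ω)) / Real.log 2) =ᵐ[P]
      fun ω => Real.logb 2 (1 + zfSINR β p α l k (Ghat ω) (fun i => Gtil i ω)
        (fun i => E i ω)) := by
    filter_upwards [ae_linearIndependent_estimate hmodel hKN hβ hp] with ω hω
    rw [one_add_zfSINR hω hp, Real.logb]
  have hrate : ergodicRate P
      (fun ω => zfSINR β p α l k (Ghat ω) (fun i => Gtil i ω) (fun i => E i ω)) =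
      rateClosedForm (errVar β τ p α l) (N - K) (betaHat β τ p l l k) α p (pilotC β l k) := by
    -- Rate and closed form both equal the same integral of Laplace transforms, divided by log 2.
    rw [ergodicRate, ← integral_congr_ae hlog, integral_div,
      (integral_log_ratio_eq hQm hXm hpos hA hC hF).2,
      rateClosedForm_eq_integral hd (N - K) hs hα hp hC hnd, div_eq_inv_mul]
  refine ⟨((integrable_log_ratio hQm hXm hpos hA hC).div_const _).congr hlog, hrate,
    fun hinj => ⟨?_, entryMult_eq_one hinj, fun s => ?_, ?_⟩⟩
  · rw [card_distinctEntries hinj, Fintype.card_prod, Fintype.card_fin, Fintype.card_fin, mul_comm]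
  · exact charCoeff_one_eq_prod hinj s
  · rw [hrate, rateClosedForm_eq_distinct hinj hd (N - K) hs hα hp hC]
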